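/- Work in homotopy type theory (dependent type theory with $\Pi$, $\Sigma$, identity types, $\mathbb{N}$, a cumulative hierarchy of univalent universes, function extensionality, and the higher inductive types of pushouts, propositional truncations and nullifications). Let $\mathcal{U}$ be a universe and let $T : I \to \mathcal{U}$ be a collection of types, where the index type $I$ may lie in any universe. For $Y : \mathcal{U}$ write $Y \in T$ if there merely exists $x : I$ with $T(x) = Y$. A type $X : \mathcal{U}$ is a $T$-sheaf if it is modal for the nullification at the family of propositions $x \mapsto \|T(x)\|$, that is, if the unit map from $X$ to its nullification is an equivalence. A $T$-cover is a map $f : A \to B$ of types in $\mathcal{U}$ such that $\mathrm{fib}_f(b) \in T$ for every $b : B$. For maps $f : A \to B$ and $g : C \to B$, the join $f * g : A *_B C \to B$ is the map induced by $f$ and $g$ on the pushout $A *_B C$ of the projections $A \leftarrow A \times_B C \to C$. The iterated join $f^{*n} : A^{*_B n} \to B$ is defined by letting $f^{*0}$ be the map $0 \to B$ from the empty type and $f^{*(n+1)} = f * f^{*n}$. Sheaf condition. The following are theorems of homotopy type theory, for every choice of the universes of $I$ and of the types in $T$, and for all collections $T$. 1. Let $n : \mathbb{N}$ (so $n \ge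 0$) and let $X : \mathcal{U}$ be an $(n-2)$-type. Then $X$ is a $T$-sheaf if and only if, for every $T$-cover $f : A \to B$, precomposition with $f^{*n}$, as a map $(B \to X) \to (A^{*_B n} \to X)$, is an equivalence. 2. Let $X : \mathcal{U}$ be a set. Then $X$ is a $T$-sheaf if and only if, for every $T$-cover $f : A \to B$, the map $g \mapsto g \circ f$ from $(B \to X)$ to the equaliser of the two maps $(A \to X) \rightrightarrows (A \times_B A \to X)$ given by the two projections $A \times_B A \to A$ is an equivalence. -/

import Mathlib

/-! # Homotopy type theory as a formal system

Raw terms, judgements and inference rules of homotopy type theory: dependent functions with the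
beta and eta rules, a cumulative hierarchy of universes à la Russell, the inductive types
`0`, `1`, `ℕ`, `A + B`, `Σ (x : A), B x`, `x = y`, function extensionality, univalence, and the
higher inductive types used below: pushouts, propositional truncations, nullifications.
Point constructors of higher inductive types compute judgementally, path constructors compute
up to a path. -/

namespace HoTT

/-! ## Raw terms -/

/-- The primitive constants other than universes and dependent functions.
The arguments are universe levels: `i` is the level of the types that a type former takes, and `k`
is the level of the motive of an induction principle. -/
inductive Const : Type
  | empty | emptyInd (k : ℕ)
  | unit | star | unitInd (k : ℕ)
  | nat | zero | succ | natInd (k : ℕ)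
  | sum (i : ℕ) | sumInl (i : ℕ) | sumInr (i : ℕ) | sumInd (i k : ℕ)
  | sig (i : ℕ) | pair (i : ℕ) | sigInd (i k : ℕ)
  | id (i : ℕ) | refl (i : ℕ) | idInd (i k : ℕ)
  | funext (i : ℕ)
  | univalence (i : ℕ)
  | pushout (i : ℕ) | inl (i : ℕ) | inr (i : ℕ) | glue (i : ℕ)
  | pushoutInd (i k : ℕ) | pushoutIndGlue (i k : ℕ)
  | trunc (i : ℕ) | tr (i : ℕ) | squash (i : ℕ)
  | truncInd (i k : ℕ) | truncIndSquash (i k : ℕ)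
  -- The nullification of `X` at `B : A → U i` has the unit `eta` and, for each `a : A`, a right
  -- inverse `sec` and a left inverse `ret` of the diagonal map to the functions on `B a`.
  | null (i : ℕ) | eta (i : ℕ)
  | sec (i : ℕ) | isSec (i : ℕ) | ret (i : ℕ) | isRet (i : ℕ)
  | nullInd (i k : ℕ) | nullIndSec (i k : ℕ) | nullIndRet (i k : ℕ)

/-- Raw terms with de Bruijn indices. Types are terms. -/
inductive Tm : Type
  | var (n : ℕ)
  | univ (i : ℕ)
  | pi (A B : Tm)
  | lam (A b : Tm)
  | app (f a : Tm)
  | const (c : Const)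

namespace Tm

/-- A renaming under one binder. -/
def liftRen (r : ℕ → ℕ) : ℕ → ℕ
  | 0 => 0
  | n + 1 => r n + 1

/-- Renaming of variables. -/
def rename : (ℕ → ℕ) → Tm → Tm
  | r, var n => var (r n)
  | _, univ i => univ i
  | r, pi A B => pi (A.rename r) (B.rename (liftRen r))
  | r, lam A b => lam (A.rename r) (b.rename (liftRen r))
  | r, app f a => app (f.rename r) (a.rename r)
  | _, const c => const c

/-- Weakening by `n` variables. -/
def shift (n : ℕ) (a : Tm) : Tm := a.rename (fun m => m + n)

/-- A substitution under one binder. -/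
def liftSub (s : ℕ → Tm) : ℕ → Tm
  | 0 => var 0
  | n + 1 => (s n).shift 1

/-- Simultaneous substitution. -/
def subst : (ℕ → Tm) → Tm → Tm
  | s, var n => s n
  | _, univ i => univ i
  | s, pi A B => pi (A.subst s) (B.subst (liftSub s))
  | s, lam A b => lam (A.subst s) (b.subst (liftSub s))
  | s, app f a => app (f.subst s) (a.subst s)
  | _, const c => const c

/-- The substitution that sends variable `0` to `a` and lowers the other variables by one. -/
def single (a : Tm) : ℕ → Tm
  | 0 => a
  | n + 1 => var n

/-- `b.inst a` is `b[a/x]`, where `x` is variable `0`. -/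
def inst (b a : Tm) : Tm := b.subst (single a)

end Tm

/-! ## Named variables

To write terms with named variables, a term is represented by the function that sends the number
of variables in scope to the raw term in that scope; a binder passes its variable to its body. -/

/-- A raw term as a function of the number of variables in scope. -/
structure Term where
  /-- The raw term in a scope with the given number of variables. -/
  at_ : ℕ → Tm

namespace Term

/-- The raw term in the empty scope. -/
def close (t : Term) : Tm := t.at_ 0

/-- The variable bound by a binder that is met below `d` other variables. -/
def bound (d : ℕ) : Term := ⟨fun e => .var (e - (d + 1))⟩

def app (f a : Term) : Term := ⟨fun d => .app (f.at_ d) (a.at_ d)⟩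

instance : CoeFun Term (fun _ => Term → Term) := ⟨app⟩

end Term

/-- The universe `U i`. -/
def U (i : ℕ) : Term := ⟨fun _ => .univ i⟩

/-- A constant. -/
def cst (c : Const) : Term := ⟨fun _ => .const c⟩

/-- The dependent function type `Π (x : A), B x`. -/
def Pi (A : Term) (B : Term → Term) : Term :=
  ⟨fun d => .pi (A.at_ d) ((B (Term.bound d)).at_ (d + 1))⟩

/-- The function `λ (x : A), b x`. -/
def Lam (A : Term) (b : Term → Term) : Term :=
  ⟨fun d => .lam (A.at_ d) ((b (Term.bound d)).at_ (d + 1))⟩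

/-- The type of non-dependent functions. -/
def arr (A B : Term) : Term := Pi A fun _ => B

infixr:30 " ⇾ " => arr

/-- A closed judgemental equality `lhs ≡ rhs : type`. -/
structure Eqn where
  lhs : Term
  rhs : Term
  type : Term

/-- Things that can be generalised over a variable: types (by a dependent function type), and
equations (by abstraction on both sides). -/
class Generalize (α : Type) where
  all : Term → (Term → α) → α

instance : Generalize Term := ⟨Pi⟩

instance : Generalize Eqn :=
  ⟨fun A e => ⟨Lam A fun x => (e x).lhs, Lam A fun x => (e x).rhs, Pi A fun x => (e x).type⟩⟩

open Generalize (all)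

/-! ## Basic constructions

Definitions inside the type theory are closed terms, with universe levels as parameters; as far as
possible they are functions of their arguments. -/

/-- The identity type `x = y` of elements of `A : U i`, as `Id i A x y`. -/
def Id (i : ℕ) : Term := cst (.id i)

/-- The reflexivity path `x = x`, as `idp i A x`. -/
def idp (i : ℕ) : Term := cst (.refl i)

/-- `Σ (x : A), B x` for `A : U i` and `B x : U i`. -/
def Sig (i : ℕ) (A : Term) (B : Term → Term) : Term := cst (.sig i) A (Lam A B)

/-- The product `A × B`. -/
def Prod (i : ℕ) (A B : Term) : Term := Sig i A fun _ => B

/-- The pair `(a, b) : Σ (x : A), B x`. -/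
def mk (i : ℕ) (A : Term) (B : Term → Term) (a b : Term) : Term :=
  cst (.pair i) A (Lam A B) a b

/-- The first projection: `fst i A B p : A` for `p : Σ (x : A), B x`. -/
def fst (i : ℕ) : Term :=
  Lam (U i) fun A => Lam (A ⇾ U i) fun B => Lam (cst (.sig i) A B) fun p =>
    cst (.sigInd i i) A B (Lam (cst (.sig i) A B) fun _ => A)
      (Lam A fun a => Lam (B a) fun _ => a) p

/-- The second projection: `snd i A B p : B (fst i A B p)` for `p : Σ (x : A), B x`. -/
def snd (i : ℕ) : Term :=
  Lam (U i) fun A => Lam (A ⇾ U i) fun B => Lam (cst (.sig i) A B) fun p =>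
    cst (.sigInd i i) A B (Lam (cst (.sig i) A B) fun q => B (fst i A B q))
      (Lam A fun a => Lam (B a) fun b => b) p

/-- `transport i k A P x y p u : P y` for `p : x = y` in `A : U i` and `u : P x`, where
`P : A → U k`. -/
def transport (i k : ℕ) : Term :=
  Lam (U i) fun A => Lam (A ⇾ U k) fun P => Lam A fun x => Lam A fun y =>
  Lam (Id i A x y) fun p => Lam (P x) fun u =>
    cst (.idInd i k) A x (Lam A fun z => Lam (Id i A x z) fun _ => P z) u y p

/-- `apd i k A P f x y p` is the path `transport p (f x) = f y` for `f : Π (x : A), P x` and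
`p : x = y`. -/
def apd (i k : ℕ) : Term :=
  Lam (U i) fun A => Lam (A ⇾ U k) fun P => Lam (Pi A fun x => P x) fun f =>
  Lam A fun x => Lam A fun y => Lam (Id i A x y) fun p =>
    cst (.idInd i k) A x
      (Lam A fun z => Lam (Id i A x z) fun q =>
        Id k (P z) (transport i k A P x z q (f x)) (f z))
      (idp k (P x) (f x)) y p

/-- `ap i A B f x y p` is the path `f x = f y` for `f : A → B` and `p : x = y`, where
`A B : U i`. -/
def ap (i : ℕ) : Term :=
  Lam (U i) fun A => Lam (U i) fun B => Lam (A ⇾ B) fun f =>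
  Lam A fun x => Lam A fun y => Lam (Id i A x y) fun p =>
    cst (.idInd i i) A x (Lam A fun z => Lam (Id i A x z) fun _ => Id i B (f x) (f z))
      (idp i B (f x)) y p

/-- `pathOverConst i A B x y p u v e` is the path `transport p u = v` in the constant family
`B` over `p : x = y`, for a path `e : u = v` in `B`, where `A B : U i`. -/
def pathOverConst (i : ℕ) : Term :=
  Lam (U i) fun A => Lam (U i) fun B => Lam A fun x => Lam A fun y =>
  Lam (Id i A x y) fun p => Lam B fun u => Lam B fun v => Lam (Id i B u v) fun e =>
    cst (.idInd i i) A x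
      (Lam A fun z => Lam (Id i A x z) fun q =>
        Id i B (transport i i A (Lam A fun _ => B) x z q u) v)
      e y p

/-- `isEquiv i A B f`: the map `f : A → B` has a right inverse and a left inverse. -/
def isEquiv (i : ℕ) : Term :=
  Lam (U i) fun A => Lam (U i) fun B => Lam (A ⇾ B) fun f =>
    Prod i
      (Sig i (B ⇾ A) fun g => Pi B fun b => Id i B (f (g b)) b)
      (Sig i (B ⇾ A) fun h => Pi A fun a => Id i A (h (f a)) a)

/-- The type `Equiv i A B` of equivalences. -/
def Equiv (i : ℕ) : Term :=
  Lam (U i) fun A => Lam (U i) fun B => Sig i (A ⇾ B) fun f => isEquiv i A B f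

/-- The identity equivalence `idEquiv i A : Equiv i A A`. -/
def idEquiv (i : ℕ) : Term :=
  Lam (U i) fun A =>
    mk i (A ⇾ A) (fun f => isEquiv i A A f) (Lam A fun x => x)
      (mk i (Sig i (A ⇾ A) fun g => Pi A fun b => Id i A (g b) b)
        (fun _ => Sig i (A ⇾ A) fun h => Pi A fun a => Id i A (h a) a)
        (mk i (A ⇾ A) (fun g => Pi A fun b => Id i A (g b) b)
          (Lam A fun x => x) (Lam A fun x => idp i A x))
        (mk i (A ⇾ A) (fun h => Pi A fun a => Id i A (h a) a)
          (Lam A fun x => x) (Lam A fun x => idp i A x)))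

/-- `idToEquiv i A B` is the canonical map from `A = B` to the type of equivalences, for
`A B : U i`. -/
def idToEquiv (i : ℕ) : Term :=
  Lam (U i) fun A => Lam (U i) fun B => Lam (Id (i + 1) (U i) A B) fun p =>
    cst (.idInd (i + 1) i) (U i) A
      (Lam (U i) fun C => Lam (Id (i + 1) (U i) A C) fun _ => Equiv i A C)
      (idEquiv i A) B p

/-- `happly i A B f g` is the canonical map from `f = g` to pointwise equality, for
`f g : Π (x : A), B x`. -/
def happly (i : ℕ) : Term :=
  Lam (U i) fun A => Lam (A ⇾ U i) fun B =>
  Lam (Pi A fun x => B x) fun f => Lam (Pi A fun x => B x) fun g =>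
  Lam (Id i (Pi A fun x => B x) f g) fun p =>
    cst (.idInd i i) (Pi A fun x => B x) f
      (Lam (Pi A fun x => B x) fun h => Lam (Id i (Pi A fun x => B x) f h) fun _ =>
        Pi A fun x => Id i (B x) (f x) (h x))
      (Lam A fun x => idp i (B x) (f x)) g p

/-! ## Hypotheses of the induction principles

Each of the following generalises over the data of an induction principle. -/

section Hypotheses

variable {α : Type} [Generalize α]

/-- Motive and methods for induction on `ℕ`. -/
def natHyp (k : ℕ) (body : Term → Term → Term → α) : α :=
  all (cst .nat ⇾ U k) fun P =>
  all (P (cst .zero)) fun z =>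
  all (Pi (cst .nat) fun n => P n ⇾ P (cst .succ n)) fun s =>
  body P z s

/-- Parameters, motive and methods for induction on `A + B`. -/
def sumHyp (i k : ℕ) (body : Term → Term → Term → Term → Term → α) : α :=
  all (U i) fun A =>
  all (U i) fun B =>
  all (cst (.sum i) A B ⇾ U k) fun P =>
  all (Pi A fun a => P (cst (.sumInl i) A B a)) fun l =>
  all (Pi B fun b => P (cst (.sumInr i) A B b)) fun r =>
  body A B P l r

/-- Parameters, motive and method for induction on `Σ (x : A), B x`. -/
def sigHyp (i k : ℕ) (body : Term → Term → Term → Term → α) : α :=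
  all (U i) fun A =>
  all (A ⇾ U i) fun B =>
  all (cst (.sig i) A B ⇾ U k) fun P =>
  all (Pi A fun a => Pi (B a) fun b => P (cst (.pair i) A B a b)) fun h =>
  body A B P h

/-- Parameters, motive and method for (based) path induction. -/
def idHyp (i k : ℕ) (body : Term → Term → Term → Term → α) : α :=
  all (U i) fun A =>
  all A fun x =>
  all (Pi A fun y => Id i A x y ⇾ U k) fun P =>
  all (P x (idp i A x)) fun h =>
  body A x P h

/-- The data of a span `A ← C → B`. -/
def spanHyp (i : ℕ) (body : Term → Term → Term → Term → Term → α) : α :=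
  all (U i) fun A =>
  all (U i) fun B =>
  all (U i) fun C =>
  all (C ⇾ A) fun f =>
  all (C ⇾ B) fun g =>
  body A B C f g

/-- Parameters, motive and methods for induction on a pushout. -/
def pushoutHyp (i k : ℕ)
    (body : Term → Term → Term → Term → Term → Term → Term → Term → Term → α) : α :=
  spanHyp i fun A B C f g =>
  all (cst (.pushout i) A B C f g ⇾ U k) fun P =>
  all (Pi A fun a => P (cst (.inl i) A B C f g a)) fun l =>
  all (Pi B fun b => P (cst (.inr i) A B C f g b)) fun r =>
  all (Pi C fun c =>
    Id k (P (cst (.inr i) A B C f g (g c)))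
      (transport i k (cst (.pushout i) A B C f g) P
        (cst (.inl i) A B C f g (f c)) (cst (.inr i) A B C f g (g c))
        (cst (.glue i) A B C f g c) (l (f c)))
      (r (g c))) fun q =>
  body A B C f g P l r q

/-- Parameter, motive and methods for induction on a propositional truncation. -/
def truncHyp (i k : ℕ) (body : Term → Term → Term → Term → α) : α :=
  all (U i) fun A =>
  all (cst (.trunc i) A ⇾ U k) fun P =>
  all (Pi A fun a => P (cst (.tr i) A a)) fun h =>
  all (Pi (cst (.trunc i) A) fun x => Pi (cst (.trunc i) A) fun y =>
    Pi (P x) fun u => Pi (P y) fun v =>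
    Id k (P y) (transport i k (cst (.trunc i) A) P x y (cst (.squash i) A x y) u) v) fun q =>
  body A P h q

/-- The data of a type family `B : A → U i` and a type `X`. -/
def nullParam (i : ℕ) (body : Term → Term → Term → α) : α :=
  all (U i) fun A =>
  all (A ⇾ U i) fun B =>
  all (U i) fun X =>
  body A B X

/-- Parameters, motive and methods for induction on the nullification of `X` at `B`. -/
def nullHyp (i k : ℕ)
    (body : Term → Term → Term → Term → Term → Term → Term → Term → Term → α) : α :=
  nullParam i fun A B X =>
  all (cst (.null i) A B X ⇾ U k) fun P =>
  all (Pi X fun x => P (cst (.eta i) A B X x)) fun h =>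
  all (Pi A fun a => Pi (B a ⇾ cst (.null i) A B X) fun g =>
    (Pi (B a) fun b => P (g b)) ⇾ P (cst (.sec i) A B X a g)) fun s =>
  all (Pi A fun a => Pi (B a ⇾ cst (.null i) A B X) fun g =>
    Pi (Pi (B a) fun b => P (g b)) fun u => Pi (B a) fun b =>
    Id k (P (g b))
      (transport i k (cst (.null i) A B X) P (cst (.sec i) A B X a g) (g b)
        (cst (.isSec i) A B X a g b) (s a g u))
      (u b)) fun s' =>
  all (Pi A fun a => Pi (B a ⇾ cst (.null i) A B X) fun g =>
    (Pi (B a) fun b => P (g b)) ⇾ P (cst (.ret i) A B X a g)) fun r =>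
  all (Pi A fun a => Pi (cst (.null i) A B X) fun x => Pi (P x) fun u =>
    Id k (P x)
      (transport i k (cst (.null i) A B X) P
        (cst (.ret i) A B X a (Lam (B a) fun _ => x)) x
        (cst (.isRet i) A B X a x)
        (r a (Lam (B a) fun _ => x) (Lam (B a) fun _ => u)))
      u) fun r' =>
  body A B X P h s s' r r'

end Hypotheses

/-! ## Types of the constants -/

/-- The type of a constant, a closed term. -/
def Const.typeTerm : Const → Term
  | .empty => U 0
  | .emptyInd k =>
      Pi (cst .empty ⇾ U k) fun P => Pi (cst .empty) fun x => P x
  | .unit => U 0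
  | .star => cst .unit
  | .unitInd k =>
      Pi (cst .unit ⇾ U k) fun P => P (cst .star) ⇾ Pi (cst .unit) fun x => P x
  | .nat => U 0
  | .zero => cst .nat
  | .succ => cst .nat ⇾ cst .nat
  | .natInd k => natHyp k fun P _ _ => Pi (cst .nat) fun n => P n
  | .sum i => U i ⇾ U i ⇾ U i
  | .sumInl i => Pi (U i) fun A => Pi (U i) fun B => A ⇾ cst (.sum i) A B
  | .sumInr i => Pi (U i) fun A => Pi (U i) fun B => B ⇾ cst (.sum i) A B
  | .sumInd i k => sumHyp i k fun A B P _ _ => Pi (cst (.sum i) A B) fun x => P x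
  | .sig i => Pi (U i) fun A => (A ⇾ U i) ⇾ U i
  | .pair i =>
      Pi (U i) fun A => Pi (A ⇾ U i) fun B =>
        Pi A fun a => B a ⇾ cst (.sig i) A B
  | .sigInd i k => sigHyp i k fun A B P _ => Pi (cst (.sig i) A B) fun x => P x
  | .id i => Pi (U i) fun A => A ⇾ A ⇾ U i
  | .refl i => Pi (U i) fun A => Pi A fun x => Id i A x x
  | .idInd i k =>
      idHyp i k fun A x P _ => Pi A fun y => Pi (Id i A x y) fun p => P y p
  | .funext i =>
      Pi (U i) fun A => Pi (A ⇾ U i) fun B =>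
        Pi (Pi A fun x => B x) fun f => Pi (Pi A fun x => B x) fun g =>
        isEquiv i (Id i (Pi A fun x => B x) f g) (Pi A fun x => Id i (B x) (f x) (g x))
          (happly i A B f g)
  | .univalence i =>
      Pi (U i) fun A => Pi (U i) fun B =>
        isEquiv (i + 1) (Id (i + 1) (U i) A B) (Equiv i A B) (idToEquiv i A B)
  | .pushout i => spanHyp i fun _ _ _ _ _ => U i
  | .inl i => spanHyp i fun A B C f g => A ⇾ cst (.pushout i) A B C f g
  | .inr i => spanHyp i fun A B C f g => B ⇾ cst (.pushout i) A B C f g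
  | .glue i =>
      spanHyp i fun A B C f g => Pi C fun c =>
        Id i (cst (.pushout i) A B C f g)
          (cst (.inl i) A B C f g (f c)) (cst (.inr i) A B C f g (g c))
  | .pushoutInd i k =>
      pushoutHyp i k fun A B C f g P _ _ _ => Pi (cst (.pushout i) A B C f g) fun x => P x
  | .pushoutIndGlue i k =>
      pushoutHyp i k fun A B C f g P l r q => Pi C fun c =>
        Id k
          (Id k (P (cst (.inr i) A B C f g (g c)))
            (transport i k (cst (.pushout i) A B C f g) P
              (cst (.inl i) A B C f g (f c)) (cst (.inr i) A B C f g (g c))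
              (cst (.glue i) A B C f g c) (l (f c)))
            (r (g c)))
          (apd i k (cst (.pushout i) A B C f g) P (cst (.pushoutInd i k) A B C f g P l r q)
            (cst (.inl i) A B C f g (f c)) (cst (.inr i) A B C f g (g c))
            (cst (.glue i) A B C f g c))
          (q c)
  | .trunc i => U i ⇾ U i
  | .tr i => Pi (U i) fun A => A ⇾ cst (.trunc i) A
  | .squash i =>
      Pi (U i) fun A => Pi (cst (.trunc i) A) fun x => Pi (cst (.trunc i) A) fun y =>
        Id i (cst (.trunc i) A) x y
  | .truncInd i k => truncHyp i k fun A P _ _ => Pi (cst (.trunc i) A) fun x => P x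
  | .truncIndSquash i k =>
      truncHyp i k fun A P h q =>
        Pi (cst (.trunc i) A) fun x => Pi (cst (.trunc i) A) fun y =>
        Id k
          (Id k (P y)
            (transport i k (cst (.trunc i) A) P x y (cst (.squash i) A x y)
              (cst (.truncInd i k) A P h q x))
            (cst (.truncInd i k) A P h q y))
          (apd i k (cst (.trunc i) A) P (cst (.truncInd i k) A P h q) x y
            (cst (.squash i) A x y))
          (q x y (cst (.truncInd i k) A P h q x) (cst (.truncInd i k) A P h q y))
  | .null i => nullParam i fun _ _ _ => U i
  | .eta i => nullParam i fun A B X => X ⇾ cst (.null i) A B X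
  | .sec i =>
      nullParam i fun A B X => Pi A fun a =>
        (B a ⇾ cst (.null i) A B X) ⇾ cst (.null i) A B X
  | .isSec i =>
      nullParam i fun A B X => Pi A fun a =>
        Pi (B a ⇾ cst (.null i) A B X) fun g => Pi (B a) fun b =>
        Id i (cst (.null i) A B X) (cst (.sec i) A B X a g) (g b)
  | .ret i =>
      nullParam i fun A B X => Pi A fun a =>
        (B a ⇾ cst (.null i) A B X) ⇾ cst (.null i) A B X
  | .isRet i =>
      nullParam i fun A B X => Pi A fun a => Pi (cst (.null i) A B X) fun x =>
        Id i (cst (.null i) A B X) (cst (.ret i) A B X a (Lam (B a) fun _ => x)) x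
  | .nullInd i k =>
      nullHyp i k fun A B X P _ _ _ _ _ => Pi (cst (.null i) A B X) fun x => P x
  | .nullIndSec i k =>
      nullHyp i k fun A B X P h s s' r r' =>
        Pi A fun a => Pi (B a ⇾ cst (.null i) A B X) fun g => Pi (B a) fun b =>
        Id k
          (Id k (P (g b))
            (transport i k (cst (.null i) A B X) P (cst (.sec i) A B X a g) (g b)
              (cst (.isSec i) A B X a g b)
              (cst (.nullInd i k) A B X P h s s' r r' (cst (.sec i) A B X a g)))
            (cst (.nullInd i k) A B X P h s s' r r' (g b)))
          (apd i k (cst (.null i) A B X) P (cst (.nullInd i k) A B X P h s s' r r')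
            (cst (.sec i) A B X a g) (g b) (cst (.isSec i) A B X a g b))
          (s' a g (Lam (B a) fun c => cst (.nullInd i k) A B X P h s s' r r' (g c)) b)
  | .nullIndRet i k =>
      nullHyp i k fun A B X P h s s' r r' =>
        Pi A fun a => Pi (cst (.null i) A B X) fun x =>
        Id k
          (Id k (P x)
            (transport i k (cst (.null i) A B X) P
              (cst (.ret i) A B X a (Lam (B a) fun _ => x)) x (cst (.isRet i) A B X a x)
              (cst (.nullInd i k) A B X P h s s' r r'
                (cst (.ret i) A B X a (Lam (B a) fun _ => x))))
            (cst (.nullInd i k) A B X P h s s' r r' x))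
          (apd i k (cst (.null i) A B X) P (cst (.nullInd i k) A B X P h s s' r r')
            (cst (.ret i) A B X a (Lam (B a) fun _ => x)) x (cst (.isRet i) A B X a x))
          (r' a x (cst (.nullInd i k) A B X P h s s' r r' x))

/-! ## Computation rules of the induction principles -/

/-- Names of the judgemental computation rules. -/
inductive Rule : Type
  | unitStar (k : ℕ)
  | natZero (k : ℕ) | natSucc (k : ℕ)
  | sumInl (i k : ℕ) | sumInr (i k : ℕ)
  | sigPair (i k : ℕ)
  | idRefl (i k : ℕ)
  | pushoutInl (i k : ℕ) | pushoutInr (i k : ℕ)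
  | truncTr (i k : ℕ)
  | nullEta (i k : ℕ) | nullSec (i k : ℕ) | nullRet (i k : ℕ)

/-- The closed equation of a computation rule. -/
def Rule.eqn : Rule → Eqn
  | .unitStar k =>
      all (cst .unit ⇾ U k) fun P => all (P (cst .star)) fun h =>
      ⟨cst (.unitInd k) P h (cst .star), h, P (cst .star)⟩
  | .natZero k => natHyp k fun P z s =>
      ⟨cst (.natInd k) P z s (cst .zero), z, P (cst .zero)⟩
  | .natSucc k => natHyp k fun P z s => all (cst .nat) fun n =>
      ⟨cst (.natInd k) P z s (cst .succ n), s n (cst (.natInd k) P z s n), P (cst .succ n)⟩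
  | .sumInl i k => sumHyp i k fun A B P l r => all A fun a =>
      ⟨cst (.sumInd i k) A B P l r (cst (.sumInl i) A B a), l a, P (cst (.sumInl i) A B a)⟩
  | .sumInr i k => sumHyp i k fun A B P l r => all B fun b =>
      ⟨cst (.sumInd i k) A B P l r (cst (.sumInr i) A B b), r b, P (cst (.sumInr i) A B b)⟩
  | .sigPair i k => sigHyp i k fun A B P h => all A fun a => all (B a) fun b =>
      ⟨cst (.sigInd i k) A B P h (cst (.pair i) A B a b), h a b, P (cst (.pair i) A B a b)⟩
  | .idRefl i k => idHyp i k fun A x P h =>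
      ⟨cst (.idInd i k) A x P h x (idp i A x), h, P x (idp i A x)⟩
  | .pushoutInl i k => pushoutHyp i k fun A B C f g P l r q => all A fun a =>
      ⟨cst (.pushoutInd i k) A B C f g P l r q (cst (.inl i) A B C f g a), l a,
        P (cst (.inl i) A B C f g a)⟩
  | .pushoutInr i k => pushoutHyp i k fun A B C f g P l r q => all B fun b =>
      ⟨cst (.pushoutInd i k) A B C f g P l r q (cst (.inr i) A B C f g b), r b,
        P (cst (.inr i) A B C f g b)⟩
  | .truncTr i k => truncHyp i k fun A P h q => all A fun a =>
      ⟨cst (.truncInd i k) A P h q (cst (.tr i) A a), h a, P (cst (.tr i) A a)⟩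
  | .nullEta i k => nullHyp i k fun A B X P h s s' r r' => all X fun x =>
      ⟨cst (.nullInd i k) A B X P h s s' r r' (cst (.eta i) A B X x), h x,
        P (cst (.eta i) A B X x)⟩
  | .nullSec i k => nullHyp i k fun A B X P h s s' r r' =>
      all A fun a => all (B a ⇾ cst (.null i) A B X) fun g =>
      ⟨cst (.nullInd i k) A B X P h s s' r r' (cst (.sec i) A B X a g),
        s a g (Lam (B a) fun b => cst (.nullInd i k) A B X P h s s' r r' (g b)),
        P (cst (.sec i) A B X a g)⟩
  | .nullRet i k => nullHyp i k fun A B X P h s s' r r' =>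
      all A fun a => all (B a ⇾ cst (.null i) A B X) fun g =>
      ⟨cst (.nullInd i k) A B X P h s s' r r' (cst (.ret i) A B X a g),
        r a g (Lam (B a) fun b => cst (.nullInd i k) A B X P h s s' r r' (g b)),
        P (cst (.ret i) A B X a g)⟩

/-! ## Judgements -/

/-- Contexts; the most recent variable comes first. -/
abbrev Ctx : Type := List Tm

/-- The three forms of judgement: `Γ` is a context, `Γ ⊢ a : A`, and `Γ ⊢ a ≡ b : A`. -/
inductive Judgement : Type
  | ctx (Γ : Ctx)
  | of (Γ : Ctx) (a A : Tm)
  | eq (Γ : Ctx) (a b A : Tm)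

open Judgement in
/-- The inference rules: structural rules, conversion, cumulative universes, dependent functions
with congruence, beta and eta, the constants, and their computation rules. -/
inductive Derivable : Judgement → Prop
  | ctx_nil : Derivable (ctx [])
  | ctx_cons {Γ A i} : Derivable (of Γ A (.univ i)) → Derivable (ctx (A :: Γ))
  | var {Γ n A} : Derivable (ctx Γ) → Γ[n]? = some A →
      Derivable (of Γ (.var n) (A.shift (n + 1)))
  | refl {Γ a A} : Derivable (of Γ a A) → Derivable (eq Γ a a A)
  | symm {Γ a b A} : Derivable (eq Γ a b A) → Derivable (eq Γ b a A)
  | trans {Γ a b c A} : Derivable (eq Γ a b A) → Derivable (eq Γ b c A) →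
      Derivable (eq Γ a c A)
  | conv {Γ a A B i} : Derivable (of Γ a A) → Derivable (eq Γ A B (.univ i)) →
      Derivable (of Γ a B)
  | conv_eq {Γ a b A B i} : Derivable (eq Γ a b A) → Derivable (eq Γ A B (.univ i)) →
      Derivable (eq Γ a b B)
  | univ {Γ i} : Derivable (ctx Γ) → Derivable (of Γ (.univ i) (.univ (i + 1)))
  | cumul {Γ A i} : Derivable (of Γ A (.univ i)) → Derivable (of Γ A (.univ (i + 1)))
  | cumul_eq {Γ A B i} : Derivable (eq Γ A B (.univ i)) →
      Derivable (eq Γ A B (.univ (i + 1)))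
  | pi {Γ A B i} : Derivable (of Γ A (.univ i)) → Derivable (of (A :: Γ) B (.univ i)) →
      Derivable (of Γ (.pi A B) (.univ i))
  | pi_eq {Γ A A' B B' i} : Derivable (of Γ A (.univ i)) →
      Derivable (eq Γ A A' (.univ i)) → Derivable (eq (A :: Γ) B B' (.univ i)) →
      Derivable (eq Γ (.pi A B) (.pi A' B') (.univ i))
  | lam {Γ A B b i} : Derivable (of Γ A (.univ i)) → Derivable (of (A :: Γ) b B) →
      Derivable (of Γ (.lam A b) (.pi A B))
  | lam_eq {Γ A A' B b b' i} : Derivable (of Γ A (.univ i)) →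
      Derivable (eq Γ A A' (.univ i)) → Derivable (eq (A :: Γ) b b' B) →
      Derivable (eq Γ (.lam A b) (.lam A' b') (.pi A B))
  | app {Γ A B f a} : Derivable (of Γ f (.pi A B)) → Derivable (of Γ a A) →
      Derivable (of Γ (.app f a) (B.inst a))
  | app_eq {Γ A B f f' a a'} : Derivable (eq Γ f f' (.pi A B)) →
      Derivable (eq Γ a a' A) → Derivable (eq Γ (.app f a) (.app f' a') (B.inst a))
  | beta {Γ A B b a} : Derivable (of (A :: Γ) b B) → Derivable (of Γ a A) →
      Derivable (eq Γ (.app (.lam A b) a) (b.inst a) (B.inst a))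
  | eta {Γ A B f} : Derivable (of Γ f (.pi A B)) →
      Derivable (eq Γ f (.lam A (.app (f.shift 1) (.var 0))) (.pi A B))
  | const {Γ} (c : Const) : Derivable (ctx Γ) →
      Derivable (of Γ (.const c) c.typeTerm.close)
  | rule {Γ} (r : Rule) : Derivable (ctx Γ) →
      Derivable (eq Γ r.eqn.lhs.close r.eqn.rhs.close r.eqn.type.close)

/-- A closed type is a theorem of homotopy type theory if it has a closed element. -/
def IsTheorem (A : Term) : Prop := ∃ a : Tm, Derivable (.of [] a A.close)

/-! ## Sheaves and covers

Below, `T : I → U i` is a collection of types, with `I : U j`. -/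

/-- `isContr i X`: the type `X : U i` is contractible. -/
def isContr (i : ℕ) : Term :=
  Lam (U i) fun X => Sig i X fun x => Pi X fun y => Id i X x y

/-- `isTruncSubTwo i n X`: the type `X : U i` is an `(n - 2)`-type. It is contractible if `n` is
zero, and it is an `(n + 1 - 2)`-type if its identity types are `(n - 2)`-types. Here `n` is an
element of the type `ℕ`. -/
def isTruncSubTwo (i : ℕ) : Term :=
  cst (.natInd (i + 1)) (Lam (cst .nat) fun _ => U i ⇾ U i)
    (isContr i)
    (Lam (cst .nat) fun _ => Lam (U i ⇾ U i) fun h =>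
      Lam (U i) fun X => Pi X fun x => Pi X fun y => h (Id i X x y))

/-- `fib i A B f b` is the fibre of `f : A → B` over `b`. -/
def fib (i : ℕ) : Term :=
  Lam (U i) fun A => Lam (U i) fun B => Lam (A ⇾ B) fun f => Lam B fun b =>
    Sig i A fun a => Id i B (f a) b

/-- `mem i j I T Y`, that is `Y ∈ T`: there merely is `x : I` with `T x = Y`. -/
def mem (i j : ℕ) : Term :=
  Lam (U j) fun I => Lam (I ⇾ U i) fun T => Lam (U i) fun Y =>
    cst (.trunc (max (i + 1) j)) (Sig (max (i + 1) j) I fun x => Id (i + 1) (U i) (T x) Y)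

/-- `isCover i j I T A B f`: the map `f : A → B` is a `T`-cover, that is, all its fibres are
in `T`. -/
def isCover (i j : ℕ) : Term :=
  Lam (U j) fun I => Lam (I ⇾ U i) fun T =>
  Lam (U i) fun A => Lam (U i) fun B => Lam (A ⇾ B) fun f =>
    Pi B fun b => mem i j I T (fib i A B f b)

/-- `truncFamily i j I T` is the family of the propositional truncations of the types in `T`. -/
def truncFamily (i j : ℕ) : Term :=
  Lam (U j) fun I => Lam (I ⇾ U i) fun T => Lam I fun x => cst (.trunc i) (T x)

/-- `isSheaf i j I T X`: the type `X : U i` is a `T`-sheaf, that is, it is modal for nullification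
at the family of the propositional truncations of the types in `T`: the unit from `X` to its
nullification is an equivalence. The nullification lives in the universe `U (max i j)`, to which
the family is lifted by cumulativity. -/
def isSheaf (i j : ℕ) : Term :=
  Lam (U j) fun I => Lam (I ⇾ U i) fun T => Lam (U i) fun X =>
    isEquiv (max i j) X
      (cst (.null (max i j)) I (Lam I fun x => truncFamily i j I T x) X)
      (cst (.eta (max i j)) I (Lam I fun x => truncFamily i j I T x) X)

/-- A function of the data of a cospan `f : A → B`, `g : C → B` of types in `U i`. -/
def cospanLam (i : ℕ) (body : Term → Term → Term → Term → Term → Term) : Term :=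
  Lam (U i) fun A => Lam (U i) fun C => Lam (U i) fun B =>
  Lam (A ⇾ B) fun f => Lam (C ⇾ B) fun g => body A C B f g

/-- `Pullback i A C B f g` is the pullback `A ×_B C` of `f : A → B` and `g : C → B`. -/
def Pullback (i : ℕ) : Term :=
  cospanLam i fun A C B f g => Sig i A fun a => Sig i C fun c => Id i B (f a) (g c)

/-- The first projection `A ×_B C → A`. -/
def pullbackFst (i : ℕ) : Term :=
  cospanLam i fun A C B f g => Lam (Pullback i A C B f g) fun z =>
    fst i A (Lam A fun a => Sig i C fun c => Id i B (f a) (g c)) z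

/-- The second projection `A ×_B C → C`. -/
def pullbackSnd (i : ℕ) : Term :=
  cospanLam i fun A C B f g => Lam (Pullback i A C B f g) fun z =>
    fst i C (Lam C fun c => Id i B (f (pullbackFst i A C B f g z)) (g c))
      (snd i A (Lam A fun a => Sig i C fun c => Id i B (f a) (g c)) z)

/-- The path from `f` of the first projection to `g` of the second projection. -/
def pullbackPath (i : ℕ) : Term :=
  cospanLam i fun A C B f g => Lam (Pullback i A C B f g) fun z =>
    snd i C (Lam C fun c => Id i B (f (pullbackFst i A C B f g z)) (g c))
      (snd i A (Lam A fun a => Sig i C fun c => Id i B (f a) (g c)) z)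

/-- The constant `F` (a pushout, or one of its constructors or eliminators) at the span
`A ← A ×_B C → C`. -/
def atPullback (i : ℕ) (F : Const) : Term :=
  cospanLam i fun A C B f g =>
    cst F A C (Pullback i A C B f g) (pullbackFst i A C B f g) (pullbackSnd i A C B f g)

/-- `Join i A C B f g` is the fibrewise join `A *_B C` of `f : A → B` and `g : C → B`: the pushout
of `A ← A ×_B C → C`. -/
def Join (i : ℕ) : Term := atPullback i (.pushout i)

/-- `joinMap i A C B f g` is the map `f * g : A *_B C → B` induced by `f` and `g`. -/
def joinMap (i : ℕ) : Term :=
  cospanLam i fun A C B f g =>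
    atPullback i (.pushoutInd i i) A C B f g (Lam (Join i A C B f g) fun _ => B) f g
      (Lam (Pullback i A C B f g) fun z =>
        pathOverConst i (Join i A C B f g) B
          (atPullback i (.inl i) A C B f g (pullbackFst i A C B f g z))
          (atPullback i (.inr i) A C B f g (pullbackSnd i A C B f g z))
          (atPullback i (.glue i) A C B f g z)
          (f (pullbackFst i A C B f g z)) (g (pullbackSnd i A C B f g z))
          (pullbackPath i A C B f g z))

/-- The type `Over i B` of types `Y : U i` over `B`. -/
def Over (i : ℕ) : Term := Lam (U i) fun B => Sig (i + 1) (U i) fun Y => Y ⇾ B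

/-- The underlying type of a type over `B`. -/
def overType (i : ℕ) : Term :=
  Lam (U i) fun B => Lam (Over i B) fun w => fst (i + 1) (U i) (Lam (U i) fun Y => Y ⇾ B) w

/-- The structure map of a type over `B`. -/
def overMap (i : ℕ) : Term :=
  Lam (U i) fun B => Lam (Over i B) fun w => snd (i + 1) (U i) (Lam (U i) fun Y => Y ⇾ B) w

/-- `joinPower i A B f n` is the `n`-fold iterated fibrewise join of `f : A → B` as a type over `B`:
it is `0 → B` if `n` is zero, and the `n + 1`-fold one is the join of `f` with the `n`-fold one. -/
def joinPower (i : ℕ) : Term :=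
  Lam (U i) fun A => Lam (U i) fun B => Lam (A ⇾ B) fun f =>
    cst (.natInd (i + 1)) (Lam (cst .nat) fun _ => Over i B)
      (mk (i + 1) (U i) (fun Y => Y ⇾ B) (cst .empty)
        (cst (.emptyInd i) (Lam (cst .empty) fun _ => B)))
      (Lam (cst .nat) fun _ => Lam (Over i B) fun w =>
        mk (i + 1) (U i) (fun Y => Y ⇾ B)
          (Join i A (overType i B w) B f (overMap i B w))
          (joinMap i A (overType i B w) B f (overMap i B w)))

/-- `joinPowerType i A B f n` is the type `A^{*_B n}`. -/
def joinPowerType (i : ℕ) : Term :=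
  Lam (U i) fun A => Lam (U i) fun B => Lam (A ⇾ B) fun f => Lam (cst .nat) fun n =>
    overType i B (joinPower i A B f n)

/-- `joinPowerMap i A B f n` is the map `f^{*n} : A^{*_B n} → B`. -/
def joinPowerMap (i : ℕ) : Term :=
  Lam (U i) fun A => Lam (U i) fun B => Lam (A ⇾ B) fun f => Lam (cst .nat) fun n =>
    overMap i B (joinPower i A B f n)

/-- `joinRestrict i A B f n X` is precomposition with `f^{*n}` as a map
`(B → X) → (A^{*_B n} → X)`. -/
def joinRestrict (i : ℕ) : Term :=
  Lam (U i) fun A => Lam (U i) fun B => Lam (A ⇾ B) fun f => Lam (cst .nat) fun n =>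
  Lam (U i) fun X => Lam (B ⇾ X) fun g => Lam (joinPowerType i A B f n) fun z =>
    g (joinPowerMap i A B f n z)

/-- `Agree i A B f X h` states that `h ∘ π₁ = h ∘ π₂` pointwise on `A ×_B A`, for
`h : A → X`. -/
def Agree (i : ℕ) : Term :=
  Lam (U i) fun A => Lam (U i) fun B => Lam (A ⇾ B) fun f => Lam (U i) fun X =>
  Lam (A ⇾ X) fun h => Pi (Pullback i A A B f f) fun z =>
    Id i X (h (pullbackFst i A A B f f z)) (h (pullbackSnd i A A B f f z))

/-- `Equaliser i A B f X` is the equaliser of `(A → X) ⇉ (A ×_B A → X)`. -/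
def Equaliser (i : ℕ) : Term :=
  Lam (U i) fun A => Lam (U i) fun B => Lam (A ⇾ B) fun f => Lam (U i) fun X =>
    Sig i (A ⇾ X) fun h => Agree i A B f X h

/-- `equaliserMap i A B f X` is the map `g ↦ g ∘ f` from `B → X` to the equaliser of
`(A → X) ⇉ (A ×_B A → X)`. -/
def equaliserMap (i : ℕ) : Term :=
  Lam (U i) fun A => Lam (U i) fun B => Lam (A ⇾ B) fun f => Lam (U i) fun X =>
  Lam (B ⇾ X) fun g =>
    mk i (A ⇾ X) (fun h => Agree i A B f X h) (Lam A fun a => g (f a))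
      (Lam (Pullback i A A B f f) fun z =>
        ap i B X g (f (pullbackFst i A A B f f z)) (f (pullbackSnd i A A B f f z))
          (pullbackPath i A A B f f z))

/-- Logical equivalence `Iff l P Q` of types `P Q : U l`. -/
def Iff (l : ℕ) : Term := Lam (U l) fun P => Lam (U l) fun Q => Prod l (P ⇾ Q) (Q ⇾ P)

/-- For every collection `T`, every `n : ℕ` and every `(n - 2)`-type `X`: `X` is a `T`-sheaf if and
only if, for every `T`-cover `f : A → B`, the map `(B → X) → (A^{*_B n} → X)` is an equivalence. -/
def sheafCondition (i j : ℕ) : Term :=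
  Pi (U j) fun I => Pi (I ⇾ U i) fun T =>
  Pi (cst .nat) fun n => Pi (U i) fun X => isTruncSubTwo i n X ⇾
  Iff (max (i + 1) j) (isSheaf i j I T X)
    (Pi (U i) fun A => Pi (U i) fun B => Pi (A ⇾ B) fun f => isCover i j I T A B f ⇾
      isEquiv i (B ⇾ X) (joinPowerType i A B f n ⇾ X) (joinRestrict i A B f n X))

/-- For every collection `T` and every set (that is, `0`-type) `X`: `X` is a `T`-sheaf if and only
if, for every `T`-cover `f : A → B`, the map from `B → X` to the equaliser of
`(A → X) ⇉ (A ×_B A → X)` is an equivalence. -/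
def setSheafCondition (i j : ℕ) : Term :=
  Pi (U j) fun I => Pi (I ⇾ U i) fun T =>
  Pi (U i) fun X => isTruncSubTwo i (cst .succ (cst .succ (cst .zero))) X ⇾
  Iff (max (i + 1) j) (isSheaf i j I T X)
    (Pi (U i) fun A => Pi (U i) fun B => Pi (A ⇾ B) fun f => isCover i j I T A B f ⇾
      isEquiv i (B ⇾ X) (Equaliser i A B f X) (equaliserMap i A B f X))

end HoTT

set_option linter.unusedVariables false

noncomputable section

/-! ### The raw syntax: calculus of substitutions and admissible structural rules. -/

namespace HoTT

/-! ## Substitution -/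

namespace Tm

/-! The mathematics. Nullification at propositions is tested by locality: `X` is a `T`-sheaf if and
only if the constant-function map `X → (P → X)` is an equivalence for every `P = ‖T x‖`
(`dLocalOfSheaf`, `dSheafOfLocal`). Restriction along `f^{*n}` is studied one fibre at a time. For
`b : B` put `P_b = ‖fib_f b‖` and let `K_b` be the type of functions to `X` from the fibre of
`f^{*n}` over `b`. Two facts carry the proof.

(1) If `fib_f b` has a point and `X` is an `(n-2)`-type, then `X → K_b` is an equivalence
(`dPowEquiv`), by induction on `n`. For `n = 0` both sides are contractible. In the step
(`dJoinStep`) the inverse evaluates a function `k` at the given point of `fib_f b`. To see that `k`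
is constant on the fibre of the join, glue paths settle the points that come from `f^{*n}`. For
another point of `fib_f b` one needs an element of an identity type of `X`. By induction this type
is equivalent to the functions into it from the fibre of `f^{*n}`, and composites of two glue paths
give such a function.

(2) `K_b` is `P_b`-local, because a point of the fibre of `f^{*n}` over `b` forces `P_b`
(`dPowSupport`, `dPowLocal`).

If `X` is a sheaf and `f` a cover, then `fib_f b` is merely some `T x`, so `X` is `P_b`-local. A map
of `P_b`-local types that is an equivalence as soon as `P_b` holds is an equivalence
(`dEquivOfLocal`), hence `X ≃ K_b` for all `b`, and these assemble to the claim about `B → X`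
(`dRestrictOfPow`). Conversely, the condition for the cover `T x → 1` identifies `X` with a type
`K_⋆`, which is local for the truncated fibre, that is, for `‖T x‖`. For sets the same argument runs
with `K_b` replaced by the functions on `fib_f b` whose values do not depend on the point
(`dFibEqEquiv`, `dFibEqLocal`).

The formal side. A theorem is a closed raw term together with a derivation, and such derivations are
too large to write. Therefore a type checker for annotated terms is given as a Lean function, proved
sound for `Derivable`, and evaluated in the kernel on the list of declarations that make up the
argument above. The soundness proof needs neither normalisation nor injectivity of dependent
function types. An application records its domain and codomain, the type of a constant applied to
arguments is read off the syntax (`spT`), and reduction tests this data before it contracts a redex.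
The main steps are `red_ok` (reduction and conversion), `elb_ok` (elaboration), `Item.ok_spec`
(declarations) and `EnvOk.addAll`. The erased types of the two final declarations are the given
statements, by computation. -/

theorem liftRen_comp (r s : ℕ → ℕ) : liftRen (fun n => r (s n)) = fun n => liftRen r (liftRen s n) := by
  funext n; cases n <;> rfl

theorem rename_rename (a : Tm) : ∀ r s : ℕ → ℕ, (a.rename s).rename r = a.rename fun n => r (s n) := by
  induction a <;> intro r s <;> simp_all [rename, liftRen_comp]

theorem liftSub_ren (r : ℕ → ℕ) : liftSub (fun n => var (r n)) = fun n => var (liftRen r n) := by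
  funext n; cases n <;> rfl

theorem rename_eq_subst (a : Tm) : ∀ r : ℕ → ℕ, a.rename r = a.subst fun n => var (r n) := by
  induction a <;> intro r <;> simp_all [rename, subst, liftSub_ren]

theorem liftSub_comp_ren (s : ℕ → Tm) (r : ℕ → ℕ) :
    (fun n => liftSub s (liftRen r n)) = liftSub fun n => s (r n) := by
  funext n; cases n <;> rfl

theorem subst_rename (a : Tm) : ∀ (s : ℕ → Tm) (r : ℕ → ℕ),
    (a.rename r).subst s = a.subst fun n => s (r n) := by
  induction a <;> intro s r <;> simp_all [rename, subst, liftSub_comp_ren]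

theorem liftRen_comp_sub (r : ℕ → ℕ) (s : ℕ → Tm) :
    (fun n => (liftSub s n).rename (liftRen r)) = liftSub fun n => (s n).rename r := by
  funext n
  cases n with
  | zero => rfl
  | succ n => simp [liftSub, shift, rename_rename, liftRen]

theorem rename_subst (a : Tm) : ∀ (r : ℕ → ℕ) (s : ℕ → Tm),
    (a.subst s).rename r = a.subst fun n => (s n).rename r := by
  induction a <;> intro r s <;> simp_all [rename, subst, ← liftRen_comp_sub]

theorem liftSub_comp (s t : ℕ → Tm) :
    (fun n => (liftSub t n).subst (liftSub s)) = liftSub fun n => (t n).subst s := by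
  funext n
  cases n with
  | zero => rfl
  | succ n => simp [liftSub, shift, subst_rename, rename_subst]

theorem subst_subst (a : Tm) : ∀ s t : ℕ → Tm,
    (a.subst t).subst s = a.subst fun n => (t n).subst s := by
  induction a <;> intro s t <;> simp_all [subst, ← liftSub_comp]

theorem liftSub_var : liftSub var = var := by
  funext n; cases n <;> rfl

theorem subst_var (a : Tm) : a.subst var = a := by
  induction a <;> simp_all [subst, liftSub_var]

/-- Extension of a substitution by the value of variable `0`. -/
def scons (a : Tm) (s : ℕ → Tm) : ℕ → Tm
  | 0 => a
  | n + 1 => s n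

theorem single_eq (a : Tm) : single a = scons a var := by
  funext n; cases n <;> rfl

theorem shift_subst_scons (A a : Tm) (s : ℕ → Tm) : (A.shift 1).subst (scons a s) = A.subst s :=
  subst_rename ..

theorem shift_inst (A a : Tm) : (A.shift 1).inst a = A := by
  rw [inst, single_eq, shift_subst_scons, subst_var]

theorem subst_inst (b a : Tm) (s : ℕ → Tm) :
    (b.inst a).subst s = (b.subst (liftSub s)).inst (a.subst s) := by
  simp only [inst, subst_subst]
  congr 1; funext n
  cases n with
  | zero => rfl
  | succ n => exact (shift_inst _ _).symm

theorem subst_liftSub_inst (b a : Tm) (s : ℕ → Tm) :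
    (b.subst (liftSub s)).inst a = b.subst (scons a s) := by
  simp only [inst, subst_subst]
  congr 1; funext n
  cases n with
  | zero => rfl
  | succ n => exact shift_inst _ _

theorem shift_subst_liftSub (a : Tm) (s : ℕ → Tm) :
    (a.shift 1).subst (liftSub s) = (a.subst s).shift 1 := by
  simp [shift, subst_rename, rename_subst, liftSub]

theorem shift_shift (a : Tm) (m n : ℕ) : (a.shift m).shift n = a.shift (m + n) := by
  simp [shift, rename_rename, Nat.add_assoc]

/-- The free variables of `a` are less than `n`. -/
def Scoped (n : ℕ) (a : Tm) : Prop := ∀ s : ℕ → Tm, (∀ m < n, s m = var m) → a.subst s = a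

theorem liftSub_eq_var {n : ℕ} {s : ℕ → Tm} (h : ∀ m < n, s m = var m) :
    ∀ m < n + 1, liftSub s m = var m := by
  rintro (_ | m) hm
  · rfl
  · rw [liftSub, h m (by omega)]; rfl

theorem Scoped.subst {a : Tm} (h : Scoped 0 a) (s : ℕ → Tm) : a.subst s = a := h s (by simp)

theorem Scoped.rename {a : Tm} (h : Scoped 0 a) (r : ℕ → ℕ) : a.rename r = a := by
  rw [rename_eq_subst, h.subst]

/-- A test for being scoped. -/
def closedBelow : ℕ → Tm → Bool
  | n, var m => Nat.blt m n
  | _, univ _ => true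
  | n, pi A B => A.closedBelow n && B.closedBelow (n + 1)
  | n, lam A b => A.closedBelow n && b.closedBelow (n + 1)
  | n, app f a => f.closedBelow n && a.closedBelow n
  | _, const _ => true

theorem scoped_of_closedBelow {a : Tm} : ∀ {n : ℕ}, a.closedBelow n = true → Scoped n a := by
  induction a with
  | var m =>
    intro n h s hs
    exact hs m (by simpa [closedBelow, Nat.blt_eq] using h)
  | univ | const => exact fun _ s _ => rfl
  | pi A B ihA ihB | lam A B ihA ihB =>
    intro n h s hs
    simp only [closedBelow, Bool.and_eq_true] at h
    rw [Tm.subst, ihA h.1 s hs, ihB h.2 _ (liftSub_eq_var hs)]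
  | app f a ihf iha =>
    intro n h s hs
    simp only [closedBelow, Bool.and_eq_true] at h
    rw [Tm.subst, ihf h.1 s hs, iha h.2 s hs]

end Tm

/-! ## Structural rules -/

open Judgement Tm

/-- The test `closedBelow` evaluates for every constant, since universe levels play no role in it.
-/
theorem Const.typeTerm_subst (c : Const) (s : ℕ → Tm) :
    c.typeTerm.close.subst s = c.typeTerm.close :=
  (scoped_of_closedBelow (by cases c <;> rfl)).subst s

theorem Rule.eqn_subst (r : Rule) (s : ℕ → Tm) : r.eqn.lhs.close.subst s = r.eqn.lhs.close ∧
    r.eqn.rhs.close.subst s = r.eqn.rhs.close ∧ r.eqn.type.close.subst s = r.eqn.type.close := by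
  have h {a : Tm} (h : a.closedBelow 0 = true) : a.subst s = a := (scoped_of_closedBelow h).subst s
  refine ⟨h ?_, h ?_, h ?_⟩ <;> cases r <;> rfl

/-- A class of well-typed substitutions that is closed under extension by a bound variable. -/
structure SubstClass (P : (ℕ → Tm) → Ctx → Ctx → Prop) : Prop where
  ctx : ∀ {s Γ Δ}, P s Γ Δ → Derivable (ctx Δ)
  var : ∀ {s Γ Δ n A}, P s Γ Δ → Γ[n]? = some A →
    Derivable (of Δ (s n) ((A.shift (n + 1)).subst s))
  lift : ∀ {s Γ Δ A i}, P s Γ Δ → Derivable (of Δ (A.subst s) (.univ i)) →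
    P (liftSub s) (A :: Γ) (A.subst s :: Δ)

/-- The types of a context remain types under substitutions. -/
def CtxSubst (P : (ℕ → Tm) → Ctx → Ctx → Prop) : Ctx → Prop
  | [] => True
  | A :: Γ => CtxSubst P Γ ∧
    ∃ i, ∀ s Δ, P s Γ Δ → Derivable (of Δ (A.subst s) (.univ i))

/-- A judgement is stable under substitutions. -/
def Stable (P : (ℕ → Tm) → Ctx → Ctx → Prop) : Judgement → Prop
  | ctx Γ => CtxSubst P Γ
  | of Γ a A => CtxSubst P Γ ∧ ∀ s Δ, P s Γ Δ → Derivable (of Δ (a.subst s) (A.subst s))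
  | eq Γ a b A => CtxSubst P Γ ∧
    ∀ s Δ, P s Γ Δ → Derivable (eq Δ (a.subst s) (b.subst s) (A.subst s))

/-- One induction is used twice: first for renamings, then for substitutions, whose extension under
a binder needs weakening. The statement also carries the stability of the types of the context. This
is needed for the beta rule, which has no premise stating that the domain is a type. -/
theorem Derivable.stable {P : (ℕ → Tm) → Ctx → Ctx → Prop} (hP : SubstClass P) {J : Judgement}
    (h : Derivable J) : Stable P J := by
  have up {A Γ s Δ} (h : CtxSubst P (A :: Γ)) (hs : P s Γ Δ) :
      P (liftSub s) (A :: Γ) (A.subst s :: Δ) := by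
    obtain ⟨_, i, h⟩ := h
    exact hP.lift hs (h _ _ hs)
  induction h with
  | ctx_nil => trivial
  | ctx_cons _ ih => exact ⟨ih.1, _, ih.2⟩
  | var _ h ih => exact ⟨ih, fun s Δ hs => hP.var hs h⟩
  | refl _ ih => exact ⟨ih.1, fun s Δ hs => .refl (ih.2 s Δ hs)⟩
  | symm _ ih => exact ⟨ih.1, fun s Δ hs => .symm (ih.2 s Δ hs)⟩
  | trans _ _ ih ih' => exact ⟨ih.1, fun s Δ hs => .trans (ih.2 s Δ hs) (ih'.2 s Δ hs)⟩
  | conv _ _ ih ih' => exact ⟨ih.1, fun s Δ hs => .conv (ih.2 s Δ hs) (ih'.2 s Δ hs)⟩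
  | conv_eq _ _ ih ih' => exact ⟨ih.1, fun s Δ hs => .conv_eq (ih.2 s Δ hs) (ih'.2 s Δ hs)⟩
  | univ _ ih => exact ⟨ih, fun s Δ hs => .univ (hP.ctx hs)⟩
  | cumul _ ih => exact ⟨ih.1, fun s Δ hs => .cumul (ih.2 s Δ hs)⟩
  | cumul_eq _ ih => exact ⟨ih.1, fun s Δ hs => .cumul_eq (ih.2 s Δ hs)⟩
  | pi _ _ ih ih' =>
    exact ⟨ih.1, fun s Δ hs => .pi (ih.2 s Δ hs) (ih'.2 _ _ (up ih'.1 hs))⟩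
  | pi_eq _ _ _ ih ih' ih'' =>
    exact ⟨ih.1, fun s Δ hs => .pi_eq (ih.2 s Δ hs) (ih'.2 s Δ hs) (ih''.2 _ _ (up ih''.1 hs))⟩
  | lam _ _ ih ih' =>
    exact ⟨ih.1, fun s Δ hs => .lam (ih.2 s Δ hs) (ih'.2 _ _ (up ih'.1 hs))⟩
  | lam_eq _ _ _ ih ih' ih'' =>
    exact ⟨ih.1, fun s Δ hs => .lam_eq (ih.2 s Δ hs) (ih'.2 s Δ hs) (ih''.2 _ _ (up ih''.1 hs))⟩
  | app _ _ ih ih' =>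
    refine ⟨ih.1, fun s Δ hs => ?_⟩
    rw [subst_inst]
    exact .app (ih.2 s Δ hs) (ih'.2 s Δ hs)
  | app_eq _ _ ih ih' =>
    refine ⟨ih.1, fun s Δ hs => ?_⟩
    rw [subst_inst]
    exact .app_eq (ih.2 s Δ hs) (ih'.2 s Δ hs)
  | beta _ _ ih ih' =>
    refine ⟨ih'.1, fun s Δ hs => ?_⟩
    rw [subst_inst, subst_inst]
    exact .beta (ih.2 _ _ (up ih.1 hs)) (ih'.2 s Δ hs)
  | eta _ ih =>
    refine ⟨ih.1, fun s Δ hs => ?_⟩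
    simp only [subst, shift_subst_liftSub]
    exact .eta (ih.2 s Δ hs)
  | const c _ ih =>
    refine ⟨ih, fun s Δ hs => ?_⟩
    rw [c.typeTerm_subst]
    exact .const c (hP.ctx hs)
  | rule r _ ih =>
    refine ⟨ih, fun s Δ hs => ?_⟩
    rw [(r.eqn_subst s).1, (r.eqn_subst s).2.1, (r.eqn_subst s).2.2]
    exact .rule r (hP.ctx hs)

/-- Renamings between contexts. -/
def RenOk (s : ℕ → Tm) (Γ Δ : Ctx) : Prop := Derivable (ctx Δ) ∧
  ∃ r : ℕ → ℕ, s = (fun n => .var (r n)) ∧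
    ∀ n A, Γ[n]? = some A → ∃ B, Δ[r n]? = some B ∧ B.shift (r n + 1) = (A.shift (n + 1)).rename r

theorem substClass_renOk : SubstClass RenOk where
  ctx h := h.1
  var := by
    rintro s Γ Δ n A ⟨hΔ, r, rfl, h⟩ hn
    obtain ⟨B, hB, e⟩ := h n A hn
    rw [← rename_eq_subst, ← e]
    exact .var hΔ hB
  lift := by
    rintro s Γ Δ A i ⟨hΔ, r, rfl, h⟩ hA
    refine ⟨.ctx_cons hA, liftRen r, liftSub_ren r, ?_⟩
    rintro (_ | n) B hB
    · simp only [List.getElem?_cons_zero, Option.some.injEq] at hB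
      subst hB
      exact ⟨_, rfl, by simp [← rename_eq_subst, shift, rename_rename, liftRen]⟩
    · obtain ⟨C, hC, e⟩ := h n B (by simpa using hB)
      refine ⟨C, by simpa [liftRen] using hC, ?_⟩
      rw [liftRen, ← shift_shift C, e, ← shift_shift B (n + 1) 1]
      simp [shift, rename_rename, liftRen]

/-- Typed substitutions. -/
def SubOk (s : ℕ → Tm) (Γ Δ : Ctx) : Prop := Derivable (ctx Δ) ∧
  ∀ n A, Γ[n]? = some A → Derivable (of Δ (s n) ((A.shift (n + 1)).subst s))

theorem renOk_shift {Γ : Ctx} {A : Tm} (h : Derivable (ctx (A :: Γ))) :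
    RenOk (fun n => .var (n + 1)) Γ (A :: Γ) :=
  ⟨h, _, rfl, fun n B hB => ⟨B, by simpa using hB, by rw [← shift_shift]; rfl⟩⟩

theorem Derivable.weaken {Γ : Ctx} {A a B : Tm} (h : Derivable (ctx (A :: Γ)))
    (ha : Derivable (of Γ a B)) : Derivable (of (A :: Γ) (a.shift 1) (B.shift 1)) := by
  have := (ha.stable substClass_renOk).2 _ _ (renOk_shift h)
  rwa [← rename_eq_subst, ← rename_eq_subst] at this

theorem Derivable.weaken_eq {Γ : Ctx} {A a b B : Tm} (h : Derivable (ctx (A :: Γ)))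
    (ha : Derivable (eq Γ a b B)) :
    Derivable (eq (A :: Γ) (a.shift 1) (b.shift 1) (B.shift 1)) := by
  have := (ha.stable substClass_renOk).2 _ _ (renOk_shift h)
  rwa [← rename_eq_subst, ← rename_eq_subst, ← rename_eq_subst] at this

theorem substClass_subOk : SubstClass SubOk where
  ctx h := h.1
  var h hn := h.2 _ _ hn
  lift := by
    rintro s Γ Δ A i ⟨hΔ, h⟩ hA
    refine ⟨.ctx_cons hA, ?_⟩
    rintro (_ | n) B hB
    · simp only [List.getElem?_cons_zero, Option.some.injEq] at hB
      subst hB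
      rw [shift_subst_liftSub]
      exact .var (.ctx_cons hA) rfl
    · rw [← shift_shift, shift_subst_liftSub]
      exact .weaken (.ctx_cons hA) (h n B (by simpa using hB))

theorem Derivable.subst {s : ℕ → Tm} {Γ Δ : Ctx} {a A : Tm} (h : Derivable (of Γ a A))
    (hs : SubOk s Γ Δ) : Derivable (of Δ (a.subst s) (A.subst s)) :=
  (h.stable substClass_subOk).2 _ _ hs

theorem Derivable.subst_eq {s : ℕ → Tm} {Γ Δ : Ctx} {a b A : Tm} (h : Derivable (eq Γ a b A))
    (hs : SubOk s Γ Δ) : Derivable (eq Δ (a.subst s) (b.subst s) (A.subst s)) :=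
  (h.stable substClass_subOk).2 _ _ hs

theorem subOk_var {Γ : Ctx} (h : Derivable (ctx Γ)) : SubOk var Γ Γ :=
  ⟨h, fun n A hA => by rw [subst_var]; exact .var h hA⟩

theorem SubOk.cons {s : ℕ → Tm} {Γ Δ : Ctx} {a A : Tm} (h : SubOk s Γ Δ)
    (ha : Derivable (of Δ a (A.subst s))) : SubOk (scons a s) (A :: Γ) Δ := by
  refine ⟨h.1, ?_⟩
  rintro (_ | n) B hB
  · simp only [List.getElem?_cons_zero, Option.some.injEq] at hB
    subst hB
    rwa [shift_subst_scons]
  · rw [← shift_shift, shift_subst_scons]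
    exact h.2 n B (by simpa using hB)

/-- The context of a judgement. -/
def Judgement.context : Judgement → Ctx
  | ctx Γ | of Γ _ _ | eq Γ _ _ _ => Γ

theorem Derivable.context {J : Judgement} (h : Derivable J) : Derivable (ctx J.context) := by
  induction h with
  | ctx_nil => exact .ctx_nil
  | ctx_cons h => exact .ctx_cons h
  -- The first premise lives in the extended context; the argument supplies the right one.
  | beta _ _ _ ih => exact ih
  | _ => assumption

theorem Derivable.ctx_of {Γ : Ctx} {a A : Tm} (h : Derivable (of Γ a A)) : Derivable (ctx Γ) :=
  h.context

end HoTT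

namespace HoTT
open Judgement Tm

/-! ## Telescopes -/

namespace Tm

/-- The substitution by a list of terms for the first variables. -/
def ofList (s : List Tm) : ℕ → Tm := s.foldr scons var

/-- Dependent function type over a context. -/
def pis (Δ : Ctx) (B : Tm) : Tm := Δ.foldl (fun B A => pi A B) B

/-- Abstraction over a context. -/
def lams (Δ : Ctx) (b : Tm) : Tm := Δ.foldl (fun b A => lam A b) b

/-- Application to a list of terms; the first one is the last argument. -/
def apps (f : Tm) (s : List Tm) : Tm := s.foldr (fun a f => app f a) f

theorem subst_liftSub_inst' (B a : Tm) (s : List Tm) :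
    (B.subst (liftSub (ofList s))).inst a = B.subst (ofList (a :: s)) := subst_liftSub_inst ..

end Tm

/-- The terms `s` are elements of the types `Δ`. -/
def Args (Γ : Ctx) : List Tm → Ctx → Prop
  | [], [] => True
  | a :: s, A :: Δ => Args Γ s Δ ∧ Derivable (of Γ a (A.subst (ofList s)))
  | _, _ => False

/-- The terms `s` and `t` are equal elements of the types `Δ`. -/
def ArgsEq (Γ : Ctx) : List Tm → List Tm → Ctx → Prop
  | [], [], [] => True
  | a :: s, b :: t, A :: Δ => ArgsEq Γ s t Δ ∧ Derivable (eq Γ a b (A.subst (ofList s)))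
  | _, _, _ => False

theorem Args.subOk {Γ : Ctx} (hΓ : Derivable (ctx Γ)) : ∀ {s : List Tm} {Δ : Ctx}, Args Γ s Δ →
    SubOk (ofList s) Δ Γ
  | [], [], _ => ⟨hΓ, by simp⟩
  | _ :: _, _ :: _, h => (h.1.subOk hΓ).cons h.2

theorem Args.refl {Γ : Ctx} : ∀ {s : List Tm} {Δ : Ctx}, Args Γ s Δ → ArgsEq Γ s s Δ
  | [], [], _ => trivial
  | _ :: _, _ :: _, h => ⟨h.1.refl, .refl h.2⟩

theorem Derivable.closed {Γ : Ctx} {a A : Tm} (h : Derivable (of [] a A)) (hΓ : Derivable (ctx Γ)) :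
    Derivable (of Γ a A) := by
  simpa [subst_var] using h.subst (s := .var) ⟨hΓ, by simp⟩

theorem Derivable.closed_eq {Γ : Ctx} {a b A : Tm} (h : Derivable (eq [] a b A))
    (hΓ : Derivable (ctx Γ)) : Derivable (eq Γ a b A) := by
  simpa [subst_var] using h.subst_eq (s := .var) ⟨hΓ, by simp⟩

theorem Derivable.type_of_ctx {Γ : Ctx} {A : Tm} (h : Derivable (ctx (A :: Γ))) :
    ∃ i, Derivable (of Γ A (.univ i)) := by
  cases h with | ctx_cons h => exact ⟨_, h⟩

theorem Derivable.lams : ∀ {Δ : Ctx} {b B : Tm}, Derivable (of Δ b B) →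
    Derivable (of [] (lams Δ b) (pis Δ B))
  | [], _, _, h => h
  | _ :: Δ, _, _, h =>
    have ⟨_, hA⟩ := h.ctx_of.type_of_ctx
    Derivable.lams (Δ := Δ) (.lam hA h)

theorem ArgsEq.apps {Γ : Ctx} {f g : Tm} : ∀ {s t : List Tm} {Δ : Ctx} {B : Tm}, ArgsEq Γ s t Δ →
    Derivable (eq Γ f g (pis Δ B)) → Derivable (eq Γ (apps f s) (apps g t) (B.subst (ofList s)))
  | [], [], [], B, _, h => by
    simpa [ofList, subst_var, Tm.apps, pis] using h
  | a :: s, b :: t, A :: Δ, B, h, hf => by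
    have := h.1.apps (B := .pi A B) hf
    rw [← subst_liftSub_inst']
    exact this.app_eq h.2

/-- Iterated beta, from the outermost domain inwards. Together with `ArgsEq.apps` it turns
statements about simultaneous substitution into congruence of application for closed functions. -/
theorem Args.betas {Γ : Ctx} (hΓ : Derivable (ctx Γ)) : ∀ {s : List Tm} {Δ : Ctx} {b B : Tm},
    Args Γ s Δ → Derivable (of Δ b B) →
    Derivable (eq Γ (apps (lams Δ b) s) (b.subst (ofList s)) (B.subst (ofList s)))
  | [], [], b, B, _, h => by
    simpa [ofList, subst_var, Tm.apps, Tm.lams] using (h.closed hΓ).refl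
  | a :: s, A :: Δ, b, B, h, hb => by
    have ⟨_, hA⟩ := hb.ctx_of.type_of_ctx
    have hs := h.1.subOk hΓ
    have := (h.1.betas hΓ (.lam hA hb)).app_eq (Derivable.refl h.2)
    rw [← subst_liftSub_inst', ← subst_liftSub_inst']
    refine this.trans (.beta ?_ h.2)
    exact hb.subst (substClass_subOk.lift hs (hA.subst hs))

/-- A type at equal arguments. -/
theorem ArgsEq.type {Γ : Ctx} (hΓ : Derivable (ctx Γ)) {s t : List Tm} {Δ : Ctx} {B : Tm} {i : ℕ}
    (h : ArgsEq Γ s t Δ) (hs : Args Γ s Δ) (ht : Args Γ t Δ) (hB : Derivable (of Δ B (.univ i))) :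
    Derivable (eq Γ (B.subst (ofList s)) (B.subst (ofList t)) (.univ i)) :=
  -- There is no rule saying that substitution respects judgemental equality. Instead `B` is
  -- abstracted to a closed function, to which the congruence rule for application applies, with
  -- beta on both sides.
  ((hs.betas hΓ hB).symm.trans (h.apps (hB.lams.closed hΓ).refl)).trans (ht.betas hΓ hB)

/-- Equal functions of a context are equal at all arguments. -/
theorem Args.eq_of_lams {Γ : Ctx} (hΓ : Derivable (ctx Γ)) {s : List Tm} {Δ : Ctx} {a b B : Tm}
    (hs : Args Γ s Δ) (ha : Derivable (of Δ a B)) (hb : Derivable (of Δ b B))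
    (h : Derivable (eq [] (Tm.lams Δ a) (Tm.lams Δ b) (pis Δ B))) :
    Derivable (eq Γ (a.subst (ofList s)) (b.subst (ofList s)) (B.subst (ofList s))) :=
  ((hs.betas hΓ ha).symm.trans (hs.refl.apps (h.closed_eq hΓ))).trans (hs.betas hΓ hb)

end HoTT

/-! ### A type checker for annotated terms. -/

namespace HoTT.Check

/-! ## Annotated terms -/

/-- A symbolic universe level: the `n`-th successor of the level variable `b`. -/
structure Lv where
  b : ℕ
  n : ℕ

namespace Lv

def beq (l k : Lv) : Bool := Nat.beq l.b k.b && Nat.beq l.n k.n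

def succ (l : Lv) : Lv := ⟨l.b, l.n + 1⟩

/-- A sound test for `l ≤ k`. Variable `2` is level zero, and variable `5` bounds all variables.
If `amb` holds, then the variables `0`, `1`, `3`, `4` are `i`, `max i j`, `j`, `max (i + 1) j`. -/
def ble (amb : Bool) (l k : Lv) : Bool :=
  ((Nat.beq l.b k.b || Nat.beq l.b 2 || Nat.beq k.b 5) && Nat.ble l.n k.n) ||
  (amb &&
    ((Nat.beq k.b 1 && (Nat.beq l.b 0 || Nat.beq l.b 3) && Nat.ble l.n k.n) ||
     (Nat.beq k.b 4 && ((Nat.beq l.b 1 || Nat.beq l.b 3) && Nat.ble l.n k.n ||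
        Nat.beq l.b 0 && Nat.ble l.n (k.n + 1)))))

/-- An upper bound of two levels. -/
def sup (amb : Bool) (l k : Lv) : Lv :=
  bif l.ble amb k then k else bif k.ble amb l then l else ⟨5, l.n + k.n⟩

/-- Instantiation of the level variables `0` and `1`. -/
def inst (l k x : Lv) : Lv :=
  match x.b with
  | 0 => ⟨l.b, l.n + x.n⟩
  | 1 => ⟨k.b, k.n + x.n⟩
  | 5 => ⟨5, l.n + k.n + x.n⟩
  | _ => x

end Lv

/-- Terms with type annotations, over a signature of closed constants that are named by numbers.
A spine is a constant applied to arguments by `sapp`; other applications are by `app`, with the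
domain and codomain of the function. The codomain is also recorded in `lam`. -/
inductive E : Type
  | var (n : ℕ)
  | univ (l : Lv)
  | pi (A B : E)
  | lam (A B b : E)
  | app (A B f a : E)
  | hd (h : ℕ) (l k : Lv)
  | sapp (f a : E)
  | hole

namespace E

/-- Weakening by `d` variables above the cutoff `c`. -/
def sh (d : ℕ) (e : E) : ℕ → E :=
  E.rec (motive := fun _ => ℕ → E)
    (fun n c => bif Nat.ble c n then var (n + d) else var n)
    (fun l _ => univ l)
    (fun _ _ A B c => pi (A c) (B (c + 1)))
    (fun _ _ _ A B b c => lam (A c) (B (c + 1)) (b (c + 1)))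
    (fun _ _ _ _ A B f a c => app (A c) (B (c + 1)) (f c) (a c))
    (fun h l k _ => hd h l k)
    (fun _ _ f a c => sapp (f c) (a c))
    (fun _ => hole) e

/-- The value of variable `n` under a substitution by a list. -/
def look (s : List E) : ℕ → E :=
  List.rec (motive := fun _ => ℕ → E) (fun n => var n)
    (fun a _ ih n => Nat.rec (motive := fun _ => E) a (fun n _ => ih n) n) s

/-- Substitution by a list for the variables from `c` on. -/
def sub (s : List E) (e : E) : ℕ → E :=
  E.rec (motive := fun _ => ℕ → E)
    (fun n c => bif Nat.ble c n then
      (bif Nat.beq c 0 then look s n else (look s (n - c)).sh c 0) else var n)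
    (fun l _ => univ l)
    (fun _ _ A B c => pi (A c) (B (c + 1)))
    (fun _ _ _ A B b c => lam (A c) (B (c + 1)) (b (c + 1)))
    (fun _ _ _ _ A B f a c => app (A c) (B (c + 1)) (f c) (a c))
    (fun h l k _ => hd h l k)
    (fun _ _ f a c => sapp (f c) (a c))
    (fun _ => hole) e

/-- Substitution of `a` for variable `0`; the other variables are lowered by one. -/
def inst (b a : E) : E := b.sub [a] 0

/-- Instantiation of level variables. -/
def lmap (l k : Lv) (e : E) : E :=
  E.rec (motive := fun _ => E) var (fun x => univ (l.inst k x)) (fun _ _ A B => pi A B)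
    (fun _ _ _ A B b => lam A B b) (fun _ _ _ _ A B f a => app A B f a)
    (fun h x y => hd h (l.inst k x) (l.inst k y)) (fun _ _ f a => sapp f a) hole e

/-- The levels `l` and `k` are the level variables `0` and `1`. -/
def lvid (l k : Lv) : Bool := l.beq ⟨0, 0⟩ && k.beq ⟨1, 0⟩

def lm (l k : Lv) (e : E) : E := bif lvid l k then e else e.lmap l k

/-- Equality up to annotations. -/
def beq (t : E) : E → Bool :=
  E.rec (motive := fun _ => E → Bool)
    (fun n u => match u with | var m => Nat.beq n m | _ => false)
    (fun l u => match u with | univ k => l.beq k | _ => false)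
    (fun _ _ A B u => match u with | pi A' B' => A A' && B B' | _ => false)
    (fun _ _ _ A _ b u => match u with | lam A' _ b' => A A' && b b' | _ => false)
    (fun _ _ _ _ _ _ f a u => match u with | app _ _ f' a' => f f' && a a' | _ => false)
    (fun h l k u => match u with
      | hd h' l' k' => Nat.beq h h' && l.beq l' && k.beq k' | _ => false)
    (fun _ _ f a u => match u with | sapp f' a' => f f' && a a' | _ => false)
    (fun _ => false) t

/-- Removal of the `d` variables from `c` on, if they do not occur. -/
def low (d : ℕ) (e : E) : ℕ → Option E :=
  E.rec (motive := fun _ => ℕ → Option E)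
    (fun n c => bif Nat.ble c n then
      (bif Nat.ble (c + d) n then some (var (n - d)) else none) else some (var n))
    (fun l _ => some (univ l))
    (fun _ _ A B c => match A c, B (c + 1) with
      | some A, some B => some (pi A B) | _, _ => none)
    (fun _ _ _ A B b c => match A c, b (c + 1) with
      | some A, some b => some (lam A hole b) | _, _ => none)
    (fun _ _ _ _ A B f a c => match f c, a c with
      | some f, some a => some (app hole hole f a) | _, _ => none)
    (fun h l k _ => some (hd h l k))
    (fun _ _ f a c => match f c, a c with
      | some f, some a => some (sapp f a) | _, _ => none)
    (fun _ => some hole) e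

/-- The arguments of a spine, the last one first. -/
def args (e : E) : List E :=
  E.rec (motive := fun _ => List E) (fun _ => []) (fun _ => []) (fun _ _ _ _ => [])
    (fun _ _ _ _ _ _ => []) (fun _ _ _ _ _ _ _ _ => []) (fun _ _ _ => [])
    (fun _ a f _ => a :: f) [] e

def head (e : E) : E :=
  E.rec (motive := fun _ => E) var univ (fun A B _ _ => pi A B) (fun A B b _ _ _ => lam A B b)
    (fun A B f a _ _ _ _ => app A B f a) hd (fun _ _ f _ => f) hole e

end E

/-- A computation rule of an eliminator, for the major premise `con`. The rule is in the context of
the first `np` arguments of the eliminator, followed by the last arguments of `con`, which have the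
types `tys` (last one first); `rest` are the other arguments of the eliminator (last one first). -/
structure IRule where
  con : ℕ
  np : ℕ
  tys : List E
  rest : List E
  rhs : E

/-- A closed constant with its type, its number of arguments, and if it is defined by a transparent
definition, the body of the definition in the context of the arguments. -/
structure Entry where
  key : ℕ
  amb : Bool
  ty : E
  n : ℕ
  body : Option E
  rules : List IRule
  den : (ℕ → ℕ) → Tm

abbrev Env := List Entry

def Env.find (V : Env) (h : ℕ) : Option Entry :=
  List.rec (motive := fun _ => Option Entry) none
    (fun e _ ih => bif Nat.beq e.key h then some e else ih) V

/-! ## Conversion -/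

/-- A position at which elaboration has failed. -/
inductive Err : Type
  | mk (c : ℕ) (Γ : List E) (s T : E)

/-- Reduction to weak head normal form, and conversion, in a context. -/
structure Red where
  whnf : List E → E → E
  conv : List E → E → E → Bool

namespace Red
open E
variable (V : Env) (amb : Bool) (R : Red)

/-- The type of a constant of type `T` applied to the arguments `r`, after the arguments `s`. -/
def tyArgs (T : E) (s r : List E) : E :=
  List.rec (motive := fun _ => E → List E → E) (fun T s => T.sub s 0)
    (fun a _ ih T s => match T with | pi _ B => ih B (a :: s) | _ => hole) r T s

def lvMax : E → E → E
  | univ l, univ k => univ (l.sup amb k)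
  | _, _ => hole

/-- The type of a spine. -/
def tySpine (t : E) : E :=
  match t.head with
  | hd h l k => match V.find h with
    | some e => tyArgs (e.ty.lm l k) [] t.args.reverse
    | none => hole
  | _ => hole

/-- The type of a well-typed term. -/
def ty (Γ : List E) (t : E) : E :=
  E.rec (motive := fun _ => List E → E)
    (fun n Γ => (look Γ n).sh (n + 1) 0) (fun l _ => univ l.succ)
    (fun A B tA tB Γ => lvMax amb (R.whnf Γ (tA Γ)) (R.whnf (A :: Γ) (tB (A :: Γ))))
    (fun A B _ _ _ _ _ => pi A B) (fun _ B _ a _ _ _ _ _ => B.inst a)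
    (fun h l k _ => tySpine V (hd h l k)) (fun f a _ _ _ => tySpine V (sapp f a))
    (fun _ => hole) t Γ

def convList (Γ : List E) : List E → List E → Bool
  | [], [] => true
  | a :: r, b :: s => R.conv Γ a b && convList Γ r s
  | _, _ => false

def univLe : E → E → Bool
  | univ l, univ k => l.ble amb k
  | _, _ => false

/-- Subsumption of types. -/
def subs (Γ : List E) (T T' : E) : Bool :=
  univLe amb T T' || R.conv Γ T T' || univLe amb (R.whnf Γ T) (R.whnf Γ T')

/-- The terms `r` extend the substitution `s` by elements of the types `Ts`. -/
def isTys (Γ : List E) : List E → List E → List E → Bool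
  | [], [], _ => true
  | e :: r, T :: Ts, s =>
    isTys Γ r Ts s && subs amb R Γ (ty V amb R Γ e) (T.sub (r ++ s) 0)
  | _, _, _ => false

def findRule : List IRule → ℕ → Option IRule
  | [], _ => none
  | r :: s, h => bif Nat.beq r.con h then some r else findRule s h

/-- Application of a computation rule, if the arguments `as` of the eliminator fit. -/
def iota (Γ : List E) (t : E) (l k : Lv) (rs : List IRule) : List E → E
  | [] => t
  | p :: as =>
    let p' := R.whnf Γ p
    match p'.head with
    | hd c _ _ =>
      match findRule rs c with
      | none => t
      | some r =>
        let as' := p' :: as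
        let ps := as'.drop (as'.length - r.np)
        let cs := p'.args.take r.tys.length
        bif isTys V amb R Γ cs (r.tys.map (lm l k)) ps &&
          convList R Γ (as'.take (as'.length - r.np))
            (r.rest.map fun e => (e.lm l k).sub (cs ++ ps) 0) then
          R.whnf Γ ((r.rhs.lm l k).sub (cs ++ ps) 0)
        else t
    | _ => t

def whnfSpine (Γ : List E) (t : E) : E :=
  match t.head with
  | hd h l k =>
    match V.find h with
    | some e =>
      bif Nat.beq t.args.length e.n then
        match e.body with
        | some b => R.whnf Γ ((b.lm l k).sub t.args 0)
        | none => match e.rules with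
          | [] => t
          | r :: rs => iota V amb R Γ t l k (r :: rs) t.args
      else t
    | none => t
  | _ => t

/-- An application of a constant to too few arguments is continued. -/
def whnfApp (Γ : List E) (A B f a : E) : E :=
  match f.head with
  | hd h _ _ => match V.find h, tySpine V f with
    | some e, pi A' B' =>
      bif Nat.blt f.args.length e.n && R.conv Γ A' A && R.conv (A' :: Γ) B' B then
        R.whnf Γ (sapp f a)
      else app A B f a
    | _, _ => app A B f a
  | _ => app A B f a

/-- A beta redex is contracted only if the domain and codomain recorded at the application agree
with those of the function. In the formal system these equalities would follow from injectivity of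
dependent function types; testing them makes that metatheorem unnecessary. -/
def whnfStep (Γ : List E) (t : E) : E :=
  match t with
  | app A B f a =>
    match R.whnf Γ f with
    | lam A' B' b =>
      bif R.conv Γ A A' && R.conv (A :: Γ) B B' then R.whnf Γ (b.inst a) else app A B f a
    | f' => whnfApp V R Γ A B f' a
  | hd h l k => whnfSpine V amb R Γ (hd h l k)
  | sapp f a => whnfSpine V amb R Γ (sapp f a)
  | t => t

/-- Comparison of the outermost constructors. -/
def struct (Γ : List E) (t : E) : E → Bool :=
  E.rec (motive := fun _ => E → Bool)
    (fun n u => match u with | var m => Nat.beq n m | _ => false)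
    (fun l u => match u with | univ k => l.beq k | _ => false)
    (fun A B _ _ u => match u with
      | pi A' B' => R.conv Γ A A' && R.conv (A :: Γ) B B' | _ => false)
    (fun A B b _ _ _ u => match u with
      | lam A' B' b' => R.conv Γ A A' && R.conv (A :: Γ) b b' && R.conv (A :: Γ) B B' | _ => false)
    (fun A B f a _ _ _ _ u => match u with
      | app A' B' f' a' => R.conv Γ f f' && R.conv Γ a a' && R.conv Γ A A' && R.conv (A :: Γ) B B'
      | _ => false)
    (fun h l k u => match u with
      | hd h' l' k' => Nat.beq h h' && l.beq l' && k.beq k' | _ => false)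
    (fun _ a ih _ u => match u with
      | sapp f' a' => ih f' && R.conv Γ a a' | _ => false)
    (fun _ => false) t

def reducible (t : E) : Bool :=
  match t with
  | app _ _ _ _ => true
  | _ => match t.head with
    | hd h _ _ => match V.find h with
      | some e => e.body.isSome || !e.rules.isEmpty
      | none => false
    | _ => false

def sameHead (t u : E) : Bool :=
  match t.head, u.head with
  | hd h _ _, hd h' _ _ => Nat.beq h h'
  | _, _ => false

/-- Arguments of equal heads are compared before anything is unfolded, which keeps the computation
small. Conversion is incomplete, for instance it has no eta rule; this limits which terms are
accepted and does not affect soundness. -/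
def convStep (Γ : List E) (t u : E) : Bool :=
  t.beq u ||
  bif reducible V t || reducible V u then
    (sameHead t u && struct R Γ t u) || struct R Γ (R.whnf Γ t) (R.whnf Γ u)
  else struct R Γ t u

end Red

/-- Approximations indexed by fuel: at zero, reduction is the identity and conversion is syntactic
equality. Every approximation is sound, so termination is never an issue. -/
def red (V : Env) (amb : Bool) (n : ℕ) : Red :=
  Nat.rec (motive := fun _ => Red) ⟨fun _ t => t, fun _ t u => t.beq u⟩
    (fun _ R => ⟨Red.whnfStep V amb R, Red.convStep V R⟩) n

/-! ## Elaboration -/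

/-- A solution of an unknown. The kind is `0` if the term has to be checked, `1` if it is part of
the type of another term, and `2` if it is an elaborated argument. -/
structure Sol where
  kind : ℕ
  e : E

/-- Inference of a type, check against a type, and matching with a pattern. -/
structure Elb where
  infer : List E → E → Except Err (E × E)
  check : List E → E → E → Except Err E
  unify : List E → ℕ → ℕ → E → E → List (Option Sol) → List (Option Sol)

namespace Elb
open E
variable (V : Env) (amb : Bool) (R : Red) (I : Elb)

def setSol (s : List (Option Sol)) (n : ℕ) (x : Sol) : List (Option Sol) :=
  List.rec (motive := fun _ => ℕ → List (Option Sol)) (fun _ => [])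
    (fun a r ih n => Nat.rec (motive := fun _ => List (Option Sol))
      (match a with
        | none => some x :: r
        | some y => (bif Nat.beq x.kind 2 then some x else some y) :: r)
      (fun n _ => a :: ih n) n) s n

def getSol (s : List (Option Sol)) : ℕ → Option Sol :=
  List.rec (motive := fun _ => ℕ → Option Sol) (fun _ => none)
    (fun a _ ih n => Nat.rec (motive := fun _ => Option Sol) a (fun n _ => ih n) n) s

def unifyArgs (Γ : List E) (off d : ℕ) (p : E) : E → List (Option Sol) → List (Option Sol) :=
  E.rec (motive := fun _ => E → List (Option Sol) → List (Option Sol))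
    (fun _ _ s => s) (fun _ _ s => s) (fun _ _ _ _ _ s => s) (fun _ _ _ _ _ _ _ s => s)
    (fun _ _ _ _ _ _ _ _ _ s => s) (fun _ _ _ _ s => s)
    (fun _ a ih _ u s => match u with
      | sapp f' a' => I.unify Γ off d a a' (ih f' s)
      | _ => s)
    (fun _ s => s) p

/-- An unknown function applied to the variable of the only binder. -/
def isPattern (d : ℕ) (f a : E) : Bool :=
  match f, a with
  | var m, var 0 => Nat.beq d 1 && Nat.ble 1 m
  | _, _ => false

/-- Matching of a pattern `p` with a term `e` under `d` binders. Variable `m` of the pattern outside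
of the binders is the unknown `m + off`. -/
def unifyStep (Γ : List E) (off d : ℕ) (p e : E) (s : List (Option Sol)) : List (Option Sol) :=
  match p with
  | var m =>
    bif Nat.ble d m then
      (bif Nat.beq d 0 then setSol s (m + off) ⟨1, e⟩
       else match e.low d 0 with
        | some e' => setSol s (m - d + off) ⟨0, e'⟩
        | none => s)
    else s
  | pi A B => match R.whnf Γ e with
    | pi A' B' => I.unify (A' :: Γ) off (d + 1) B B' (I.unify Γ off d A A' s)
    | _ => s
  | lam A _ b => match e with
    | lam A' _ b' => I.unify (A' :: Γ) off (d + 1) b b' (I.unify Γ off d A A' s)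
    | _ => s
  | app _ _ f a =>
    bif isPattern d f a then
      match f with
      | var m => setSol s (m - 1 + off) ⟨0, lam hole hole e⟩
      | _ => s
    else s
  | sapp _ _ =>
    bif Red.sameHead p e then unifyArgs I Γ off d p e s
    else
      let e' := R.whnf Γ e
      bif Red.sameHead p e' then unifyArgs I Γ off d p e' s else s
  | _ => s

def inferable : E → Bool
  | lam hole _ _ => false
  | hole => false
  | _ => true

def allSolved (s : List (Option Sol)) : List ℕ → Bool
  | [] => true
  | n :: r => (getSol s n).isSome && allSolved s r

/-- Solve the holes among the arguments `as` of a spine; `hs` are the holes met. -/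
def solve (Γ : List E) (T : E) (as : List E) (hs : List ℕ) (s : List (Option Sol)) :
    List (Option Sol) :=
  List.rec (motive := fun _ => E → List ℕ → List (Option Sol) → List (Option Sol))
    (fun _ _ s => s)
    (fun a r ih T hs s => match T with
      | pi A B =>
        (match a with
        | hole => ih B (r.length :: hs) s
        | _ =>
          bif !inferable a || allSolved s hs then ih B hs s
          else match I.infer Γ a with
            | .ok (e, T) => ih B hs
                (I.unify Γ (r.length + 1) 0 A T (setSol s r.length ⟨2, e⟩))
            | .error _ => ih B hs s)
      | _ => s) as T hs s

def applyArgs (Γ : List E) (e T : E) (as : List E) : Except Err (E × E) :=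
  List.rec (motive := fun _ => E → E → Except Err (E × E)) (fun e T => .ok (e, T))
    (fun a _ ih e T => match R.whnf Γ T with
      | pi A B => (match I.check Γ a A with
        | .ok a' => ih (app A B e a') (B.inst a')
        | .error x => .error x)
      | T' => .error (.mk 1 Γ e T')) as e T

/-- The term to use for an argument. -/
def pick (a : E) (x : Option Sol) : E :=
  match a, x with
  | hole, some s => s.e
  | a, some s => bif Nat.beq s.kind 2 then s.e else a
  | a, none => a

def argE (Γ : List E) (a A : E) (x : Option Sol) : Except Err E :=
  I.check Γ (pick a x) A

/-- Apply the constant `e` of type `T` to the arguments `as`, after the arguments `s`. -/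
def build (Γ : List E) (ex : List E) (sol : List (Option Sol)) (T : E) (as : List E) (e : E)
    (s : List E) : Except Err (E × E) :=
  List.rec (motive := fun _ => E → E → List E → Except Err (E × E))
    (fun T e s => applyArgs R I Γ e (T.sub s 0) ex)
    (fun a r ih T e s => match T with
      | pi A B => (match argE I Γ a (A.sub s 0) (getSol sol r.length) with
        | .ok u => ih B (sapp e u) (u :: s)
        | .error x => .error x)
      | _ => .error (.mk 3 Γ e T)) as T e s

/-- Drop `n` domains. -/
def cod : ℕ → E → E
  | n + 1, pi _ B => cod n B
  | _, T => T

def hasHole : List E → Bool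
  | [] => false
  | hole :: _ => true
  | _ :: r => hasHole r

def nones : ℕ → List (Option Sol)
  | 0 => []
  | n + 1 => none :: nones n

def initSol (Γ : List E) (n : ℕ) (T : E) (full : Bool) : Option E → List (Option Sol)
  | some X => bif full then I.unify Γ 0 0 (cod n T) X (nones n) else nones n
  | none => nones n

/-- Matching only proposes values for the omitted arguments; `build` checks every argument against
its domain, so `unify` and `solve` need no correctness proof. A constant that depends on the
relations between the ambient levels may be used only at the identical levels, in a declaration of
the same kind. -/
def spine (Γ : List E) (t : E) (X : Option E) : Except Err (E × E) :=
  match t.head with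
  | hd h l k =>
    match V.find h with
    | some e =>
      bif e.amb && !(amb && lvid l k) then .error (.mk 4 Γ t t) else
      let as := t.args.reverse
      let T := e.ty.lm l k
      let as' := as.take e.n
      bif hasHole as' then
        build R I Γ (as.drop e.n)
          (solve I Γ T as' [] (initSol I Γ as'.length T (Nat.ble as.length e.n) X))
          T as' (hd h l k) []
      else build R I Γ (as.drop e.n) (nones as'.length) T as' (hd h l k) []
    | none => .error (.mk 5 Γ t t)
  | _ => .error (.mk 6 Γ t t)

def inferType (Γ : List E) (s : E) : Except Err (E × Lv) :=
  match I.infer Γ s with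
  | .ok (e, T) => match R.whnf Γ T with
    | univ l => .ok (e, l)
    | T' => .error (.mk 7 Γ e T')
  | .error x => .error x

def inferStep (Γ : List E) (s : E) : Except Err (E × E) :=
  match s with
  | var n => bif Nat.ble (n + 1) Γ.length then .ok (var n, (E.look Γ n).sh (n + 1) 0)
      else .error (.mk 8 Γ s s)
  | univ l => .ok (univ l, univ l.succ)
  | pi A B => match inferType R I Γ A with
    | .ok (A', l) => match inferType R I (A' :: Γ) B with
      | .ok (B', k) => .ok (pi A' B', univ (l.sup amb k))
      | .error x => .error x
    | .error x => .error x
  | lam A _ b => match inferType R I Γ A with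
    | .ok (A', _) => match I.infer (A' :: Γ) b with
      | .ok (b', B) => .ok (lam A' B b', pi A' B)
      | .error x => .error x
    | .error x => .error x
  | app _ _ f a => match I.infer Γ f with
    | .ok (f', T) => applyArgs R I Γ f' T [a]
    | .error x => .error x
  | hole => .error (.mk 10 Γ s s)
  | s => spine V amb R I Γ s none

def checkSub (Γ : List E) (T : E) (r : Except Err (E × E)) : Except Err E :=
  match r with
  | .ok (e, T') => bif R.subs amb Γ T' T then .ok e else .error (.mk 11 Γ T' T)
  | .error x => .error x

/-- `let x : A := a; b` has type `T` if `b` has. -/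
def checkLet (Γ : List E) (A b a T : E) : Except Err E :=
  match inferType R I Γ A with
  | .ok (A', _) => match I.check Γ a A' with
    | .ok a' => match I.check (A' :: Γ) b (T.sh 1 0) with
      | .ok b' => .ok (app A' (T.sh 1 0) (lam A' (T.sh 1 0) b') a')
      | .error x => .error x
    | .error x => .error x
  | .error x => .error x

/-- The type of a function is inferred if its codomain is marked by a function. -/
def checkStep (Γ : List E) (s T : E) : Except Err E :=
  match s with
  | lam A₀ X b => match X with
    | lam _ _ _ => checkSub amb R Γ T (I.infer Γ (lam A₀ X b))
    | _ => match R.whnf Γ T with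
      | pi A B => match I.check (A :: Γ) b B with
        | .ok b' => .ok (lam A B b')
        | .error x => .error x
      | T' => .error (.mk 12 Γ s T')
  | app A' B' f a => match f with
    | lam A _ b => match A' with
      | hole => checkLet R I Γ A b a T
      | _ => checkSub amb R Γ T (I.infer Γ (app A' B' f a))
    | f => checkSub amb R Γ T (I.infer Γ (app A' B' f a))
  | sapp f a => checkSub amb R Γ T (spine V amb R I Γ (sapp f a) (some T))
  | hole => .error (.mk 13 Γ s T)
  | s => checkSub amb R Γ T (I.infer Γ s)

end Elb

def elb (V : Env) (amb : Bool) (R : Red) (n : ℕ) : Elb :=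
  Nat.rec (motive := fun _ => Elb)
    ⟨fun Γ s => .error (.mk 0 Γ s s), fun Γ s _ => .error (.mk 0 Γ s s), fun _ _ _ _ _ s => s⟩
    (fun _ I => ⟨Elb.inferStep V amb R I, Elb.checkStep V amb R I, Elb.unifyStep R I⟩) n

end HoTT.Check

/-! ### Soundness of the checker: levels, erasure, typing, computed types. -/

namespace HoTT.Check
open Judgement Tm

/-! ## Levels -/

/-- The value of a level. -/
def Lv.ev (β : ℕ → ℕ) (l : Lv) : ℕ := β l.b + l.n

/-- Values of level variables after an instantiation of the variables `0` and `1`. -/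
def upd (β : ℕ → ℕ) (l k : Lv) (b : ℕ) : ℕ :=
  match b with
  | 0 => l.ev β
  | 1 => k.ev β
  | 5 => β 5 + l.n + k.n
  | b => β b

/-- The constraints on the values of level variables. -/
def Good (amb : Bool) (β : ℕ → ℕ) : Prop := β 2 = 0 ∧ (∀ b, β b ≤ β 5) ∧
  (amb = true → β 1 = max (β 0) (β 3) ∧ β 4 = max (β 0 + 1) (β 3))

/-- Equality except for the bound of all level variables. -/
def SameLv (β β' : ℕ → ℕ) : Prop := ∀ b, b ≠ 5 → β b = β' b

theorem Lv.eq_of_beq {l k : Lv} (h : l.beq k = true) : l = k := by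
  simp only [Lv.beq, Bool.and_eq_true] at h
  cases l; cases k
  simp_all

theorem Lv.ev_inst (β : ℕ → ℕ) (l k x : Lv) : (l.inst k x).ev β = x.ev (upd β l k) := by
  obtain ⟨b, n⟩ := x
  unfold Lv.inst Lv.ev upd
  split <;> simp_all [Lv.ev] <;> omega

theorem upd_of_lvid {β : ℕ → ℕ} {l k : Lv} (h : E.lvid l k = true) : upd β l k = β := by
  simp only [E.lvid, Bool.and_eq_true] at h
  obtain rfl := Lv.eq_of_beq h.1
  obtain rfl := Lv.eq_of_beq h.2
  funext b
  unfold upd Lv.ev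
  split <;> simp

/-- Relations such as `β 1 = max (β 0) (β 3)` do not survive an instantiation of the variables `0`
and `1`, so they are kept only under the identical one. Without them, only the bound has to be
preserved; this is why variable `5` absorbs the offsets `l.n` and `k.n`. -/
theorem Good.upd {amb : Bool} {β : ℕ → ℕ} (h : Good amb β) {amb' : Bool} {l k : Lv}
    (h' : amb' = true → amb = true ∧ E.lvid l k = true) : Good amb' (upd β l k) := by
  obtain ⟨h2, h5, ha⟩ := h
  cases amb' with
  | true =>
    obtain ⟨rfl, hl⟩ := h' rfl
    rw [upd_of_lvid hl]
    exact ⟨h2, h5, ha⟩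
  | false =>
    refine ⟨h2, fun b => ?_, by simp⟩
    have := h5 b
    have := h5 l.b
    have := h5 k.b
    simp only [Check.upd, Lv.ev]
    split <;> omega

theorem Good.le {amb : Bool} {β : ℕ → ℕ} (h : Good amb β) {l k : Lv} (hl : l.ble amb k = true) :
    l.ev β ≤ k.ev β := by
  obtain ⟨h2, h5, ha⟩ := h
  obtain ⟨b, n⟩ := l
  obtain ⟨c, m⟩ := k
  simp only [Lv.ble, Bool.or_eq_true, Bool.and_eq_true, Nat.beq_eq, Nat.ble_eq] at hl
  have := h5 b
  simp only [Lv.ev]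
  rcases hl with ⟨(h | h) | h, hn⟩ | ⟨rfl, ⟨⟨rfl, h⟩, hn⟩ | ⟨rfl, ⟨h, hn⟩ | ⟨h, hn⟩⟩⟩
  · subst h; omega
  · subst h; omega
  · subst h; omega
  · have := (ha rfl).1
    rcases h with rfl | rfl <;> omega
  · have := ha rfl
    rcases h with rfl | rfl <;> omega
  · have := ha rfl
    subst h; omega

theorem Good.le_sup {amb : Bool} {β : ℕ → ℕ} (h : Good amb β) (l k : Lv) :
    l.ev β ≤ (l.sup amb k).ev β ∧ k.ev β ≤ (l.sup amb k).ev β := by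
  unfold Lv.sup
  cases h1 : l.ble amb k with
  | true => exact ⟨h.le h1, le_rfl⟩
  | false =>
    cases h2 : k.ble amb l with
    | true => exact ⟨le_rfl, h.le h2⟩
    | false =>
      have := h.2.1 l.b
      have := h.2.1 k.b
      simp only [cond_false, Lv.ev]
      omega

/-! ## Substitution in annotated terms -/

namespace E

/-- Renaming. -/
def ren : (ℕ → ℕ) → E → E
  | r, var n => var (r n)
  | _, univ l => univ l
  | r, pi A B => pi (A.ren r) (B.ren (liftRen r))
  | r, lam A B b => lam (A.ren r) (B.ren (liftRen r)) (b.ren (liftRen r))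
  | r, app A B f a => app (A.ren r) (B.ren (liftRen r)) (f.ren r) (a.ren r)
  | _, hd h l k => hd h l k
  | r, sapp f a => sapp (f.ren r) (a.ren r)
  | _, hole => hole

/-- A substitution under one binder. -/
def up (s : ℕ → E) : ℕ → E
  | 0 => var 0
  | n + 1 => (s n).ren Nat.succ

/-- Simultaneous substitution. -/
def sb : (ℕ → E) → E → E
  | s, var n => s n
  | _, univ l => univ l
  | s, pi A B => pi (A.sb s) (B.sb (up s))
  | s, lam A B b => lam (A.sb s) (B.sb (up s)) (b.sb (up s))
  | s, app A B f a => app (A.sb s) (B.sb (up s)) (f.sb s) (a.sb s)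
  | _, hd h l k => hd h l k
  | s, sapp f a => sapp (f.sb s) (a.sb s)
  | _, hole => hole

theorem ren_ren (e : E) : ∀ r s : ℕ → ℕ, (e.ren s).ren r = e.ren fun n => r (s n) := by
  induction e <;> intro r s <;> simp_all [ren, liftRen_comp]

theorem ren_id (e : E) : e.ren (fun n => n) = e := by
  have : liftRen (fun n => n) = fun n => n := by funext n; cases n <;> rfl
  induction e <;> simp_all [ren]

theorem up_var (r : ℕ → ℕ) : up (fun n => var (r n)) = fun n => var (liftRen r n) := by
  funext n; cases n <;> rfl

theorem ren_eq_sb (e : E) : ∀ r : ℕ → ℕ, e.ren r = e.sb fun n => var (r n) := by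
  induction e <;> intro r <;> simp_all [ren, sb, up_var]

theorem sb_var (e : E) : e.sb var = e := by
  rw [← ren_eq_sb e fun n => n, ren_id]

/-- The operations with a cutoff, `sh` and `sub`, are for evaluation; `ren` and `sb`, which take
functions on variables, are for proofs. -/
theorem sh_eq (d : ℕ) (e : E) : ∀ c, e.sh d c = e.ren fun n => if c ≤ n then n + d else n := by
  have lift (c : ℕ) : liftRen (fun n => if c ≤ n then n + d else n) =
      fun n => if c + 1 ≤ n then n + d else n := by
    funext n
    cases n with
    | zero => simp [liftRen]
    | succ n => simp only [liftRen, Nat.add_le_add_iff_right]; split <;> omega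
  induction e with
  | var n =>
    intro c
    simp only [sh, ren]
    cases h : Nat.ble c n <;> simp_all [Nat.ble_eq, ← Bool.not_eq_true]
  | univ | hd | hole => exact fun _ => rfl
  | pi A B ihA ihB => exact fun c => by rw [ren, lift, ← ihA, ← ihB]; rfl
  | lam A B b ihA ihB ihb => exact fun c => by rw [ren, lift, ← ihA, ← ihB, ← ihb]; rfl
  | app A B f a ihA ihB ihf iha =>
    exact fun c => by rw [ren, lift, ← ihA, ← ihB, ← ihf, ← iha]; rfl
  | sapp f a ihf iha => exact fun c => by rw [ren, ← ihf, ← iha]; rfl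

theorem sh_zero (d : ℕ) (e : E) : e.sh d 0 = e.ren fun n => n + d := by
  simp [sh_eq]

theorem sub_eq (s : List E) (e : E) : ∀ c, e.sub s c =
    e.sb fun n => if c ≤ n then (look s (n - c)).ren (fun n => n + c) else var n := by
  have lift (c : ℕ) : up (fun n => if c ≤ n then (look s (n - c)).ren (fun n => n + c) else var n) =
      fun n => if c + 1 ≤ n then (look s (n - (c + 1))).ren (fun n => n + (c + 1)) else var n := by
    funext n
    cases n with
    | zero => simp [up]
    | succ n =>
      simp only [up, Nat.add_le_add_iff_right, Nat.add_sub_add_right]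
      split
      · rw [ren_ren]; rfl
      · rfl
  induction e with
  | var n =>
    intro c
    simp only [sub, sb]
    cases h : Nat.ble c n with
    | false => simp_all [Nat.ble_eq, ← Bool.not_eq_true]
    | true =>
      rw [Nat.ble_eq] at h
      cases c with
      | zero => simp [ren_id]
      | succ c =>
        rw [show Nat.beq (c + 1) 0 = false from rfl]
        simp [h, sh_zero]
  | univ | hd | hole => exact fun _ => rfl
  | pi A B ihA ihB => exact fun c => by rw [sb, lift, ← ihA, ← ihB]; rfl
  | lam A B b ihA ihB ihb => exact fun c => by rw [sb, lift, ← ihA, ← ihB, ← ihb]; rfl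
  | app A B f a ihA ihB ihf iha =>
    exact fun c => by rw [sb, lift, ← ihA, ← ihB, ← ihf, ← iha]; rfl
  | sapp f a ihf iha => exact fun c => by rw [sb, ← ihf, ← iha]; rfl

theorem sub_zero (s : List E) (e : E) : e.sub s 0 = e.sb (look s) := by
  simp [sub_eq, ren_id]

/-- The arguments and the head determine a spine. -/
def spine (f : E) (s : List E) : E := s.foldr (fun a f => sapp f a) f

theorem spine_head_args (t : E) : t.head.spine t.args = t := by
  induction t with
  | sapp f a ihf => exact congrArg (sapp · a) ihf
  | _ => rfl

end E

/-! ## Erasure -/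

open E

/-- The raw term of an annotated term. -/
def er (V : Env) (β : ℕ → ℕ) : E → Tm
  | .var n => .var n
  | .univ l => .univ (l.ev β)
  | .pi A B => .pi (er V β A) (er V β B)
  | .lam A _ b => .lam (er V β A) (er V β b)
  | .app _ _ f a => .app (er V β f) (er V β a)
  | .hd h l k => match V.find h with
    | some e => e.den (upd β l k)
    | none => .univ 0
  | .sapp f a => .app (er V β f) (er V β a)
  | .hole => .univ 0

/-- The terms that constants denote are closed. -/
def DenClosed (V : Env) : Prop := ∀ h e, V.find h = some e → ∀ β, Scoped 0 (e.den β)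

/-- The terms that constants denote do not depend on the bound of the level variables. -/
def DenSame (V : Env) : Prop :=
  ∀ h e, V.find h = some e → ∀ β β', SameLv β β' → e.den β = e.den β'

theorem er_beq {V : Env} {β : ℕ → ℕ} {t : E} : ∀ {u : E}, t.beq u = true → er V β t = er V β u := by
  induction t with
  | var n =>
    intro u h
    cases u <;> first | cases h | exact congrArg Tm.var (Nat.eq_of_beq_eq_true h)
  | univ l =>
    intro u h
    cases u <;> first | cases h | rw [Lv.eq_of_beq (l := l) h]
  | pi A B ihA ihB =>
    intro u h
    cases u <;> first | cases h | skip
    have h := (Bool.and_eq_true _ _).mp h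
    rw [er, er, ihA h.1, ihB h.2]
  | lam A B b ihA _ ihb =>
    intro u h
    cases u <;> first | cases h | skip
    have h := (Bool.and_eq_true _ _).mp h
    rw [er, er, ihA h.1, ihb h.2]
  | app A B f a _ _ ihf iha =>
    intro u h
    cases u <;> first | cases h | skip
    have h := (Bool.and_eq_true _ _).mp h
    rw [er, er, ihf h.1, iha h.2]
  | hd h l k =>
    intro u h
    cases u <;> first | cases h | skip
    have h := (Bool.and_eq_true _ _).mp h
    have h' := (Bool.and_eq_true _ _).mp h.1
    rw [Nat.eq_of_beq_eq_true h'.1, Lv.eq_of_beq h'.2, Lv.eq_of_beq h.2]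
  | sapp f a ihf iha =>
    intro u h
    cases u <;> first | cases h | skip
    have h := (Bool.and_eq_true _ _).mp h
    rw [er, er, ihf h.1, iha h.2]
  | hole => intro u h; cases h

theorem er_ren {V : Env} (hV : DenClosed V) (β : ℕ → ℕ) (e : E) :
    ∀ r, er V β (e.ren r) = (er V β e).rename r := by
  induction e with
  | hd h l k =>
    intro r
    rw [ren, er]
    split
    · exact ((hV _ _ ‹_› _).rename r).symm
    · rfl
  | _ => intro r; simp_all [ren, er, rename]

theorem er_up {V : Env} (hV : DenClosed V) (β : ℕ → ℕ) (s : ℕ → E) :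
    (fun n => er V β (up s n)) = liftSub fun n => er V β (s n) := by
  funext n
  cases n with
  | zero => rfl
  | succ n => exact er_ren hV β (s n) _

theorem er_sb {V : Env} (hV : DenClosed V) (β : ℕ → ℕ) (e : E) :
    ∀ s, er V β (e.sb s) = (er V β e).subst fun n => er V β (s n) := by
  induction e with
  | hd h l k =>
    intro r
    rw [sb, er]
    split
    · exact ((hV _ _ ‹_› _).subst _).symm
    · rfl
  | _ => intro r; simp_all [sb, er, Tm.subst, er_up]

theorem er_look (V : Env) (β : ℕ → ℕ) (s : List E) :
    (fun n => er V β (look s n)) = ofList (s.map (er V β)) := by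
  induction s with
  | nil => rfl
  | cons a s ih =>
    funext n
    cases n with
    | zero => rfl
    | succ n => exact congrFun ih n

theorem er_sub {V : Env} (hV : DenClosed V) (β : ℕ → ℕ) (e : E) (s : List E) :
    er V β (e.sub s 0) = (er V β e).subst (ofList (s.map (er V β))) := by
  rw [sub_zero, er_sb hV, er_look]

theorem er_inst {V : Env} (hV : DenClosed V) (β : ℕ → ℕ) (b a : E) :
    er V β (b.inst a) = (er V β b).inst (er V β a) := by
  rw [E.inst, er_sub hV, Tm.inst, single_eq]
  rfl

theorem er_sh {V : Env} (hV : DenClosed V) (β : ℕ → ℕ) (e : E) (d : ℕ) :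
    er V β (e.sh d 0) = (er V β e).shift d := by
  rw [sh_zero, er_ren hV]
  rfl

theorem er_spine (V : Env) (β : ℕ → ℕ) (f : E) (s : List E) :
    er V β (f.spine s) = apps (er V β f) (s.map (er V β)) := by
  induction s with
  | nil => rfl
  | cons a s ih => exact congrArg (Tm.app · _) ih

theorem SameLv.upd {β β' : ℕ → ℕ} {l k : Lv} (h : SameLv β β') (hl : l.b ≠ 5) (hk : k.b ≠ 5) :
    SameLv (upd β l k) (upd β' l k) := by
  intro b hb
  unfold Check.upd Lv.ev
  split
  · rw [h _ hl]
  · rw [h _ hk]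
  · exact absurd rfl hb
  · exact h _ hb

/-- The bound, variable `5`, accumulates different offsets on the two sides. Hence the agreement of
`SameLv` excludes it, and types and denotations of constants must not mention it. -/
theorem upd_upd (β : ℕ → ℕ) (l k x y : Lv) :
    SameLv (upd β (l.inst k x) (l.inst k y)) (upd (upd β l k) x y) := by
  intro b hb
  match b with
  | 0 => exact Lv.ev_inst ..
  | 1 => exact Lv.ev_inst ..
  | 5 => exact absurd rfl hb
  | 2 | 3 | 4 | n + 6 => rfl

theorem er_lmap {V : Env} (hV : DenSame V) (β : ℕ → ℕ) (l k : Lv) (e : E) :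
    er V β (e.lmap l k) = er V (upd β l k) e := by
  induction e with
  | var | hole => rfl
  | univ x => exact congrArg _ (Lv.ev_inst ..)
  | pi A B ihA ihB => rw [er, ← ihA, ← ihB]; rfl
  | lam A B b ihA _ ihb => rw [er, ← ihA, ← ihb]; rfl
  | app A B f a _ _ ihf iha => rw [er, ← ihf, ← iha]; rfl
  | sapp f a ihf iha => rw [er, ← ihf, ← iha]; rfl
  | hd h x y =>
    change er V β (hd h (l.inst k x) (l.inst k y)) = _
    rw [er, er]
    split
    · exact hV _ _ ‹_› _ _ fun b hb => upd_upd β l k x y b hb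
    · rfl

theorem er_lm {V : Env} (hV : DenSame V) (β : ℕ → ℕ) (l k : Lv) (e : E) :
    er V β (e.lm l k) = er V (upd β l k) e := by
  unfold lm
  cases h : lvid l k with
  | true => rw [upd_of_lvid h]; rfl
  | false => exact er_lmap hV ..

/-- The free variables of the raw term are less than `n`, and it does not depend on the bound of the
level variables. -/
noncomputable def plain (e : E) : ℕ → Bool :=
  E.rec (motive := fun _ => ℕ → Bool) (fun m n => Nat.blt m n) (fun l _ => !Nat.beq l.b 5)
    (fun _ _ A B n => A n && B (n + 1)) (fun _ _ _ A _ b n => A n && b (n + 1))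
    (fun _ _ _ _ _ _ f a n => f n && a n) (fun _ l k _ => !Nat.beq l.b 5 && !Nat.beq k.b 5)
    (fun _ _ f a n => f n && a n) (fun _ => true) e

theorem scoped_of_plain {V : Env} (hV : DenClosed V) (β : ℕ → ℕ) {e : E} :
    ∀ {n}, plain e n = true → Scoped n (er V β e) := by
  induction e with
  | var m => intro n h s hs; exact hs m (by simpa [plain, Nat.blt_eq] using h)
  | univ | hole => exact fun _ s _ => rfl
  | pi A B ihA ihB | lam A _ B ihA _ ihB =>
    intro n h s hs
    have h := (Bool.and_eq_true _ _).mp h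
    rw [er, Tm.subst, ihA h.1 s hs, ihB h.2 _ (liftSub_eq_var hs)]
  | app _ _ f a _ _ ihf iha | sapp f a ihf iha =>
    intro n h s hs
    have h := (Bool.and_eq_true _ _).mp h
    rw [er, Tm.subst, ihf h.1 s hs, iha h.2 s hs]
  | hd h l k =>
    intro n _ s _
    rw [er]
    split
    · exact (hV _ _ ‹_› _).subst _
    · rfl

theorem er_same {V : Env} (hV : DenSame V) {β β' : ℕ → ℕ} (hβ : SameLv β β') {e : E} :
    ∀ {n}, plain e n = true → er V β e = er V β' e := by
  induction e with
  | var | hole => exact fun _ => rfl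
  | univ l =>
    intro n h
    rw [er, er, Lv.ev, Lv.ev, hβ]
    rintro h'
    simp [plain, h'] at h
  | pi A B ihA ihB | lam A _ B ihA _ ihB =>
    intro n h
    have h := (Bool.and_eq_true _ _).mp h
    rw [er, er, ihA h.1, ihB h.2]
  | app _ _ f a _ _ ihf iha | sapp f a ihf iha =>
    intro n h
    have h := (Bool.and_eq_true _ _).mp h
    rw [er, er, ihf h.1, iha h.2]
  | hd x l k =>
    intro n h
    have h := (Bool.and_eq_true _ _).mp h
    rw [er, er]
    split
    · refine hV _ _ ‹_› _ _ (hβ.upd ?_ ?_) <;> rintro h' <;> simp [h'] at h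
    · rfl

end HoTT.Check

namespace HoTT.Check
open Judgement Tm E

/-! ## Subsumption -/

/-- An element of the first type is an element of the second one. -/
inductive Le (Γ : Ctx) : Tm → Tm → Prop
  | refl (T : Tm) : Le Γ T T
  | conv {A B : Tm} {i : ℕ} : Derivable (eq Γ A B (.univ i)) → Le Γ A B
  | cumul (i : ℕ) : Le Γ (.univ i) (.univ (i + 1))
  | trans {A B C : Tm} : Le Γ A B → Le Γ B C → Le Γ A C

namespace Le
variable {Γ : Ctx} {A B a b : Tm} {i j : ℕ}

theorem univ (h : i ≤ j) : Le Γ (.univ i) (.univ j) := by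
  induction h with
  | refl => exact .refl _
  | step _ ih => exact ih.trans (.cumul _)

theorem of (h : Le Γ A B) : ∀ {a}, Derivable (of Γ a A) → Derivable (of Γ a B) := by
  induction h with
  | refl => exact id
  | conv h => exact fun ha => .conv ha h
  | cumul => exact .cumul
  | trans _ _ ih ih' => exact fun ha => ih' (ih ha)

theorem eq (h : Le Γ A B) : ∀ {a b}, Derivable (eq Γ a b A) → Derivable (eq Γ a b B) := by
  induction h with
  | refl => exact id
  | conv h => exact fun ha => .conv_eq ha h
  | cumul => exact .cumul_eq
  | trans _ _ ih ih' => exact fun ha => ih' (ih ha)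

theorem subst {P : (ℕ → Tm) → Ctx → Ctx → Prop} (hP : SubstClass P) {s : ℕ → Tm} {Δ : Ctx}
    (hs : P s Γ Δ) (h : Le Γ A B) : Le Δ (A.subst s) (B.subst s) := by
  induction h with
  | refl => exact .refl _
  | conv h => exact .conv ((h.stable hP).2 _ _ hs)
  | cumul => exact .cumul _
  | trans _ _ ih ih' => exact ih.trans ih'

end Le

/-! ## Typing of annotated terms -/

section

variable (V : Env) (amb : Bool) (β : ℕ → ℕ)

/-- The type of a spine, and the number of further arguments that it may have. -/
def spT : E → Option (ℕ × Tm)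
  | .hd h l k => match V.find h with
    | some e => some (e.n, er V (upd β l k) e.ty)
    | none => none
  | .sapp f a => match spT f with
    | some (n + 1, .pi _ B) => some (n, B.inst (er V β a))
    | _ => none
  | _ => none

/-- An annotated term has a type. -/
inductive Has : Ctx → E → Tm → Prop
  | var {Γ n A T} : Γ[n]? = some A → Le Γ (A.shift (n + 1)) T → Has Γ (.var n) T
  | univ {Γ l T} : Le Γ (.univ (l.ev β + 1)) T → Has Γ (.univ l) T
  | pi {Γ A B i T} : Has Γ A (.univ i) → Has (er V β A :: Γ) B (.univ i) → Le Γ (.univ i) T →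
      Has Γ (.pi A B) T
  | lam {Γ A B b i T} : Has Γ A (.univ i) → Has (er V β A :: Γ) B (.univ i) →
      Has (er V β A :: Γ) b (er V β B) → Le Γ (.pi (er V β A) (er V β B)) T →
      Has Γ (.lam A B b) T
  | app {Γ A B f a i T} : Has Γ A (.univ i) → Has (er V β A :: Γ) B (.univ i) →
      Has Γ f (.pi (er V β A) (er V β B)) → Has Γ a (er V β A) →
      Le Γ ((er V β B).inst (er V β a)) T → Has Γ (.app A B f a) T
  | hd {Γ h l k e T} : V.find h = some e → (e.amb = true → amb = true ∧ lvid l k = true) →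
      Le Γ (er V (upd β l k) e.ty) T → Has Γ (.hd h l k) T
  | sapp {Γ f a n A B T} : spT V β f = some (n + 1, .pi A B) → Has Γ f (.pi A B) → Has Γ a A →
      Le Γ (B.inst (er V β a)) T → Has Γ (.sapp f a) T

/-- The type of every constant is closed, and independent of the bound of the level variables. -/
structure Plain : Prop where
  closed : DenClosed V
  same : DenSame V
  ty : ∀ h e, V.find h = some e → plain e.ty 0 = true

end

variable {V : Env} {amb : Bool} {β : ℕ → ℕ}

/-- Every rule of `Has` ends with a subsumption, so no separate conversion rule is needed, and a
case distinction on a typing recovers the premises at once. -/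
theorem Has.le {Γ : Ctx} {e : E} {T T' : Tm} (h : Has V amb β Γ e T) (hT : Le Γ T T') :
    Has V amb β Γ e T' := by
  cases h with
  | var h h' => exact .var h (h'.trans hT)
  | univ h => exact .univ (h.trans hT)
  | pi h h' hl => exact .pi h h' (hl.trans hT)
  | lam h h' h'' hl => exact .lam h h' h'' (hl.trans hT)
  | app h h' hf ha hl => exact .app h h' hf ha (hl.trans hT)
  | hd h h' hl => exact .hd h h' (hl.trans hT)
  | sapp h hf ha hl => exact .sapp h hf ha (hl.trans hT)

theorem Has.up {Γ : Ctx} {e : E} {i j : ℕ} (h : Has V amb β Γ e (.univ i)) (hi : i ≤ j) :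
    Has V amb β Γ e (.univ j) := h.le (.univ hi)

theorem spT_sb (hV : Plain V) (s : ℕ → E) {f : E} : ∀ {n : ℕ} {T : Tm}, spT V β f = some (n, T) →
    spT V β (f.sb s) = some (n, T.subst fun n => er V β (s n)) := by
  induction f with
  | hd h l k =>
    intro n T hT
    rw [sb, spT] at *
    split at hT <;> cases hT
    rw [(scoped_of_plain hV.closed _ (hV.ty _ _ ‹_›)).subst]
  | sapp f a ih =>
    intro n T hT
    rw [spT] at hT
    split at hT <;> cases hT
    rw [sb, spT, ih ‹_›]
    simp only [Tm.subst]
    rw [subst_inst, er_sb hV.closed]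
  | _ => intro _ _ h; cases h

/-- A class of well-typed substitutions that is closed under extension by a bound variable. -/
structure ESubst (V : Env) (amb : Bool) (β : ℕ → ℕ) (P : (ℕ → E) → Ctx → Ctx → Prop) : Prop where
  ok : ∀ {s Γ Δ}, P s Γ Δ → ∃ Q, SubstClass Q ∧ Q (fun n => er V β (s n)) Γ Δ
  var : ∀ {s Γ Δ n A}, P s Γ Δ → Γ[n]? = some A →
    Has V amb β Δ (s n) ((A.shift (n + 1)).subst fun n => er V β (s n))
  lift : ∀ {s Γ Δ A i}, P s Γ Δ → Has V amb β Δ A (.univ i) → ∀ {A'},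
    er V β A = A'.subst (fun n => er V β (s n)) → P (up s) (A' :: Γ) (er V β A :: Δ)

theorem Has.sb (hV : Plain V) {P : (ℕ → E) → Ctx → Ctx → Prop} (hP : ESubst V amb β P) {Γ : Ctx}
    {e : E} {T : Tm} (h : Has V amb β Γ e T) : ∀ {s Δ}, P s Γ Δ →
      Has V amb β Δ (e.sb s) (T.subst fun n => er V β (s n)) := by
  have le {s Γ Δ A B} (hs : P s Γ Δ) (h : Le Γ A B) :
      Le Δ (A.subst fun n => er V β (s n)) (B.subst fun n => er V β (s n)) := by
    obtain ⟨Q, hQ, hs⟩ := hP.ok hs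
    exact h.subst hQ hs
  induction h with
  | var hA hT => exact fun hs => (hP.var hs hA).le (le hs hT)
  | univ hT => exact fun hs => .univ (le hs hT)
  | pi _ _ hT ihA ihB =>
    intro s Δ hs
    have := ihB (hP.lift hs (ihA hs) (er_sb hV.closed ..))
    exact .pi (ihA hs) this (le hs hT)
  | lam _ _ _ hT ihA ihB ihb =>
    intro s Δ hs
    have hs' := hP.lift hs (ihA hs) (er_sb hV.closed ..)
    refine .lam (ihA hs) (ihB hs') ?_ ?_
    · have := ihb hs'
      rwa [← er_sb hV.closed] at this
    · rw [er_sb hV.closed, er_sb hV.closed, er_up hV.closed]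
      exact le hs hT
  | app _ _ _ _ hT ihA ihB ihf iha =>
    intro s Δ hs
    have hs' := hP.lift hs (ihA hs) (er_sb hV.closed ..)
    refine .app (ihA hs) (ihB hs') ?_ ?_ ?_
    · rw [er_sb hV.closed, er_sb hV.closed, er_up hV.closed]
      exact ihf hs
    · rw [er_sb hV.closed]
      exact iha hs
    · rw [er_sb hV.closed, er_sb hV.closed, er_up hV.closed, ← subst_inst]
      exact le hs hT
  | hd h h' hT =>
    intro s Δ hs
    refine .hd h h' ?_
    rw [← (scoped_of_plain hV.closed _ (hV.ty _ _ h)).subst fun n => er V β (s n)]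
    exact le hs hT
  | sapp h _ _ hT ihf iha =>
    intro s Δ hs
    refine .sapp (spT_sb hV s h) (ihf hs) (iha hs) ?_
    rw [er_sb hV.closed, ← subst_inst]
    exact le hs hT

end HoTT.Check

namespace HoTT.Check
open Judgement Tm E

/-! ## Well-formed signatures -/

section

variable (V : Env) (amb : Bool) (β : ℕ → ℕ)

/-- The terms `s` are elements of the types `Δ`. -/
def HasArgs (Γ : Ctx) : List E → Ctx → Prop
  | [], [] => True
  | a :: s, A :: Δ => HasArgs Γ s Δ ∧ Has V amb β Γ a (A.subst (ofList (s.map (er V β))))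
  | _, _ => False

/-- A well-formed context. -/
def Wf : List E → Prop
  | [] => True
  | A :: Γ => Wf Γ ∧ ∃ i, Has V amb β (Γ.map (er V β)) A (.univ i)

/-- The variables from `k` to `k + n - 1`. -/
def vars (k n : ℕ) : List E := (List.range n).map fun m => .var (k + m)

/-- A computation rule for a constant `t` with arguments `Δ` and values in `R` is valid. -/
structure RuleOk (t : Tm) (Δ : List E) (R : E) (r : IRule) : Prop where
  length : r.rest.length + r.np = Δ.length
  wf : Wf V amb β (r.tys ++ Δ.drop r.rest.length)
  args : HasArgs V amb β ((r.tys ++ Δ.drop r.rest.length).map (er V β))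
    (r.rest ++ vars r.tys.length r.np) (Δ.map (er V β))
  rhs : Has V amb β ((r.tys ++ Δ.drop r.rest.length).map (er V β)) r.rhs
    ((er V β R).subst (ofList ((r.rest ++ vars r.tys.length r.np).map (er V β))))
  eq : Derivable (eq []
    (lams ((r.tys ++ Δ.drop r.rest.length).map (er V β))
      (apps t ((r.rest ++ vars r.tys.length r.np).map (er V β))))
    (lams ((r.tys ++ Δ.drop r.rest.length).map (er V β)) (er V β r.rhs))
    (pis ((r.tys ++ Δ.drop r.rest.length).map (er V β))
      ((er V β R).subst (ofList ((r.rest ++ vars r.tys.length r.np).map (er V β))))))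

end

/-- Dependent function type over a context. -/
def epis (Δ : List E) (R : E) : E := Δ.foldl (fun B A => .pi A B) R

/-- A constant is valid. -/
structure EntryOk (V : Env) (e : Entry) : Prop where
  ty : ∀ β, Good e.amb β → ∃ i, Has V e.amb β [] e.ty (.univ i)
  den : ∀ β, Good e.amb β → Derivable (of [] (e.den β) (er V β e.ty))
  args : ∃ Δ R, e.ty = epis Δ R ∧ Δ.length = e.n ∧
    (∀ b ∈ e.body, ∀ β, Good e.amb β → Has V e.amb β (Δ.map (er V β)) b (er V β R) ∧
      e.den β = lams (Δ.map (er V β)) (er V β b)) ∧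
    ∀ r ∈ e.rules, ∀ β, Good e.amb β → RuleOk V e.amb β (e.den β) Δ R r

structure EnvOk (V : Env) : Prop extends Plain V where
  entry : ∀ h e, V.find h = some e → EntryOk V e

variable {V : Env} {amb : Bool} {β : ℕ → ℕ}

/-- The passage to the formal system: each typing rule erases to one inference rule followed by a
subsumption, and a constant contributes the derivation stored with its signature entry. -/
theorem Has.of (hV : EnvOk V) (hβ : Good amb β) {Γ : Ctx} {e : E} {T : Tm}
    (h : Has V amb β Γ e T) : Derivable (ctx Γ) → Derivable (of Γ (er V β e) T) := by
  induction h with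
  | var hA hT => exact fun hΓ => hT.of (.var hΓ hA)
  | univ hT => exact fun hΓ => hT.of (.univ hΓ)
  | pi _ _ hT ihA ihB => exact fun hΓ => hT.of (.pi (ihA hΓ) (ihB (.ctx_cons (ihA hΓ))))
  | lam _ _ _ hT ihA _ ihb => exact fun hΓ => hT.of (.lam (ihA hΓ) (ihb (.ctx_cons (ihA hΓ))))
  | app _ _ _ _ hT _ _ ihf iha => exact fun hΓ => hT.of (.app (ihf hΓ) (iha hΓ))
  | hd h ha hT =>
    intro hΓ
    refine hT.of ?_
    rw [er, h]
    exact ((hV.entry _ _ h).den _ (hβ.upd ha)).closed hΓ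
  | sapp _ _ _ hT ihf iha => exact fun hΓ => hT.of (.app (ihf hΓ) (iha hΓ))

theorem Wf.ctx (hV : EnvOk V) (hβ : Good amb β) : ∀ {Γ : List E}, Wf V amb β Γ →
    Derivable (ctx (Γ.map (er V β)))
  | [], _ => .ctx_nil
  | _ :: _, ⟨h, _, hA⟩ => .ctx_cons (hA.of hV hβ (h.ctx hV hβ))

/-! ## Substitution -/

theorem eSubst_ren (hV : EnvOk V) (hβ : Good amb β) : ESubst V amb β fun s Γ Δ =>
    ∃ r : ℕ → ℕ, s = (fun n => .var (r n)) ∧ Derivable (ctx Δ) ∧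
      ∀ n A, Γ[n]? = some A → ∃ B, Δ[r n]? = some B ∧
        B.shift (r n + 1) = (A.shift (n + 1)).rename r where
  ok := by
    rintro _ Γ Δ ⟨r, rfl, hΔ, h⟩
    exact ⟨_, substClass_renOk, hΔ, r, rfl, h⟩
  var := by
    rintro _ Γ Δ n A ⟨r, rfl, hΔ, h⟩ hn
    obtain ⟨B, hB, e⟩ := h n A hn
    refine .var hB ?_
    rw [e, rename_eq_subst]
    exact .refl _
  lift := by
    rintro _ Γ Δ A i ⟨r, rfl, hΔ, h⟩ hA A' hA'
    have h' : RenOk (fun n => .var (r n)) Γ Δ := ⟨hΔ, r, rfl, h⟩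
    have hA := hA.of hV hβ hΔ
    rw [hA'] at hA ⊢
    obtain ⟨h, r', e, h'⟩ := substClass_renOk.lift h' hA
    obtain rfl : liftRen r = r' := by
      funext n
      rw [liftSub_ren] at e
      simpa using congrFun e n
    exact ⟨liftRen r, up_var r, h, h'⟩

theorem Has.weaken (hV : EnvOk V) (hβ : Good amb β) {Γ : Ctx} {A T : Tm} {e : E}
    (h : Has V amb β Γ e T) (hA : Derivable (ctx (A :: Γ))) :
    Has V amb β (A :: Γ) (e.sh 1 0) (T.shift 1) := by
  rw [sh_zero, ren_eq_sb, shift, rename_eq_subst]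
  exact h.sb hV.toPlain (eSubst_ren hV hβ)
    ⟨_, rfl, hA, fun n B hB => ⟨B, by simpa using hB, by rw [← shift_shift]; rfl⟩⟩

theorem eSubst_has (hV : EnvOk V) (hβ : Good amb β) : ESubst V amb β fun s Γ Δ =>
    Derivable (ctx Δ) ∧ ∀ n A, Γ[n]? = some A →
      Has V amb β Δ (s n) ((A.shift (n + 1)).subst fun n => er V β (s n)) where
  ok := by
    rintro s Γ Δ ⟨hΔ, h⟩
    exact ⟨_, substClass_subOk, hΔ, fun n A hA => (h n A hA).of hV hβ hΔ⟩
  var h hn := h.2 _ _ hn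
  lift := by
    rintro s Γ Δ A i ⟨hΔ, h⟩ hA A' hA'
    have hΔ' := Derivable.ctx_cons (hA.of hV hβ hΔ)
    refine ⟨hΔ', ?_⟩
    rw [hA'] at hΔ' ⊢
    rw [er_up hV.closed]
    rintro (_ | n) B hB
    · simp only [List.getElem?_cons_zero, Option.some.injEq] at hB
      subst hB
      rw [shift_subst_liftSub]
      exact .var rfl (.refl _)
    · rw [← shift_shift, shift_subst_liftSub, up, show Nat.succ = fun n => n + 1 from rfl, ← sh_zero]
      exact (h n B (by simpa using hB)).weaken hV hβ hΔ'

theorem HasArgs.sub (hV : EnvOk V) {Γ : Ctx} : ∀ {s : List E} {Δ : Ctx}, HasArgs V amb β Γ s Δ →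
    ∀ n A, Δ[n]? = some A →
      Has V amb β Γ (look s n) ((A.shift (n + 1)).subst fun n => er V β (look s n))
  | [], [], _, n, A, hA => by simp at hA
  | a :: s, A :: Δ, h, n, B, hB => by
    rw [er_look, List.map_cons, ofList, List.foldr_cons]
    cases n with
    | zero =>
      simp only [List.getElem?_cons_zero, Option.some.injEq] at hB
      subst hB
      rw [shift_subst_scons]
      exact h.2
    | succ n =>
      rw [← shift_shift, shift_subst_scons]
      have := h.1.sub hV n B (by simpa using hB)
      rwa [er_look] at this

theorem Has.subst (hV : EnvOk V) (hβ : Good amb β) {Γ Δ : Ctx} {s : List E} {e : E} {T : Tm}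
    (h : Has V amb β Δ e T) (hΓ : Derivable (ctx Γ)) (hs : HasArgs V amb β Γ s Δ) :
    Has V amb β Γ (e.sub s 0) (T.subst (ofList (s.map (er V β)))) := by
  rw [sub_zero, ← er_look]
  exact h.sb hV.toPlain (eSubst_has hV hβ) ⟨hΓ, hs.sub hV⟩

theorem Has.inst (hV : EnvOk V) (hβ : Good amb β) {Γ : Ctx} {A T : Tm} {e a : E}
    (h : Has V amb β (A :: Γ) e T) (ha : Has V amb β Γ a A) (hΓ : Derivable (ctx Γ)) :
    Has V amb β Γ (e.inst a) (T.inst (er V β a)) := by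
  rw [E.inst, sub_zero, Tm.inst, single_eq]
  have := h.sb hV.toPlain (eSubst_has hV hβ) (s := look [a]) (Δ := Γ) ⟨hΓ, ?_⟩
  · rwa [er_look] at this
  · rw [er_look]
    rintro (_ | n) B hB
    · simp only [List.getElem?_cons_zero, Option.some.injEq] at hB
      subst hB
      rw [List.map_cons, ofList, List.foldr_cons, shift_subst_scons]
      change Has V amb β Γ a (A.subst Tm.var)
      rwa [subst_var]
    · rw [← shift_shift, List.map_cons, ofList, List.foldr_cons, shift_subst_scons]
      refine .var (by simpa using hB) ?_
      change Le Γ _ ((B.shift (n + 1)).subst Tm.var)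
      rw [subst_var]
      exact .refl _

/-- Replacement of the last type of a context by an equal one. -/
theorem Has.conv_ctx (hV : EnvOk V) (hβ : Good amb β) {Γ : Ctx} {A A' T : Tm} {e : E} {i : ℕ}
    (h : Has V amb β (A :: Γ) e T) (hA : Derivable (eq Γ A' A (.univ i)))
    (hA' : Derivable (ctx (A' :: Γ))) : Has V amb β (A' :: Γ) e T := by
  have := h.sb hV.toPlain (eSubst_has hV hβ) (s := .var) (Δ := A' :: Γ) ⟨hA', ?_⟩
  · rw [sb_var] at this
    convert this using 1
    exact (subst_var T).symm
  · intro n B hB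
    change Has _ _ _ _ _ ((B.shift (n + 1)).subst Tm.var)
    rw [subst_var]
    cases n with
    | zero =>
      simp only [List.getElem?_cons_zero, Option.some.injEq] at hB
      subst hB
      exact .var rfl (.conv (.weaken_eq hA' hA))
    | succ n => exact .var (by simpa using hB) (.refl _)

/-! ## Instantiation of levels -/

theorem spT_lmap (hV : Plain V) (l k : Lv) {f : E} : ∀ {n : ℕ} {T : Tm},
    spT V (upd β l k) f = some (n, T) → spT V β (f.lmap l k) = some (n, T) := by
  induction f with
  | hd h x y =>
    intro n T hT
    change spT V β (.hd h (l.inst k x) (l.inst k y)) = _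
    rw [spT] at *
    split at hT <;> cases hT
    rw [er_same hV.same (upd_upd β l k x y) (hV.ty _ _ ‹_›)]
  | sapp f a ih =>
    intro n T hT
    change spT V β (.sapp (f.lmap l k) (a.lmap l k)) = _
    rw [spT] at hT
    split at hT <;> cases hT
    rw [spT, ih ‹_›, er_lmap hV.same]
  | _ => intro _ _ h; cases h

theorem lmap_pi (l k : Lv) (A B : E) : (pi A B).lmap l k = pi (A.lmap l k) (B.lmap l k) := rfl

theorem lmap_lam (l k : Lv) (A B b : E) :
    (lam A B b).lmap l k = lam (A.lmap l k) (B.lmap l k) (b.lmap l k) := rfl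

theorem lmap_app (l k : Lv) (A B f a : E) :
    (app A B f a).lmap l k = app (A.lmap l k) (B.lmap l k) (f.lmap l k) (a.lmap l k) := rfl

theorem lmap_sapp (l k : Lv) (f a : E) :
    (sapp f a).lmap l k = sapp (f.lmap l k) (a.lmap l k) := rfl

/-- The source typing excludes constants tied to the ambient levels, the only ones for which an
instantiation of levels could fail. -/
theorem Has.lmap (hV : Plain V) {l k : Lv} {Γ : Ctx} {e : E} {T : Tm}
    (h : Has V false (upd β l k) Γ e T) : Has V amb β Γ (e.lmap l k) T := by
  induction h with
  | var hA hT => exact .var hA hT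
  | univ hT => exact .univ (by rwa [Lv.ev_inst])
  | pi _ _ hT ihA ihB =>
    rw [lmap_pi]
    exact .pi ihA (by rwa [er_lmap hV.same]) hT
  | lam _ _ _ hT ihA ihB ihb =>
    rw [lmap_lam]
    refine .lam ihA (by rwa [er_lmap hV.same]) ?_ ?_
    · rwa [er_lmap hV.same, er_lmap hV.same]
    · rwa [er_lmap hV.same, er_lmap hV.same]
  | app _ _ _ _ hT ihA ihB ihf iha =>
    rw [lmap_app]
    refine .app ihA (by rwa [er_lmap hV.same]) ?_ ?_ ?_
    · rwa [er_lmap hV.same, er_lmap hV.same]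
    · rwa [er_lmap hV.same]
    · rwa [er_lmap hV.same, er_lmap hV.same]
  | hd h ha hT =>
    refine .hd h (fun h => absurd (ha h).1 (by simp)) ?_
    rwa [er_same hV.same (upd_upd β l k _ _) (hV.ty _ _ h)]
  | sapp h _ _ hT ihf iha =>
    rw [lmap_sapp]
    refine .sapp (spT_lmap hV l k h) ihf iha ?_
    rwa [er_lmap hV.same]

theorem Has.mono {amb' : Bool} (ha : amb' = true → amb = true) {Γ : Ctx} {e : E} {T : Tm}
    (h : Has V amb' β Γ e T) : Has V amb β Γ e T := by
  induction h with
  | var hA hT => exact .var hA hT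
  | univ hT => exact .univ hT
  | pi _ _ hT ihA ihB => exact .pi ihA ihB hT
  | lam _ _ _ hT ihA ihB ihb => exact .lam ihA ihB ihb hT
  | app _ _ _ _ hT ihA ihB ihf iha => exact .app ihA ihB ihf iha hT
  | hd h h' hT => exact .hd h (fun x => ⟨ha (h' x).1, (h' x).2⟩) hT
  | sapp h _ _ hT ihf iha => exact .sapp h ihf iha hT

theorem Has.lm (hV : Plain V) {amb' : Bool} {l k : Lv}
    (ha : amb' = true → amb = true ∧ lvid l k = true) {Γ : Ctx} {e : E} {T : Tm}
    (h : Has V amb' (upd β l k) Γ e T) : Has V amb β Γ (e.lm l k) T := by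
  unfold E.lm
  cases hl : lvid l k with
  | true =>
    rw [upd_of_lvid hl] at h
    exact h.mono fun h => (ha h).1
  | false =>
    cases amb' with
    | true => rw [(ha rfl).2] at hl; cases hl
    | false => exact h.lmap hV

theorem map_er_lm (hV : Plain V) (l k : Lv) (Γ : List E) :
    (Γ.map (E.lm l k)).map (er V β) = Γ.map (er V (upd β l k)) := by
  simp [er_lm hV.same]

theorem HasArgs.lm (hV : Plain V) {amb' : Bool} {l k : Lv}
    (ha : amb' = true → amb = true ∧ lvid l k = true) {Γ : Ctx} : ∀ {s : List E} {Δ : Ctx},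
    HasArgs V amb' (upd β l k) Γ s Δ → HasArgs V amb β Γ (s.map (E.lm l k)) Δ
  | [], [], _ => trivial
  | _ :: _, _ :: _, h => ⟨h.1.lm hV ha, by rw [map_er_lm hV]; exact h.2.lm hV ha⟩

theorem Wf.lm (hV : Plain V) {amb' : Bool} {l k : Lv}
    (ha : amb' = true → amb = true ∧ lvid l k = true) : ∀ {Γ : List E},
    Wf V amb' (upd β l k) Γ → Wf V amb β (Γ.map (E.lm l k))
  | [], _ => trivial
  | _ :: _, ⟨h, i, h'⟩ => ⟨h.lm hV ha, i, by rw [map_er_lm hV]; exact h'.lm hV ha⟩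

end HoTT.Check

namespace HoTT.Check
open Judgement Tm E

variable {V : Env} {amb : Bool} {β : ℕ → ℕ}

/-! ## Spines -/

/-- The type computed by `spT` depends only on the term, and every other type of the spine lies
above it. This takes the place of uniqueness of types. -/
theorem Has.of_spT {Γ : Ctx} {f : E} {n : ℕ} {S T : Tm} (h : Has V amb β Γ f T)
    (hS : spT V β f = some (n, S)) : Has V amb β Γ f S ∧ Le Γ S T := by
  cases h with
  | hd h ha hT =>
    rw [spT, h] at hS
    cases hS
    exact ⟨.hd h ha (.refl _), hT⟩
  | sapp h hf ha hT =>
    rw [spT, h] at hS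
    cases hS
    exact ⟨.sapp h hf ha (.refl _), hT⟩
  | _ => cases hS

/-- Inversion for a constant applied to several arguments. Each application in a spine records that
`spT` of its function is literally a dependent function type; comparison with the telescope of the
constant gives equality of domains and codomains as raw terms. -/
theorem Has.spine {Γ : Ctx} {h : ℕ} {l k : Lv} {e : Entry} (he : V.find h = some e) {s : List E} :
    ∀ {Δ : Ctx} {R T : Tm}, er V (upd β l k) e.ty = pis Δ R → s.length = Δ.length →
    Has V amb β Γ ((E.hd h l k).spine s) T →
    (e.amb = true → amb = true ∧ lvid l k = true) ∧ HasArgs V amb β Γ s Δ ∧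
      Le Γ (R.subst (ofList (s.map (er V β)))) T ∧
      ∃ n, spT V β ((E.hd h l k).spine s) = some (n, R.subst (ofList (s.map (er V β)))) := by
  induction s with
  | nil =>
    rintro (_ | _) R T hR hl ht
    · have hs : R.subst (ofList ([].map (er V β))) = R := subst_var R
      rw [hs]
      cases ht with
      | hd h ha hT =>
        rw [he] at h
        cases h
        rw [hR] at hT
        exact ⟨ha, trivial, hT, e.n, by rw [E.spine, List.foldr_nil, spT, he]; simp [hR, pis]⟩
    · cases hl
  | cons a s ih =>
    rintro (_ | ⟨A, Δ⟩) R T hR hl ht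
    · cases hl
    · cases ht with
      | sapp hf hf' ha hT =>
        obtain ⟨h1, h2, -, n, h3⟩ := ih (Δ := Δ) (R := .pi A R) hR (Nat.succ.inj hl) hf'
        have := Option.some.inj (hf.symm.trans h3)
        simp only [Prod.mk.injEq, Tm.subst, Tm.pi.injEq] at this
        obtain ⟨rfl, rfl, rfl⟩ := this
        rw [subst_liftSub_inst'] at hT
        refine ⟨h1, ⟨h2, ha⟩, hT, ?_⟩
        change ∃ n, spT V β (.sapp ((E.hd h l k).spine s) a) = _
        rw [spT, h3]
        simp only [Tm.subst, subst_liftSub_inst']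
        exact ⟨_, rfl⟩

theorem er_epis (V : Env) (β : ℕ → ℕ) : ∀ (Δ : List E) (R : E),
    er V β (epis Δ R) = pis (Δ.map (er V β)) (er V β R)
  | [], _ => rfl
  | _ :: Δ, _ => er_epis V β Δ _

theorem Wf.epis : ∀ {Δ Γ : List E} {R : E} {i : ℕ}, Wf V amb β Γ →
    Has V amb β (Γ.map (er V β)) (epis Δ R) (.univ i) →
    Wf V amb β (Δ ++ Γ) ∧ ∃ i, Has V amb β ((Δ ++ Γ).map (er V β)) R (.univ i)
  | [], _, _, _, hΓ, h => ⟨hΓ, _, h⟩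
  | A :: Δ, Γ, R, i, hΓ, h => by
    obtain ⟨hΔ, i, h⟩ := Wf.epis (Δ := Δ) hΓ h
    cases h with
    | pi hA hR hT => exact ⟨⟨hΔ, _, hA⟩, _, hR⟩

/-- The domains and the codomain of an iterated dependent function type are closed. -/
theorem plain_epis : ∀ {Δ : List E} {R : E} {n : ℕ}, plain (epis Δ R) n = true →
    plain R (n + Δ.length) = true
  | [], _, _, h => h
  | _ :: Δ, _, n, h => ((Bool.and_eq_true _ _).mp (plain_epis (Δ := Δ) h)).2

theorem plain_epis_cons {Δ : List E} {A R : E} (h : plain (epis (A :: Δ) R) 0 = true) :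
    plain A Δ.length = true := by
  exact Nat.zero_add Δ.length ▸ ((Bool.and_eq_true _ _).mp (plain_epis (Δ := Δ) h)).1

theorem Has.arg {Γ : Ctx} {f : E} : ∀ {s : List E} {T : Tm}, Has V amb β Γ (f.spine s) T →
    ∀ a ∈ s, ∃ A, Has V amb β Γ a A
  | [], _, _, a, ha => by simp at ha
  | b :: s, _, .sapp _ hf hb _, a, ha => by
    rcases List.mem_cons.mp ha with rfl | ha
    · exact ⟨_, hb⟩
    · exact hf.arg a ha

theorem Has.of_foldl {Γ : Ctx} : ∀ {r : List E} {f : E} {T : Tm},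
    Has V amb β Γ (r.foldl E.sapp f) T → ∃ S, Has V amb β Γ f S
  | [], _, _, h => ⟨_, h⟩
  | a :: r, f, _, h => by
    obtain ⟨S, h⟩ := Has.of_foldl (r := r) h
    cases h with
    | sapp _ h _ _ => exact ⟨_, h⟩

/-! ## Types of terms -/

/-- Reduction and conversion are sound. -/
structure RedOk (V : Env) (amb : Bool) (β : ℕ → ℕ) (R : Red) : Prop where
  whnf : ∀ {Γ t T}, Wf V amb β Γ → Has V amb β (Γ.map (er V β)) t T →
    Has V amb β (Γ.map (er V β)) (R.whnf Γ t) T ∧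
      Derivable (eq (Γ.map (er V β)) (er V β t) (er V β (R.whnf Γ t)) T)
  conv : ∀ {Γ t u T}, Wf V amb β Γ → Has V amb β (Γ.map (er V β)) t T →
    Has V amb β (Γ.map (er V β)) u T → R.conv Γ t u = true →
    Derivable (eq (Γ.map (er V β)) (er V β t) (er V β u) T)
  whnf_hole : ∀ Γ, R.whnf Γ .hole = .hole
  conv_hole : ∀ Γ t, R.conv Γ .hole t = false

/-- A computed type is a type of the term, or there is no result. -/
def TyOk (V : Env) (amb : Bool) (β : ℕ → ℕ) (Γ : Ctx) (t S : E) : Prop :=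
  S = .hole ∨ Has V amb β Γ t (er V β S) ∧ ∃ i, Has V amb β Γ S (.univ i)

theorem tyArgs_spec (hV : EnvOk V) (hβ : Good amb β) {Γ : Ctx} (hΓ : Derivable (ctx Γ)) :
    ∀ {r s Δ : List E} {T f : E} {X : Tm} {i : ℕ}, Has V amb β (Δ.map (er V β)) T (.univ i) →
    HasArgs V amb β Γ s (Δ.map (er V β)) → (∃ n, spT V β f = some (n, er V β (T.sub s 0))) →
    Has V amb β Γ (r.foldl E.sapp f) X → Red.tyArgs T s r = .hole ∨
      (∃ n, spT V β (r.foldl E.sapp f) = some (n, er V β (Red.tyArgs T s r))) ∧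
        ∃ i, Has V amb β Γ (Red.tyArgs T s r) (.univ i)
  | [], s, Δ, T, f, X, i, hT, hs, hf, _ => .inr ⟨hf, i, hT.subst hV hβ hΓ hs⟩
  | a :: r, s, Δ, T, f, X, i, hT, hs, ⟨n, hf⟩, hX => by
    cases T with
    | pi A B =>
      obtain ⟨S, hS⟩ := Has.of_foldl (r := r) hX
      cases hT with
      | pi hA hB _ =>
      cases hS with
      | sapp h _ ha _ =>
      have := Option.some.inj (h.symm.trans hf)
      rw [er_sub hV.closed] at this
      simp only [Prod.mk.injEq, er, Tm.subst, Tm.pi.injEq] at this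
      obtain ⟨rfl, rfl, rfl⟩ := this
      refine tyArgs_spec hV hβ hΓ (Δ := A :: Δ) (r := r) hB ⟨hs, ha⟩ ?_ hX
      rw [spT, h]
      simp only [subst_liftSub_inst', er_sub hV.closed]
      exact ⟨_, rfl⟩
    | _ => exact .inl rfl

theorem tySpine_spec (hV : EnvOk V) (hβ : Good amb β) {Γ : Ctx} (hΓ : Derivable (ctx Γ)) {t : E}
    {T : Tm} (ht : Has V amb β Γ t T) : Red.tySpine V t = .hole ∨
      (∃ n, spT V β t = some (n, er V β (Red.tySpine V t))) ∧
        ∃ i, Has V amb β Γ (Red.tySpine V t) (.univ i) := by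
  unfold Red.tySpine
  split
  · rename_i h l k hh
    split
    · rename_i e he
      have ht' : t = t.args.reverse.foldl E.sapp (.hd h l k) := by
        rw [List.foldl_reverse]
        conv_lhs => rw [← spine_head_args t, hh]
        rfl
      have ha : e.amb = true → amb = true ∧ lvid l k = true := by
        rw [ht'] at ht
        obtain ⟨S, hS⟩ := ht.of_foldl
        cases hS with
        | hd h ha _ =>
        rw [he] at h
        cases h
        exact ha
      obtain ⟨i, hi⟩ := (hV.entry _ _ he).ty (upd β l k) (hβ.upd ha)
      have := hi.lm hV.toPlain ha
      rw [ht'] at ht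
      have := tyArgs_spec hV hβ hΓ (Δ := []) (s := []) this trivial (f := .hd h l k) ⟨e.n, ?_⟩ ht
      · rwa [← ht'] at this
      · rw [spT, he, er_sub hV.closed, er_lm hV.same]
        simp only [List.map_nil, ofList, List.foldr_nil, subst_var]
    · exact .inl rfl
  · exact .inl rfl

theorem Wf.look (hV : EnvOk V) (hβ : Good amb β) : ∀ {Γ : List E} {n : ℕ} {A : Tm},
    Wf V amb β Γ → (Γ.map (er V β))[n]? = some A →
    A = er V β (E.look Γ n) ∧
      ∃ i, Has V amb β (Γ.map (er V β)) ((E.look Γ n).sh (n + 1) 0) (.univ i)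
  | [], _, _, _, h => by simp at h
  | B :: Γ, n, A, hΓ, h => by
    have hc := hΓ.ctx hV hβ
    cases n with
    | zero =>
      obtain ⟨i, hB⟩ := hΓ.2
      exact ⟨(Option.some.inj h).symm, i, hB.weaken hV hβ hc⟩
    | succ n =>
      obtain ⟨h1, i, h2⟩ := Wf.look hV hβ hΓ.1 (n := n) (A := A) (by simpa using h)
      refine ⟨h1, i, ?_⟩
      have := h2.weaken hV hβ hc
      rw [sh_zero, sh_zero, ren_ren] at this
      rw [sh_zero]
      exact this

theorem lvMax_spec (hβ : Good amb β) {A B : E} (h : Red.lvMax amb A B ≠ .hole) :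
    ∃ l k, A = .univ l ∧ B = .univ k ∧ Red.lvMax amb A B = .univ (l.sup amb k) := by
  cases A <;> cases B <;> first | exact absurd rfl h | exact ⟨_, _, rfl, rfl, rfl⟩

theorem RedOk.univ {R : Red} (hR : RedOk V amb β R) {Γ : List E} (hΓ : Wf V amb β Γ) {t T : E}
    (h : TyOk V amb β (Γ.map (er V β)) t T) {l : Lv} (hl : R.whnf Γ T = .univ l) :
    Has V amb β (Γ.map (er V β)) t (.univ (l.ev β)) := by
  rcases h with rfl | ⟨h, i, hi⟩
  · rw [hR.whnf_hole] at hl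
    cases hl
  · have := (hR.whnf hΓ hi).2
    rw [hl] at this
    exact h.le (.conv this)

theorem ty_spec (hV : EnvOk V) (hβ : Good amb β) {R : Red} (hR : RedOk V amb β R) {t : E} :
    ∀ {Γ : List E} {T : Tm}, Wf V amb β Γ → Has V amb β (Γ.map (er V β)) t T →
      TyOk V amb β (Γ.map (er V β)) t (Red.ty V amb R Γ t) := by
  have spine {Γ : List E} {t : E} {T : Tm} (hΓ : Wf V amb β Γ)
      (h : Has V amb β (Γ.map (er V β)) t T) :
      TyOk V amb β (Γ.map (er V β)) t (Red.tySpine V t) := by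
    rcases tySpine_spec hV hβ (hΓ.ctx hV hβ) h with h' | ⟨⟨n, hn⟩, h'⟩
    · exact .inl h'
    · exact .inr ⟨(h.of_spT hn).1, h'⟩
  induction t with
  | var n =>
    intro Γ T hΓ h
    cases h with
    | var hA hT =>
    obtain ⟨rfl, h⟩ := hΓ.look hV hβ hA
    refine .inr ⟨.var hA ?_, h⟩
    change Le _ _ (er V β ((E.look Γ n).sh (n + 1) 0))
    rw [er_sh hV.closed]
    exact .refl _
  | univ l =>
    intro Γ T hΓ h
    have : l.succ.ev β = l.ev β + 1 := rfl
    refine .inr ⟨.univ ?_, _, .univ (.refl _)⟩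
    exact this ▸ .refl _
  | pi A B ihA ihB =>
    intro Γ T hΓ h
    cases h with
    | @pi _ _ _ i _ hA hB hT =>
    have hΓ' : Wf V amb β (A :: Γ) := ⟨hΓ, i, hA⟩
    change TyOk V amb β _ _ (Red.lvMax amb (R.whnf Γ (Red.ty V amb R Γ A))
      (R.whnf (A :: Γ) (Red.ty V amb R (A :: Γ) B)))
    by_cases hm : Red.lvMax amb (R.whnf Γ (Red.ty V amb R Γ A))
      (R.whnf (A :: Γ) (Red.ty V amb R (A :: Γ) B)) = .hole
    · exact .inl hm
    · obtain ⟨l, k, hl, hk, hm⟩ := lvMax_spec hβ hm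
      rw [hm]
      obtain ⟨h1, h2⟩ := hβ.le_sup l k
      exact .inr ⟨.pi ((hR.univ hΓ (ihA hΓ hA) hl).up h1) ((hR.univ hΓ' (ihB hΓ' hB) hk).up h2)
        (.refl _), _, .univ (.refl _)⟩
  | lam A B b =>
    intro Γ T hΓ h
    cases h with
    | lam hA hB hb hT => exact .inr ⟨.lam hA hB hb (.refl _), _, .pi hA hB (.refl _)⟩
  | app A B f a =>
    intro Γ T hΓ h
    cases h with
    | app hA hB hf ha hT =>
    have := hB.inst hV hβ ha (hΓ.ctx hV hβ)
    refine .inr ⟨.app hA hB hf ha ?_, _, this⟩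
    change Le _ _ (er V β (B.inst a))
    rw [er_inst hV.closed]
    exact .refl _
  | hd h l k => exact fun hΓ h => spine hΓ h
  | sapp f a => exact fun hΓ h => spine hΓ h
  | hole => exact fun _ _ => .inl rfl

/-! ## Subsumption -/

theorem univLe_spec (hβ : Good amb β) {Γ : Ctx} {T T' : E} (h : Red.univLe amb T T' = true) :
    Le Γ (er V β T) (er V β T') := by
  unfold Red.univLe at h
  split at h
  · exact .univ (hβ.le h)
  · cases h

theorem subs_spec (hβ : Good amb β) {R : Red} (hR : RedOk V amb β R) {Γ : List E}
    (hΓ : Wf V amb β Γ) {T T' : E} {i j : ℕ} (hT : Has V amb β (Γ.map (er V β)) T (.univ i))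
    (hT' : Has V amb β (Γ.map (er V β)) T' (.univ j)) (h : R.subs amb Γ T T' = true) :
    Le (Γ.map (er V β)) (er V β T) (er V β T') := by
  simp only [Red.subs, Bool.or_eq_true] at h
  rcases h with (h | h) | h
  · exact univLe_spec hβ h
  · exact .conv (hR.conv hΓ (hT.up (le_max_left i j)) (hT'.up (le_max_right i j)) h)
  · exact (Le.conv (hR.whnf hΓ hT).2).trans
      ((univLe_spec hβ h).trans (.conv (hR.whnf hΓ hT').2.symm))

/-- A hole stands for a failed computation of a type and has no typing. It must therefore convert to
nothing, not even to another hole, so that a failure is never read as success. -/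
theorem subs_hole {R : Red} (hR : RedOk V amb β R) (Γ : List E) (T : E) :
    R.subs amb Γ .hole T = false := by
  simp only [Red.subs, hR.whnf_hole, hR.conv_hole]
  rfl

theorem TyOk.subs (hβ : Good amb β) {R : Red} (hR : RedOk V amb β R) {Γ : List E}
    (hΓ : Wf V amb β Γ) {t S T : E} {i : ℕ} (hS : TyOk V amb β (Γ.map (er V β)) t S)
    (hT : Has V amb β (Γ.map (er V β)) T (.univ i)) (h : R.subs amb Γ S T = true) :
    Has V amb β (Γ.map (er V β)) t (er V β T) := by
  rcases hS with rfl | ⟨hS, j, hj⟩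
  · rw [subs_hole hR] at h
    cases h
  · exact hS.le (subs_spec hβ hR hΓ hj hT h)

theorem isTys_spec (hV : EnvOk V) (hβ : Good amb β) {R : Red} (hR : RedOk V amb β R) {Γ : List E}
    (hΓ : Wf V amb β Γ) {s Δ : List E} (hs : HasArgs V amb β (Γ.map (er V β)) s (Δ.map (er V β))) :
    ∀ {r Ts : List E}, (∀ a ∈ r, ∃ A, Has V amb β (Γ.map (er V β)) a A) → Wf V amb β (Ts ++ Δ) →
    R.isTys V amb Γ r Ts s = true →
    HasArgs V amb β (Γ.map (er V β)) (r ++ s) ((Ts ++ Δ).map (er V β))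
  | [], [], _, _, _ => hs
  | a :: r, T :: Ts, ha, hT, h => by
    have h := (Bool.and_eq_true _ _).mp h
    have hr := isTys_spec hV hβ hR hΓ hs (fun b hb => ha b (List.mem_cons_of_mem _ hb)) hT.1 h.1
    obtain ⟨A, hA⟩ := ha a List.mem_cons_self
    obtain ⟨i, hi⟩ := hT.2
    have := (ty_spec hV hβ hR hΓ hA).subs hβ hR hΓ (hi.subst hV hβ (hΓ.ctx hV hβ) hr) h.2
    rw [er_sub hV.closed] at this
    exact ⟨hr, this⟩

end HoTT.Check

namespace HoTT

/-- `Scoped` is invariance under substitutions that fix the first `n` variables. One that sends all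
other variables to a closed dummy shows that only the first `n` values matter. -/
theorem Tm.Scoped.subst_congr {n : ℕ} {a : Tm} (h : Tm.Scoped n a) {s t : ℕ → Tm}
    (hst : ∀ m < n, s m = t m) : a.subst s = a.subst t := by
  have key (s : ℕ → Tm) : a.subst s = a.subst fun m => if m < n then s m else .univ 0 := by
    conv_lhs => rw [← h (fun m => if m < n then .var m else .univ 0) fun m hm => if_pos hm]
    rw [Tm.subst_subst]
    congr 1
    funext m
    split <;> rfl
  rw [key s, key t]
  congr 1
  funext m
  split
  · exact hst m ‹_›
  · rfl

theorem Tm.ofList_subst {σ : ℕ → Tm} : ∀ {s : List Tm} {m : ℕ}, m < s.length →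
    (Tm.ofList s m).subst σ = Tm.ofList (s.map (Tm.subst σ)) m
  | a :: s, 0, _ => rfl
  | a :: s, m + 1, h => Tm.ofList_subst (s := s) (Nat.lt_of_succ_lt_succ h)

theorem Tm.Scoped.subst_ofList {a : Tm} {s : List Tm} (h : Tm.Scoped s.length a) (σ : ℕ → Tm) :
    (a.subst (Tm.ofList s)).subst σ = a.subst (Tm.ofList (s.map (Tm.subst σ))) := by
  rw [Tm.subst_subst]
  exact h.subst_congr fun m hm => Tm.ofList_subst hm

namespace Check
open Judgement Tm E

variable {V : Env} {amb : Bool} {β : ℕ → ℕ}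

/-! ## Arguments -/

theorem HasArgs.length {Γ : Ctx} : ∀ {s : List E} {Δ : Ctx}, HasArgs V amb β Γ s Δ →
    s.length = Δ.length
  | [], [], _ => rfl
  | _ :: _, _ :: _, h => congrArg (· + 1) h.1.length

theorem HasArgs.args (hV : EnvOk V) (hβ : Good amb β) {Γ : Ctx} (hΓ : Derivable (ctx Γ)) :
    ∀ {s : List E} {Δ : Ctx}, HasArgs V amb β Γ s Δ → Args Γ (s.map (er V β)) Δ
  | [], [], _ => trivial
  | _ :: _, _ :: _, h => ⟨h.1.args hV hβ hΓ, h.2.of hV hβ hΓ⟩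

theorem HasArgs.drop {Γ : Ctx} : ∀ (n : ℕ) {s : List E} {Δ : Ctx}, HasArgs V amb β Γ s Δ →
    HasArgs V amb β Γ (s.drop n) (Δ.drop n)
  | 0, _, _, h => h
  | n + 1, [], [], _ => trivial
  | n + 1, _ :: _, _ :: _, h => h.1.drop n

/-- Every type of a context is closed relative to the previous ones. -/
def ScopedCtx : Ctx → Prop
  | [] => True
  | A :: Δ => ScopedCtx Δ ∧ Scoped Δ.length A

theorem scopedCtx_of_plain (hV : DenClosed V) (β : ℕ → ℕ) : ∀ {Δ : List E} {R : E},
    plain (epis Δ R) 0 = true → ScopedCtx (Δ.map (er V β))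
  | [], _, _ => trivial
  | A :: Δ, R, h => by
    refine ⟨scopedCtx_of_plain hV β (R := .pi A R) h, ?_⟩
    rw [List.length_map]
    exact scoped_of_plain hV β (plain_epis_cons h)

theorem HasArgs.subst (hV : EnvOk V) (hβ : Good amb β) {Γ Ψ : Ctx} {r : List E}
    (hΓ : Derivable (ctx Γ)) (hr : HasArgs V amb β Γ r Ψ) : ∀ {s : List E} {Δ : Ctx},
    ScopedCtx Δ → HasArgs V amb β Ψ s Δ → HasArgs V amb β Γ (s.map fun a => a.sub r 0) Δ
  | [], [], _, _ => trivial
  | a :: s, A :: Δ, hA, h => by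
    refine ⟨HasArgs.subst hV hβ hΓ hr hA.1 h.1, ?_⟩
    have := Has.subst hV hβ h.2 hΓ hr
    have hl : (s.map (er V β)).length = List.length Δ := by rw [List.length_map, h.1.length]
    rw [Scoped.subst_ofList (hl ▸ hA.2)] at this
    convert this using 3
    simp [er_sub hV.closed]

/-- The lists have the last argument first, and `ps` is a common tail of initial arguments. The type
of each further argument depends on the previous ones, and is moved along their equality by
`ArgsEq.type` before the conversion test is applied. -/
theorem convList_spec (hV : EnvOk V) (hβ : Good amb β) {R : Red} (hR : RedOk V amb β R)
    {Γ : List E} (hΓ : Wf V amb β Γ) {ps : List E} : ∀ {x y : List E} {Δ : Ctx},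
    Derivable (ctx Δ) → HasArgs V amb β (Γ.map (er V β)) (x ++ ps) Δ →
    HasArgs V amb β (Γ.map (er V β)) (y ++ ps) Δ → R.convList Γ x y = true →
    ArgsEq (Γ.map (er V β)) ((x ++ ps).map (er V β)) ((y ++ ps).map (er V β)) Δ
  | [], [], _, _, hx, _, _ => (hx.args hV hβ (hΓ.ctx hV hβ)).refl
  | a :: x, b :: y, A :: Δ, hΔ, hx, hy, h => by
    have hG := hΓ.ctx hV hβ
    have h := (Bool.and_eq_true _ _).mp h
    obtain ⟨i, hA⟩ := hΔ.type_of_ctx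
    have hs := convList_spec hV hβ hR hΓ hA.ctx_of hx.1 hy.1 h.2
    have := hs.type hG (hx.1.args hV hβ hG) (hy.1.args hV hβ hG) hA
    exact ⟨hs, hR.conv hΓ hx.2 (hy.2.le (.conv this.symm)) h.1⟩
  | [], b :: y, _, _, _, _, h => by cases h
  | a :: x, [], _, _, _, _, h => by cases h

theorem spT_length {h : ℕ} {l k : Lv} {e : Entry} (he : V.find h = some e) : ∀ {s : List E} {n : ℕ}
    {S : Tm}, spT V β ((E.hd h l k).spine s) = some (n, S) → n + s.length = e.n
  | [], n, S, h => by
    change spT V β (.hd _ l k) = _ at h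
    rw [spT, he] at h
    cases h
    rfl
  | a :: s, n, S, h => by
    change spT V β (.sapp ((E.hd _ l k).spine s) a) = _ at h
    rw [spT] at h
    split at h <;> cases h
    have := spT_length he (s := s) ‹_›
    rw [List.length_cons]
    omega

/-- The telescope of the type of a constant, in the context of `s`. -/
theorem EntryOk.tele (hV : EnvOk V) {h : ℕ} {e : Entry} (he : V.find h = some e)
    (l k : Lv) (ha : Good e.amb (upd β l k)) {m : ℕ} (hm : m ≤ e.n) : ∃ Δ R,
    er V (upd β l k) e.ty = pis Δ R ∧ m = Δ.length ∧ ∃ i, Derivable (of Δ R (.univ i)) := by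
  obtain ⟨Δ, R, hR, hn, -⟩ := (hV.entry _ _ he).args
  obtain ⟨i, hi⟩ := (hV.entry _ _ he).ty _ ha
  have : epis Δ R = epis (Δ.drop (e.n - m)) (epis (Δ.take (e.n - m)) R) := by
    conv_lhs => rw [← List.take_append_drop (e.n - m) Δ]
    exact List.foldl_append
  rw [hR, this] at hi
  obtain ⟨hw, j, hj⟩ := Wf.epis (Γ := []) trivial hi
  rw [List.append_nil] at hw hj
  exact ⟨_, _, by rw [hR, this, er_epis], by simp; omega, j, hj.of hV ha (hw.ctx hV ha)⟩

/-! ## Reduction -/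

/-- `t` reduces to `t'`. -/
def Step (V : Env) (amb : Bool) (β : ℕ → ℕ) (Γ : Ctx) (t t' : E) (T : Tm) : Prop :=
  Has V amb β Γ t' T ∧ Derivable (eq Γ (er V β t) (er V β t') T)

theorem Step.refl (hV : EnvOk V) (hβ : Good amb β) {Γ : Ctx} (hΓ : Derivable (ctx Γ)) {t : E}
    {T : Tm} (h : Has V amb β Γ t T) : Step V amb β Γ t t T := ⟨h, .refl (h.of hV hβ hΓ)⟩

theorem Step.trans {Γ : Ctx} {t t' t'' : E} {T : Tm} (h : Step V amb β Γ t t' T)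
    (h' : Step V amb β Γ t' t'' T) : Step V amb β Γ t t'' T := ⟨h'.1, h.2.trans h'.2⟩

theorem findRule_mem {c : ℕ} {r : IRule} : ∀ {rs : List IRule}, Red.findRule rs c = some r → r ∈ rs
  | [], h => by cases h
  | q :: rs, h => by
    rw [Red.findRule] at h
    cases hq : Nat.beq q.con c with
    | true =>
      rw [hq] at h
      cases h
      exact List.mem_cons_self
    | false =>
      rw [hq] at h
      exact List.mem_cons_of_mem _ (findRule_mem h)

theorem look_append : ∀ (r s : List E) (m : ℕ), look (r ++ s) (r.length + m) = look s m
  | [], s, m => by rw [List.length_nil, Nat.zero_add]; rfl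
  | a :: r, s, m => by
    rw [List.length_cons, Nat.add_right_comm]
    exact look_append r s m

theorem look_eq : ∀ (s : List E) (m : ℕ) (h : m < s.length), look s m = s[m]
  | a :: s, 0, _ => rfl
  | a :: s, m + 1, h => look_eq s m (Nat.lt_of_succ_lt_succ h)

theorem lm_var (l k : Lv) (n : ℕ) : (E.var n).lm l k = .var n := by
  unfold E.lm
  cases lvid l k <;> rfl

theorem vars_sub (l k : Lv) (r s : List E) :
    (vars r.length s.length).map (fun e => (e.lm l k).sub (r ++ s) 0) = s := by
  apply List.ext_getElem
  · simp [vars]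
  · intro m h _
    simp only [vars, List.getElem_map, List.getElem_range, lm_var]
    change look (r ++ s) (r.length + m) = _
    rw [look_append, look_eq]

theorem _root_.HoTT.Args.apps {Γ : Ctx} {f : Tm} : ∀ {s : List Tm} {Δ : Ctx} {B : Tm}, Args Γ s Δ →
    Derivable (Judgement.of Γ f (pis Δ B)) →
    Derivable (Judgement.of Γ (Tm.apps f s) (B.subst (ofList s)))
  | [], [], B, _, h => by
    simpa [ofList, subst_var, Tm.apps, pis] using h
  | a :: s, A :: Δ, B, h, hf => by
    have := h.1.apps (B := .pi A B) hf
    rw [← subst_liftSub_inst']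
    exact this.app h.2

theorem apps_subst (f : Tm) (s : List Tm) (σ : ℕ → Tm) :
    (apps f s).subst σ = apps (f.subst σ) (s.map (Tm.subst σ)) := by
  induction s with
  | nil => rfl
  | cons a s ih => exact congrArg (Tm.app · _) ih

/-- The arguments of the constructor and the parameters, motive and methods of the eliminator form
an instance of the context of the rule. The remaining arguments of the eliminator are only
convertible to those that the rule prescribes. So the term is first moved to the prescribed
arguments, together with its type, and the closed equation of the rule is then instantiated. -/
theorem iota_rule (hV : EnvOk V) (hβ : Good amb β) {R : Red} (hR : RedOk V amb β R) {Γ : List E}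
    (hΓ : Wf V amb β Γ) {h : ℕ} {l k : Lv} {e : Entry} (he : V.find h = some e) {r : IRule}
    (hr : r ∈ e.rules) {s cs : List E} (hs : s.length = e.n) {T : Tm}
    (ht : Has V amb β (Γ.map (er V β)) ((E.hd h l k).spine s) T)
    (hcs : ∀ a ∈ cs, ∃ A, Has V amb β (Γ.map (er V β)) a A)
    (hc : R.isTys V amb Γ cs (r.tys.map (E.lm l k)) (s.drop (s.length - r.np)) = true)
    (hc' : R.convList Γ (s.take (s.length - r.np))
      (r.rest.map fun e => (e.lm l k).sub (cs ++ s.drop (s.length - r.np)) 0) = true) :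
    Step V amb β (Γ.map (er V β)) ((E.hd h l k).spine s)
      (R.whnf Γ ((r.rhs.lm l k).sub (cs ++ s.drop (s.length - r.np)) 0)) T := by
  have hG := hΓ.ctx hV hβ
  obtain ⟨Δ, S, hS, hn, -, hrules⟩ := (hV.entry _ _ he).args
  have hS' : er V (upd β l k) e.ty = pis (Δ.map (er V (upd β l k))) (er V (upd β l k) S) := by
    rw [hS, er_epis]
  obtain ⟨ha, hargs, hT, -⟩ := ht.spine he hS' (by rw [hs, ← hn, List.length_map])
  have hβ' := hβ.upd ha
  obtain ⟨i, hi⟩ := (hV.entry _ _ he).ty _ hβ'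
  have hpl := hV.ty _ _ he
  rw [hS] at hi hpl
  obtain ⟨hw, j, hj⟩ := Wf.epis (Γ := []) trivial hi
  rw [List.append_nil] at hw hj
  have hΔ := hw.ctx hV hβ'
  replace hj := hj.of hV hβ' hΔ
  have hsc := scopedCtx_of_plain hV.closed (upd β l k) hpl
  have hsR := scoped_of_plain hV.closed (upd β l k) (plain_epis hpl)
  rw [Nat.zero_add] at hsR
  obtain ⟨hrl, hrw, hra, hrr, hre⟩ := hrules r hr _ hβ'
  have hm : s.length - r.np = r.rest.length := by omega
  have hsx : s = s.take r.rest.length ++ s.drop r.rest.length := (List.take_append_drop ..).symm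
  rw [hm] at hc hc' ⊢
  have hps := hargs.drop r.rest.length
  rw [← List.map_drop] at hps
  have hpl : r.np = (s.drop r.rest.length).length := by rw [List.length_drop]; omega
  generalize s.drop r.rest.length = ps at *
  generalize s.take r.rest.length = x at *
  subst hsx
  set Ψ := r.tys ++ Δ.drop r.rest.length with hΨ
  set as := r.rest ++ vars r.tys.length r.np with has
  -- The constructor is not assumed to have been built with the parameters of the eliminator;
  -- `isTys` has retyped its arguments against the context of the rule.
  have hσ : HasArgs V amb β (Γ.map (er V β)) (cs ++ ps) (Ψ.map (er V (upd β l k))) := by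
    have := isTys_spec hV hβ hR hΓ (s := ps) (Δ := (Δ.drop r.rest.length).map (E.lm l k))
      (by rwa [map_er_lm hV.toPlain]) hcs (by rw [← List.map_append]; exact hrw.lm hV.toPlain ha) hc
    rwa [← List.map_append, map_er_lm hV.toPlain] at this
  have hcl : r.tys.length = cs.length := by
    have h1 := hσ.length
    have h2 := hps.length
    simp only [hΨ, List.length_map, List.length_append] at h1 h2
    omega
  have hy := HasArgs.subst hV hβ hG hσ hsc (hra.lm hV.toPlain ha)
  have hyl : (as.map (E.lm l k)).map (fun a => a.sub (cs ++ ps) 0) =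
      (r.rest.map fun e => (e.lm l k).sub (cs ++ ps) 0) ++ ps := by
    rw [has, List.map_map, List.map_append, hcl, hpl]
    exact congrArg (_ ++ ·) (vars_sub l k cs ps)
  have hye : ((as.map (E.lm l k)).map (fun a => a.sub (cs ++ ps) 0)).map (er V β) =
      (as.map (er V (upd β l k))).map (Tm.subst (ofList ((cs ++ ps).map (er V β)))) := by
    simp [er_sub hV.closed, er_lm hV.same]
  rw [hyl] at hy hye
  have heq := convList_spec hV hβ hR hΓ hΔ hargs hy hc'
  have hrr' := (hrr.lm hV.toPlain ha).subst hV hβ hG hσ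
  have hal : (as.map (er V (upd β l k))).length = Δ.length := by
    rw [← List.length_map (f := er V (upd β l k)) (as := Δ), ← hra.length, List.length_map]
  have hden := (hV.entry _ _ he).den _ hβ'
  have hre' := (hσ.args hV hβ hG).eq_of_lams hG
    ((hra.args hV hβ' (hrw.ctx hV hβ')).apps (hS' ▸ hden.closed (hrw.ctx hV hβ')))
    (hrr.of hV hβ' (hrw.ctx hV hβ')) hre
  have hdc : Scoped 0 (e.den (upd β l k)) := hV.closed _ _ he _
  rw [apps_subst, hdc.subst, Scoped.subst_ofList (hal ▸ hsR), ← hye] at hre'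
  rw [Scoped.subst_ofList (hal ▸ hsR), ← hye] at hrr'
  -- The rule gives an equation at the type for the prescribed arguments; this equality returns it
  -- to the original type.
  have htype := heq.type hG (hargs.args hV hβ hG) (hy.args hV hβ hG) hj
  have hle := (Le.conv htype.symm).trans hT
  have h1 := heq.apps (hS' ▸ (hden.closed hG).refl)
  refine Step.trans ⟨hrr'.le hle, ?_⟩ (hR.whnf hΓ (hrr'.le hle))
  rw [er_spine, er, he, er_sub hV.closed, er_lm hV.same]
  exact (hT.eq h1).trans (hle.eq hre')

theorem HasArgs.spine {Γ : Ctx} {h : ℕ} {l k : Lv} {e : Entry} (he : V.find h = some e)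
    (ha : e.amb = true → amb = true ∧ lvid l k = true) : ∀ {s : List E} {Δ : Ctx} {R : Tm},
    er V (upd β l k) e.ty = pis Δ R → s.length ≤ e.n → HasArgs V amb β Γ s Δ →
    Has V amb β Γ ((E.hd h l k).spine s) (R.subst (ofList (s.map (er V β)))) ∧
      spT V β ((E.hd h l k).spine s) =
        some (e.n - s.length, R.subst (ofList (s.map (er V β))))
  | [], [], R, hR, _, _ => by
    have hs : R.subst (ofList ([].map (er V β))) = R := subst_var R
    rw [hs]
    refine ⟨.hd he ha (hR ▸ .refl _), ?_⟩
    change spT V β (.hd h l k) = _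
    rw [spT, he]
    exact congrArg (fun T => some (e.n, T)) hR
  | a :: s, A :: Δ, R, hR, hl, hs => by
    rw [List.length_cons] at hl
    obtain ⟨h1, h2⟩ := hs.1.spine he ha (R := .pi A R) hR (by omega)
    have hn : e.n - s.length = (e.n - (s.length + 1)) + 1 := by omega
    rw [hn] at h2
    rw [List.map_cons, ← subst_liftSub_inst']
    refine ⟨.sapp h2 h1 hs.2 (.refl _), ?_⟩
    change spT V β (.sapp ((E.hd h l k).spine s) a) = _
    rw [spT, h2]
    rfl

/-- Reduction of the last argument. -/
theorem Step.major (hV : EnvOk V) (hβ : Good amb β) {Γ : List E} (hΓ : Wf V amb β Γ) {h : ℕ}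
    {l k : Lv} {e : Entry} (he : V.find h = some e) {p p' : E} {s : List E}
    (hs : (p :: s).length ≤ e.n) {T : Tm}
    (ht : Has V amb β (Γ.map (er V β)) ((E.hd h l k).spine (p :: s)) T)
    (hp : ∀ B, Has V amb β (Γ.map (er V β)) p B → Step V amb β (Γ.map (er V β)) p p' B) :
    Step V amb β (Γ.map (er V β)) ((E.hd h l k).spine (p :: s)) ((E.hd h l k).spine (p' :: s)) T ∧
      ∃ B, Has V amb β (Γ.map (er V β)) p' B := by
  have hG := hΓ.ctx hV hβ
  obtain ⟨S, hS⟩ : ∃ S, Has V amb β (Γ.map (er V β)) (.hd h l k) S := by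
    apply Has.of_foldl (r := (p :: s).reverse) (T := T)
    rwa [List.foldl_reverse]
  have ha : e.amb = true → amb = true ∧ lvid l k = true := by
    cases hS with
    | hd h ha _ =>
    rw [he] at h
    cases h
    exact ha
  have hβ' := hβ.upd ha
  obtain ⟨Δ, R, hR, hl, i, hi⟩ := EntryOk.tele hV he l k hβ' hs
  obtain ⟨-, hargs, hT, -⟩ := ht.spine he hR hl
  cases Δ with
  | nil => cases hl
  | cons A Δ =>
    obtain ⟨h1, h2⟩ := hp _ hargs.2
    have hargs' : HasArgs V amb β (Γ.map (er V β)) (p' :: s) (A :: Δ) := ⟨hargs.1, h1⟩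
    have heq : ArgsEq (Γ.map (er V β)) ((p :: s).map (er V β)) ((p' :: s).map (er V β)) (A :: Δ) :=
      ⟨(hargs.1.args hV hβ hG).refl, h2⟩
    have htype := heq.type hG (hargs.args hV hβ hG) (hargs'.args hV hβ hG) hi
    have hden := ((hV.entry _ _ he).den _ hβ').closed hG
    refine ⟨⟨(hargs'.spine he ha hR (s := p' :: s) hs).1.le ((Le.conv htype.symm).trans hT), ?_⟩, _, h1⟩
    rw [er_spine, er_spine, er, he]
    exact hT.eq (heq.apps (hR ▸ hden.refl))

theorem iota_spec (hV : EnvOk V) (hβ : Good amb β) {R : Red} (hR : RedOk V amb β R) {Γ : List E}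
    (hΓ : Wf V amb β Γ) {h : ℕ} {l k : Lv} {e : Entry} (he : V.find h = some e) {s : List E}
    (hs : s.length = e.n) {T : Tm}
    (ht : Has V amb β (Γ.map (er V β)) ((E.hd h l k).spine s) T) :
    Step V amb β (Γ.map (er V β)) ((E.hd h l k).spine s)
      (Red.iota V amb R Γ ((E.hd h l k).spine s) l k e.rules s) T := by
  have hG := hΓ.ctx hV hβ
  have triv := Step.refl hV hβ hG ht
  cases s with
  | nil => exact triv
  | cons p as =>
    simp only [Red.iota]
    split
    · split
      · exact triv
      · rename_i r hr
        obtain ⟨hst, B, hB⟩ := Step.major hV hβ hΓ he hs.le ht fun B hB => hR.whnf hΓ hB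
        cases hc : R.isTys V amb Γ _ _ _ && R.convList Γ _ _ with
        | false => exact triv
        | true =>
          have hc := (Bool.and_eq_true _ _).mp hc
          refine hst.trans (iota_rule hV hβ hR hΓ he (findRule_mem hr)
            (s := R.whnf Γ p :: as) hs hst.1 ?_ hc.1 hc.2)
          intro a ha
          rw [← spine_head_args (R.whnf Γ p)] at hB
          exact hB.arg a (List.mem_of_mem_take ha)
    · exact triv

end Check
end HoTT

/-! ### Soundness of weak head reduction and conversion. -/

namespace HoTT.Check
open Judgement Tm E

variable {V : Env} {amb : Bool} {β : ℕ → ℕ}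

theorem body_spec (hV : EnvOk V) (hβ : Good amb β) {Γ : List E} (hΓ : Wf V amb β Γ) {h : ℕ}
    {l k : Lv} {e : Entry} (he : V.find h = some e) {b : E} (hb : e.body = some b) {s : List E}
    (hs : s.length = e.n) {T : Tm}
    (ht : Has V amb β (Γ.map (er V β)) ((E.hd h l k).spine s) T) :
    Step V amb β (Γ.map (er V β)) ((E.hd h l k).spine s) ((b.lm l k).sub s 0) T := by
  have hG := hΓ.ctx hV hβ
  obtain ⟨Δ, S, hS, hn, hbody, -⟩ := (hV.entry _ _ he).args
  have hS' : er V (upd β l k) e.ty = pis (Δ.map (er V (upd β l k))) (er V (upd β l k) S) := by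
    rw [hS, er_epis]
  obtain ⟨ha, hargs, hT, -⟩ := ht.spine he hS' (by rw [hs, ← hn, List.length_map])
  have hβ' := hβ.upd ha
  obtain ⟨i, hi⟩ := (hV.entry _ _ he).ty _ hβ'
  rw [hS] at hi
  obtain ⟨hw, -⟩ := Wf.epis (Γ := []) trivial hi
  rw [List.append_nil] at hw
  obtain ⟨hb, hden⟩ := hbody b hb _ hβ'
  have := (hargs.args hV hβ hG).betas hG (hb.of hV hβ' (hw.ctx hV hβ'))
  refine ⟨((hb.lm hV.toPlain ha).subst hV hβ hG hargs).le hT, ?_⟩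
  rw [er_spine, er, he, er_sub hV.closed, er_lm hV.same]
  simp only [hden]
  exact hT.eq this

theorem whnfSpine_spec (hV : EnvOk V) (hβ : Good amb β) {R : Red} (hR : RedOk V amb β R)
    {Γ : List E} (hΓ : Wf V amb β Γ) {t : E} {T : Tm} (ht : Has V amb β (Γ.map (er V β)) t T) :
    Step V amb β (Γ.map (er V β)) t (Red.whnfSpine V amb R Γ t) T := by
  have hG := hΓ.ctx hV hβ
  have triv := Step.refl hV hβ hG ht
  simp only [Red.whnfSpine]
  split
  · rename_i h l k hh
    have ht' : t = (E.hd h l k).spine t.args := by rw [← hh, spine_head_args]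
    split
    · rename_i e he
      cases hl : Nat.beq t.args.length e.n with
      | false => exact triv
      | true =>
        have hl := Nat.eq_of_beq_eq_true hl
        rw [ht'] at ht
        simp only [cond_true]
        split
        · have := body_spec hV hβ hΓ he ‹_› hl ht
          rw [← ht'] at this
          exact this.trans (hR.whnf hΓ this.1)
        · split
          · exact triv
          · rename_i r rs hr
            have := iota_spec hV hβ hR hΓ he hl ht
            rwa [← ht', hr] at this
    · exact triv
  · exact triv

theorem whnfApp_spec (hV : EnvOk V) (hβ : Good amb β) {R : Red} (hR : RedOk V amb β R)
    {Γ : List E} (hΓ : Wf V amb β Γ) {A B f a : E} {T : Tm}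
    (ht : Has V amb β (Γ.map (er V β)) (.app A B f a) T) :
    Step V amb β (Γ.map (er V β)) (.app A B f a) (Red.whnfApp V R Γ A B f a) T := by
  have hG := hΓ.ctx hV hβ
  have triv := Step.refl hV hβ hG ht
  simp only [Red.whnfApp]
  split
  · rename_i h l k hh
    split
    · rename_i e A' B' he hty
      cases hc : (Nat.blt f.args.length e.n && R.conv Γ A' A && R.conv (A' :: Γ) B' B) with
      | false => exact triv
      | true =>
        simp only [Bool.and_eq_true, Nat.blt_eq] at hc
        obtain ⟨⟨hl, hcA⟩, hcB⟩ := hc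
        have hof := ht.of hV hβ hG
        cases ht with
        | @app _ _ _ _ _ j _ hA hB hf ha hT =>
        rcases tySpine_spec hV hβ hG hf with h' | ⟨⟨n, hn⟩, i, hi⟩
        · rw [hty] at h'
          cases h'
        rw [hty] at hn hi
        have hf' := (hf.of_spT hn).1
        rw [← spine_head_args f, hh] at hn
        have := spT_length he hn
        obtain ⟨m, rfl⟩ : ∃ m, n = m + 1 := ⟨n - 1, by omega⟩
        rw [← hh, spine_head_args f] at hn
        cases hi with
        | @pi _ _ _ i' _ hA' hB' _ =>
        have eA := hR.conv hΓ (hA'.up (le_max_left i' j)) (hA.up (le_max_right i' j)) hcA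
        have hΓ' : Wf V amb β (A' :: Γ) := ⟨hΓ, i', hA'⟩
        have hG' := hΓ'.ctx hV hβ
        have hB := hB.conv_ctx hV hβ eA hG'
        have eB := hR.conv hΓ' (hB'.up (le_max_left i' j)) (hB.up (le_max_right i' j)) hcB
        have ha' := ha.le (.conv eA.symm)
        have := eB.subst_eq ((subOk_var hG).cons (a := er V β a)
          (by rw [subst_var]; exact ha'.of hV hβ hG))
        rw [← single_eq] at this
        have hs : Has V amb β (Γ.map (er V β)) (.sapp f a) T :=
          .sapp hn hf' ha' ((Le.conv this).trans hT)
        -- The two annotated terms erase to the same raw term; only the bookkeeping of the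
        -- application changes.
        have st : Step V amb β (Γ.map (er V β)) (.app A B f a) (.sapp f a) T := ⟨hs, .refl hof⟩
        exact st.trans (hR.whnf hΓ hs)
    · exact triv
  · exact triv

theorem whnfStep_spec (hV : EnvOk V) (hβ : Good amb β) {R : Red} (hR : RedOk V amb β R)
    {Γ : List E} (hΓ : Wf V amb β Γ) {t : E} {T : Tm} (ht : Has V amb β (Γ.map (er V β)) t T) :
    Step V amb β (Γ.map (er V β)) t (Red.whnfStep V amb R Γ t) T := by
  have hG := hΓ.ctx hV hβ
  have triv := Step.refl hV hβ hG ht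
  cases t with
  | app A B f a =>
    simp only [Red.whnfStep]
    cases ht with
    | @app _ _ _ _ _ i _ hA hB hf ha hT =>
    obtain ⟨hw, ew⟩ := hR.whnf hΓ hf
    have happ := hT.eq (ew.app_eq (.refl (ha.of hV hβ hG)))
    split
    · rename_i A' B' b hlam
      rw [hlam] at hw happ
      cases hc : (R.conv Γ A A' && R.conv (A :: Γ) B B') with
      | false => exact triv
      | true =>
        obtain ⟨hcA, hcB⟩ := (Bool.and_eq_true _ _).mp hc
        cases hw with
        | @lam _ _ _ _ j _ hA' hB' hb _ =>
        have eA := hR.conv hΓ (hA.up (le_max_left i j)) (hA'.up (le_max_right i j)) hcA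
        have hΓ' : Wf V amb β (A :: Γ) := ⟨hΓ, i, hA⟩
        have hB'' := hB'.conv_ctx hV hβ eA (hΓ'.ctx hV hβ)
        have eB := hR.conv hΓ' (hB.up (le_max_left i j)) (hB''.up (le_max_right i j)) hcB
        -- The test on domains lets the argument enter the function; the test on codomains,
        -- instantiated at the argument, brings the result back to the expected type.
        have ha' := ha.le (.conv eA)
        have eBa := eB.subst_eq ((subOk_var hG).cons (a := er V β a)
          (by rw [subst_var]; exact ha.of hV hβ hG))
        rw [← single_eq] at eBa
        have hle := (Le.conv eBa.symm).trans hT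
        have hba := (hb.inst hV hβ ha' hG).le hle
        have hΓ'' : Wf V amb β (A' :: Γ) := ⟨hΓ, j, hA'⟩
        have st : Step V amb β (Γ.map (er V β)) (.app A B f a) (b.inst a) T := by
          refine ⟨hba, happ.trans ?_⟩
          rw [er_inst hV.closed]
          exact hle.eq (.beta (hb.of hV hβ (hΓ''.ctx hV hβ)) (ha'.of hV hβ hG))
        exact st.trans (hR.whnf hΓ hba)
    · have hw' : Has V amb β (Γ.map (er V β)) (.app A B (R.whnf Γ f) a) T := .app hA hB hw ha hT
      have st : Step V amb β (Γ.map (er V β)) (.app A B f a) (.app A B (R.whnf Γ f) a) T :=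
        ⟨hw', happ⟩
      exact st.trans (whnfApp_spec hV hβ hR hΓ hw')
  | hd h l k => exact whnfSpine_spec hV hβ hR hΓ ht
  | sapp f a => exact whnfSpine_spec hV hβ hR hΓ ht
  | _ => exact triv

/-! ## Conversion -/

theorem struct_spine {R : Red} {Γ : List E} {t : E} : ∀ {n : ℕ} {S : Tm} {u : E},
    spT V β t = some (n, S) → R.struct Γ t u = true →
    ∃ h l k s s', t = (E.hd h l k).spine s ∧ u = (E.hd h l k).spine s' ∧
      R.convList Γ s s' = true := by
  induction t with
  | hd h l k =>
    intro n S u _ hu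
    cases u with
    | hd h' l' k' =>
      have hu := (Bool.and_eq_true _ _).mp hu
      have hu' := (Bool.and_eq_true _ _).mp hu.1
      obtain rfl := Nat.eq_of_beq_eq_true hu'.1
      obtain rfl := Lv.eq_of_beq hu'.2
      obtain rfl := Lv.eq_of_beq hu.2
      exact ⟨_, _, _, [], [], rfl, rfl, rfl⟩
    | _ => cases hu
  | sapp f a ih =>
    intro n S u ht hu
    rw [spT] at ht
    split at ht
    · cases u with
      | sapp f' a' =>
        have hu := (Bool.and_eq_true _ _).mp hu
        obtain ⟨h, l, k, s, s', rfl, rfl, hs⟩ := ih ‹_› hu.1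
        exact ⟨h, l, k, a :: s, a' :: s', rfl, rfl, (Bool.and_eq_true _ _).mpr ⟨hu.2, hs⟩⟩
      | _ => cases hu
    · cases ht
  | _ => intro _ _ _ h; cases h

/-- Once the heads and levels coincide, both spines are instances of one telescope, and pairwise
conversion of arguments lifts to the applications by congruence. -/
theorem spine_conv (hV : EnvOk V) (hβ : Good amb β) {R : Red} (hR : RedOk V amb β R) {Γ : List E}
    (hΓ : Wf V amb β Γ) {t u : E} {T : Tm} (ht : Has V amb β (Γ.map (er V β)) t T)
    (hu : Has V amb β (Γ.map (er V β)) u T) {n : ℕ} {S : Tm} (hS : spT V β t = some (n, S))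
    (hst : R.struct Γ t u = true) :
    Derivable (eq (Γ.map (er V β)) (er V β t) (er V β u) T) := by
  have hG := hΓ.ctx hV hβ
  obtain ⟨h, l, k, s, s', rfl, rfl, hs⟩ := struct_spine hS hst
  obtain ⟨S', hS'⟩ : ∃ S, Has V amb β (Γ.map (er V β)) (.hd h l k) S := by
    apply Has.of_foldl (r := s.reverse) (T := T)
    rwa [List.foldl_reverse]
  cases hS' with
  | @hd _ _ _ _ e _ he ha _ =>
  have hβ' := hβ.upd ha
  have hl := spT_length he hS
  obtain ⟨Δ, B, hB, hl', i, hi⟩ := EntryOk.tele hV he l k hβ' (m := s.length) (by omega)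
  obtain ⟨-, hx, hT, -⟩ := ht.spine he hB hl'
  have hlen : ∀ {x y : List E}, R.convList Γ x y = true → x.length = y.length := by
    intro x
    induction x with
    | nil => intro y h; cases y <;> first | rfl | cases h
    | cons a x ih =>
      intro y h
      cases y with
      | nil => cases h
      | cons b y => exact congrArg (· + 1) (ih ((Bool.and_eq_true _ _).mp h).2)
  obtain ⟨-, hy, -, -⟩ := hu.spine he hB ((hlen hs).symm.trans hl')
  have heq := convList_spec hV hβ hR hΓ (ps := []) hi.ctx_of (by simpa using hx)
    (by simpa using hy) hs
  rw [List.append_nil, List.append_nil] at heq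
  rw [er_spine, er_spine, er, he]
  exact hT.eq (heq.apps (hB ▸ (((hV.entry _ _ he).den _ hβ').closed hG).refl))

theorem struct_spec (hV : EnvOk V) (hβ : Good amb β) {R : Red} (hR : RedOk V amb β R) {Γ : List E}
    (hΓ : Wf V amb β Γ) {t u : E} {T : Tm} (ht : Has V amb β (Γ.map (er V β)) t T)
    (hu : Has V amb β (Γ.map (er V β)) u T) (h : R.struct Γ t u = true) :
    Derivable (eq (Γ.map (er V β)) (er V β t) (er V β u) T) := by
  have hG := hΓ.ctx hV hβ
  have triv := Derivable.refl (ht.of hV hβ hG)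
  cases t with
  | var n =>
    cases u <;> first | cases h | skip
    obtain rfl := Nat.eq_of_beq_eq_true h
    exact triv
  | univ l =>
    cases u <;> first | cases h | skip
    obtain rfl := Lv.eq_of_beq h
    exact triv
  | pi A B =>
    cases u <;> first | cases h | skip
    rename_i A' B'
    obtain ⟨hcA, hcB⟩ := (Bool.and_eq_true _ _).mp h
    cases ht with
    | @pi _ _ _ i _ hA hB hT =>
    cases hu with
    | @pi _ _ _ j _ hA' hB' hT' =>
    have eA := hR.conv hΓ (hA.up (le_max_left i j)) (hA'.up (le_max_right i j)) hcA
    have hΓ' : Wf V amb β (A :: Γ) := ⟨hΓ, i, hA⟩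
    have hB' := hB'.conv_ctx hV hβ eA (hΓ'.ctx hV hβ)
    have eB := hR.conv hΓ' (hB.up (le_max_left i j)) (hB'.up (le_max_right i j)) hcB
    have hT : Le (Γ.map (er V β)) (.univ (max i j)) T := by
      rcases le_total i j with h | h
      · rwa [max_eq_right h]
      · rwa [max_eq_left h]
    exact hT.eq (.pi_eq ((hA.up (le_max_left i j)).of hV hβ hG) eA eB)
  | lam A B b =>
    cases u <;> first | cases h | skip
    rename_i A' B' b'
    simp only [Red.struct, Bool.and_eq_true] at h
    obtain ⟨⟨hcA, hcb⟩, hcB⟩ := h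
    cases ht with
    | @lam _ _ _ _ i _ hA hB hb hT =>
    cases hu with
    | @lam _ _ _ _ j _ hA' hB' hb' hT' =>
    have eA := hR.conv hΓ (hA.up (le_max_left i j)) (hA'.up (le_max_right i j)) hcA
    have hΓ' : Wf V amb β (A :: Γ) := ⟨hΓ, i, hA⟩
    have hc := hΓ'.ctx hV hβ
    -- Codomains are compared as well, because conversion of the bodies is meaningful only at a
    -- common type.
    have eB := hR.conv hΓ' (hB.up (le_max_left i j))
      ((hB'.conv_ctx hV hβ eA hc).up (le_max_right i j)) hcB
    have eb := hR.conv hΓ' hb ((hb'.conv_ctx hV hβ eA hc).le (.conv eB.symm)) hcb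
    exact hT.eq (.lam_eq ((hA.up (le_max_left i j)).of hV hβ hG) eA eb)
  | app A B f a =>
    cases u <;> first | cases h | skip
    rename_i A' B' f' a'
    simp only [Red.struct, Bool.and_eq_true] at h
    obtain ⟨⟨⟨hcf, hca⟩, hcA⟩, hcB⟩ := h
    cases ht with
    | @app _ _ _ _ _ i _ hA hB hf ha hT =>
    cases hu with
    | @app _ _ _ _ _ j _ hA' hB' hf' ha' hT' =>
    have eA := hR.conv hΓ (hA.up (le_max_left i j)) (hA'.up (le_max_right i j)) hcA
    have hΓ' : Wf V amb β (A :: Γ) := ⟨hΓ, i, hA⟩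
    have hc := hΓ'.ctx hV hβ
    have eB := hR.conv hΓ' (hB.up (le_max_left i j))
      ((hB'.conv_ctx hV hβ eA hc).up (le_max_right i j)) hcB
    have ePi := Derivable.pi_eq ((hA.up (le_max_left i j)).of hV hβ hG) eA eB
    have ef := hR.conv hΓ hf (hf'.le (.conv ePi.symm)) hcf
    have ea := hR.conv hΓ ha (ha'.le (.conv eA.symm)) hca
    exact hT.eq (ef.app_eq ea)
  | hd h' l k =>
    cases ht with
    | hd he ha hT => exact spine_conv hV hβ hR hΓ (.hd he ha hT) hu (by rw [spT, he]) h
  | sapp f a =>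
    cases ht with
    | sapp hf hf' ha hT => exact spine_conv hV hβ hR hΓ (.sapp hf hf' ha hT) hu (by rw [spT, hf]) h
  | hole => cases h

theorem convStep_spec (hV : EnvOk V) (hβ : Good amb β) {R : Red} (hR : RedOk V amb β R)
    {Γ : List E} (hΓ : Wf V amb β Γ) {t u : E} {T : Tm}
    (ht : Has V amb β (Γ.map (er V β)) t T) (hu : Has V amb β (Γ.map (er V β)) u T)
    (h : Red.convStep V R Γ t u = true) :
    Derivable (eq (Γ.map (er V β)) (er V β t) (er V β u) T) := by
  rcases (Bool.or_eq_true _ _).mp h with h | h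
  · rw [← er_beq h]
    exact .refl (ht.of hV hβ (hΓ.ctx hV hβ))
  · cases hr : (Red.reducible V t || Red.reducible V u) with
    | false =>
      rw [hr] at h
      exact struct_spec hV hβ hR hΓ ht hu h
    | true =>
      rw [hr] at h
      rcases (Bool.or_eq_true _ _).mp h with h | h
      · exact struct_spec hV hβ hR hΓ ht hu ((Bool.and_eq_true _ _).mp h).2
      · obtain ⟨ht', et⟩ := hR.whnf hΓ ht
        obtain ⟨hu', eu⟩ := hR.whnf hΓ hu
        exact (et.trans (struct_spec hV hβ hR hΓ ht' hu' h)).trans eu.symm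

/-- Induction on the fuel: each step of reduction and conversion is sound relative to any sound
procedure that it calls. -/
theorem red_ok (hV : EnvOk V) (hβ : Good amb β) (n : ℕ) : RedOk V amb β (red V amb n) := by
  induction n with
  | zero => exact
    { whnf := fun hΓ ht => Step.refl hV hβ (hΓ.ctx hV hβ) ht
      conv := fun hΓ ht _ h => er_beq (V := V) (β := β) h ▸ .refl (ht.of hV hβ (hΓ.ctx hV hβ))
      whnf_hole := fun _ => rfl
      conv_hole := fun _ _ => rfl }
  | succ n ih => exact
    { whnf := fun hΓ ht => whnfStep_spec hV hβ ih hΓ ht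
      conv := fun hΓ ht hu h => convStep_spec hV hβ ih hΓ ht hu h
      whnf_hole := fun _ => rfl
      conv_hole := fun Γ t => by
        change Red.convStep V (red V amb n) Γ hole t = false
        have hb : hole.beq t = false := rfl
        have hs (u : E) : Red.struct (red V amb n) Γ hole u = false := rfl
        rw [Red.convStep, hb, hs, ih.whnf_hole, hs]
        simp }

end HoTT.Check

namespace HoTT.Check
open Judgement Tm E

variable {V : Env} {amb : Bool} {β : ℕ → ℕ}

/-! ## Soundness of elaboration -/

/-- `T` is a type. -/
def IsTy (V : Env) (amb : Bool) (β : ℕ → ℕ) (Γ : List E) (T : E) : Prop :=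
  ∃ i, Has V amb β (Γ.map (er V β)) T (.univ i)

/-- A term with its type. -/
def HasTy (V : Env) (amb : Bool) (β : ℕ → ℕ) (Γ : List E) (p : E × E) : Prop :=
  Has V amb β (Γ.map (er V β)) p.1 (er V β p.2) ∧ IsTy V amb β Γ p.2

/-- Elaboration is sound. -/
structure ElbOk (V : Env) (amb : Bool) (β : ℕ → ℕ) (I : Elb) : Prop where
  infer : ∀ {Γ s p}, Wf V amb β Γ → I.infer Γ s = .ok p → HasTy V amb β Γ p
  check : ∀ {Γ s A e}, Wf V amb β Γ → IsTy V amb β Γ A → I.check Γ s A = .ok e →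
    Has V amb β (Γ.map (er V β)) e (er V β A)

theorem RedOk.isTy {R : Red} (hR : RedOk V amb β R) {Γ : List E} (hΓ : Wf V amb β Γ) {T : E}
    (hT : IsTy V amb β Γ T) : IsTy V amb β Γ (R.whnf Γ T) ∧
      Le (Γ.map (er V β)) (er V β T) (er V β (R.whnf Γ T)) ∧
      Le (Γ.map (er V β)) (er V β (R.whnf Γ T)) (er V β T) := by
  obtain ⟨i, hT⟩ := hT
  obtain ⟨h, h'⟩ := hR.whnf hΓ hT
  exact ⟨⟨i, h⟩, .conv h', .conv h'.symm⟩

theorem IsTy.pi {Γ : List E} {A B : E} (h : IsTy V amb β Γ (.pi A B)) :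
    ∃ i, Has V amb β (Γ.map (er V β)) A (.univ i) ∧
      Has V amb β (er V β A :: Γ.map (er V β)) B (.univ i) := by
  obtain ⟨_, h⟩ := h
  cases h with
  | pi hA hB _ => exact ⟨_, hA, hB⟩

theorem applyArgs_spec (hV : EnvOk V) (hβ : Good amb β) {R : Red} (hR : RedOk V amb β R) {I : Elb}
    (hI : ElbOk V amb β I) {Γ : List E} (hΓ : Wf V amb β Γ) : ∀ {as : List E} {e T : E} {p : E × E},
    HasTy V amb β Γ (e, T) → Elb.applyArgs R I Γ e T as = .ok p → HasTy V amb β Γ p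
  | [], e, T, p, h, hp => by
    cases hp
    exact h
  | a :: as, e, T, p, h, hp => by
    change (match R.whnf Γ T with
      | .pi A B => (match I.check Γ a A with
        | .ok a' => Elb.applyArgs R I Γ (.app A B e a') (B.inst a') as
        | .error x => .error x)
      | T' => .error (.mk 1 Γ e T')) = _ at hp
    obtain ⟨h1, h2, -⟩ := hR.isTy hΓ h.2
    split at hp
    · rename_i A B hT
      rw [hT] at h1 h2
      obtain ⟨i, hA, hB⟩ := h1.pi
      split at hp
      · rename_i a' ha
        have ha := hI.check hΓ ⟨i, hA⟩ ha
        have hB' := hB.inst hV hβ ha (hΓ.ctx hV hβ)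
        refine applyArgs_spec hV hβ hR hI hΓ ⟨?_, i, hB'⟩ hp
        refine .app hA hB (h.1.le h2) ha ?_
        change Le _ _ (er V β (B.inst a'))
        rw [er_inst hV.closed]
        exact .refl _
      · cases hp
    · cases hp

theorem build_spec (hV : EnvOk V) (hβ : Good amb β) {R : Red} (hR : RedOk V amb β R) {I : Elb}
    (hI : ElbOk V amb β I) {Γ : List E} (hΓ : Wf V amb β Γ) {ex : List E}
    {sol : List (Option Sol)} : ∀ {as s Δ : List E} {T e : E} {p : E × E} {n : ℕ},
    IsTy V amb β Δ T → HasArgs V amb β (Γ.map (er V β)) s (Δ.map (er V β)) →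
    Has V amb β (Γ.map (er V β)) e (er V β (T.sub s 0)) →
    spT V β e = some (n, er V β (T.sub s 0)) → as.length ≤ n →
    Elb.build R I Γ ex sol T as e s = .ok p → HasTy V amb β Γ p
  | [], s, Δ, T, e, p, n, ⟨i, hT⟩, hs, he, hn, hl, hp =>
    applyArgs_spec hV hβ hR hI hΓ ⟨he, i, hT.subst hV hβ (hΓ.ctx hV hβ) hs⟩ hp
  | a :: as, s, Δ, T, e, p, n, hT, hs, he, hn, hl, hp => by
    cases T with
    | pi A B =>
      change (match I.check Γ (Elb.pick a (Elb.getSol sol as.length)) (A.sub s 0) with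
        | .ok u => Elb.build R I Γ ex sol B as (.sapp e u) (u :: s)
        | .error x => .error x) = _ at hp
      obtain ⟨i, hA, hB⟩ := hT.pi
      split at hp
      · rename_i u hu
        have hA' := hA.subst hV hβ (hΓ.ctx hV hβ) hs
        have hu := hI.check hΓ ⟨i, hA'⟩ hu
        rw [er_sub hV.closed] at hu
        obtain _ | n := n
        · cases hl
        rw [er_sub hV.closed] at he hn
        have hB' : er V β (B.sub (u :: s) 0) =
            ((er V β B).subst (liftSub (ofList (s.map (er V β))))).inst (er V β u) := by
          rw [er_sub hV.closed, subst_liftSub_inst']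
          rfl
        refine build_spec hV hβ hR hI hΓ (s := u :: s) (Δ := A :: Δ) (n := n) ⟨i, hB⟩ ⟨hs, hu⟩
          (.sapp hn he hu ?_) ?_ (Nat.le_of_succ_le_succ hl) hp
        · rw [hB']
          exact .refl _
        · rw [spT, hn, hB']
          rfl
      · cases hp
    | _ => cases hp

theorem Elb.spine_spec (hV : EnvOk V) (hβ : Good amb β) {R : Red} (hR : RedOk V amb β R) {I : Elb}
    (hI : ElbOk V amb β I) {Γ : List E} (hΓ : Wf V amb β Γ) {t : E} {X : Option E} {p : E × E}
    (hp : Elb.spine V amb R I Γ t X = .ok p) : HasTy V amb β Γ p := by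
  unfold Elb.spine at hp
  split at hp
  · rename_i h l k _
    split at hp
    · rename_i e he
      cases ha : e.amb && !(amb && lvid l k) with
      | true =>
        rw [ha] at hp
        cases hp
      | false =>
        rw [ha, cond_false] at hp
        have ha : e.amb = true → amb = true ∧ lvid l k = true := by
          intro h
          simpa [h] using ha
        obtain ⟨i, hi⟩ := (hV.entry _ _ he).ty (Check.upd β l k) (hβ.upd ha)
        have hT : IsTy V amb β [] (e.ty.lm l k) := ⟨i, hi.lm hV.toPlain ha⟩
        have hs : er V β ((e.ty.lm l k).sub [] 0) = er V (Check.upd β l k) e.ty := by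
          rw [er_sub hV.closed, er_lm hV.same]
          exact subst_var _
        -- The proposed solutions are arbitrary, since every argument is checked again.
        have key : ∀ sol, Elb.build R I Γ (t.args.reverse.drop e.n) sol (e.ty.lm l k)
            (t.args.reverse.take e.n) (.hd h l k) [] = .ok p → HasTy V amb β Γ p := by
          intro sol hp
          refine build_spec hV hβ hR hI hΓ (s := []) (Δ := []) hT trivial (n := e.n) ?_ ?_ ?_ hp
          · rw [hs]
            exact .hd he ha (.refl _)
          · rw [hs, spT, he]
          · simp
        cases hh : hasHole (t.args.reverse.take e.n) with
        | true =>
          dsimp only at hp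
          rw [hh] at hp
          exact key _ hp
        | false =>
          dsimp only at hp
          rw [hh] at hp
          exact key _ hp
    · cases hp
  · cases hp

theorem inferType_spec {R : Red} (hR : RedOk V amb β R) {I : Elb} (hI : ElbOk V amb β I)
    {Γ : List E} (hΓ : Wf V amb β Γ) {s e : E} {l : Lv}
    (hp : Elb.inferType R I Γ s = .ok (e, l)) :
    Has V amb β (Γ.map (er V β)) e (.univ (l.ev β)) := by
  unfold Elb.inferType at hp
  split at hp
  · rename_i e' T h
    obtain ⟨h1, h2⟩ := hI.infer hΓ h
    split at hp
    · rename_i l' hl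
      cases hp
      obtain ⟨-, h3, -⟩ := hR.isTy hΓ h2
      rw [hl] at h3
      exact h1.le h3
    · cases hp
  · cases hp

theorem inferStep_spec (hV : EnvOk V) (hβ : Good amb β) {R : Red} (hR : RedOk V amb β R) {I : Elb}
    (hI : ElbOk V amb β I) {Γ : List E} (hΓ : Wf V amb β Γ) {s : E} {p : E × E}
    (hp : Elb.inferStep V amb R I Γ s = .ok p) : HasTy V amb β Γ p := by
  cases s with
  | var n =>
    cases hn : Nat.ble (n + 1) Γ.length with
    | false =>
      simp only [Elb.inferStep, hn, cond_false] at hp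
      cases hp
    | true =>
      simp only [Elb.inferStep, hn, cond_true] at hp
      cases hp
      have hn := Nat.le_of_ble_eq_true hn
      have hA : (Γ.map (er V β))[n]? = some (er V β Γ[n]) := by
        rw [List.getElem?_map, List.getElem?_eq_getElem hn, Option.map_some]
      obtain ⟨h, h'⟩ := hΓ.look hV hβ hA
      refine ⟨.var hA ?_, h'⟩
      rw [h, er_sh hV.closed]
      exact .refl _
  | univ l =>
    cases hp
    exact ⟨.univ (.refl _), _, .univ (.refl _)⟩
  | pi A B =>
    simp only [Elb.inferStep] at hp
    split at hp
    · rename_i A' l hA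
      have hA := inferType_spec hR hI hΓ hA
      split at hp
      · rename_i B' k hB
        have hB := inferType_spec hR hI (Γ := A' :: Γ) ⟨hΓ, _, hA⟩ hB
        cases hp
        obtain ⟨h1, h2⟩ := hβ.le_sup l k
        exact ⟨.pi (hA.up h1) (hB.up h2) (.refl _), _, .univ (.refl _)⟩
      · cases hp
    · cases hp
  | lam A _ b =>
    simp only [Elb.inferStep] at hp
    split at hp
    · rename_i A' l hA
      have hA := inferType_spec hR hI hΓ hA
      split at hp
      · rename_i b' B hb
        obtain ⟨hb, i, hB⟩ := hI.infer (Γ := A' :: Γ) ⟨hΓ, _, hA⟩ hb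
        cases hp
        have hA := hA.up (le_max_left _ i)
        have hB := hB.up (le_max_right (l.ev β) i)
        exact ⟨.lam hA hB hb (.refl _), _, .pi hA hB (.refl _)⟩
      · cases hp
    · cases hp
  | app A B f a =>
    simp only [Elb.inferStep] at hp
    split at hp
    · rename_i f' T hf
      exact applyArgs_spec hV hβ hR hI hΓ (hI.infer hΓ hf) hp
    · cases hp
  | hd h l k => exact Elb.spine_spec hV hβ hR hI hΓ (t := .hd h l k) (X := none) hp
  | sapp f a => exact Elb.spine_spec hV hβ hR hI hΓ (t := .sapp f a) (X := none) hp
  | hole => cases hp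

theorem checkSub_spec (hβ : Good amb β) {R : Red} (hR : RedOk V amb β R) {Γ : List E}
    (hΓ : Wf V amb β Γ) {T e : E} (hT : IsTy V amb β Γ T) {r : Except Err (E × E)}
    (hr : ∀ p, r = .ok p → HasTy V amb β Γ p) (h : Elb.checkSub amb R Γ T r = .ok e) :
    Has V amb β (Γ.map (er V β)) e (er V β T) := by
  unfold Elb.checkSub at h
  split at h
  · rename_i e' T'
    obtain ⟨h1, i, h2⟩ := hr _ rfl
    obtain ⟨j, hT⟩ := hT
    cases hs : R.subs amb Γ T' T with
    | true =>
      rw [hs] at h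
      cases h
      exact h1.le (subs_spec hβ hR hΓ h2 hT hs)
    | false =>
      rw [hs] at h
      cases h
  · cases h

theorem checkLet_spec (hV : EnvOk V) (hβ : Good amb β) {R : Red} (hR : RedOk V amb β R) {I : Elb}
    (hI : ElbOk V amb β I) {Γ : List E} (hΓ : Wf V amb β Γ) {A b a T e : E} (hT : IsTy V amb β Γ T)
    (h : Elb.checkLet R I Γ A b a T = .ok e) : Has V amb β (Γ.map (er V β)) e (er V β T) := by
  unfold Elb.checkLet at h
  split at h
  · rename_i A' l hA
    have hA := inferType_spec hR hI hΓ hA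
    have hΓ' : Wf V amb β (A' :: Γ) := ⟨hΓ, _, hA⟩
    split at h
    · rename_i a' ha
      have ha := hI.check hΓ ⟨_, hA⟩ ha
      split at h
      · rename_i b' hb
        cases h
        obtain ⟨i, hT⟩ := hT
        have hT' : Has V amb β ((A' :: Γ).map (er V β)) (T.sh 1 0) (.univ i) :=
          hT.weaken hV hβ (hΓ'.ctx hV hβ)
        have hb := hI.check hΓ' ⟨i, hT'⟩ hb
        have hA := hA.up (le_max_left _ i)
        have hT' := hT'.up (le_max_right (l.ev β) i)
        -- A local definition becomes a beta redex whose codomain is weakened, so it does not depend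
        -- on the defined variable.
        refine .app hA hT' (.lam hA hT' hb (.refl _)) ha ?_
        rw [er_sh hV.closed, shift_inst]
        exact .refl _
      · cases h
    · cases h
  · cases h

theorem checkStep_spec (hV : EnvOk V) (hβ : Good amb β) {R : Red} (hR : RedOk V amb β R) {I : Elb}
    (hI : ElbOk V amb β I) {Γ : List E} (hΓ : Wf V amb β Γ) {s T e : E} (hT : IsTy V amb β Γ T)
    (h : Elb.checkStep V amb R I Γ s T = .ok e) : Has V amb β (Γ.map (er V β)) e (er V β T) := by
  have infer {s : E} (h : Elb.checkSub amb R Γ T (I.infer Γ s) = .ok e) :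
      Has V amb β (Γ.map (er V β)) e (er V β T) :=
    checkSub_spec hβ hR hΓ hT (fun p hp => hI.infer hΓ hp) h
  unfold Elb.checkStep at h
  split at h
  · split at h
    · exact infer h
    · obtain ⟨h1, -, h2⟩ := hR.isTy hΓ hT
      split at h
      · rename_i A B hT'
        rw [hT'] at h1 h2
        obtain ⟨i, hA, hB⟩ := h1.pi
        split at h
        · rename_i b' hb
          cases h
          exact .lam hA hB (hI.check (Γ := A :: Γ) ⟨hΓ, i, hA⟩ ⟨i, hB⟩ hb) h2
        · cases h
      · cases h
  · split at h
    · split at h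
      · exact checkLet_spec hV hβ hR hI hΓ hT h
      · exact infer h
    · exact infer h
  · exact checkSub_spec hβ hR hΓ hT (fun p hp => Elb.spine_spec hV hβ hR hI hΓ hp) h
  · cases h
  · exact infer h

theorem elb_ok (hV : EnvOk V) (hβ : Good amb β) {R : Red} (hR : RedOk V amb β R) (n : ℕ) :
    ElbOk V amb β (elb V amb R n) := by
  induction n with
  | zero => exact ⟨fun _ h => (by cases h), fun _ _ h => (by cases h)⟩
  | succ n ih =>
    exact ⟨fun hΓ h => inferStep_spec hV hβ hR ih hΓ h,
      fun hΓ hT h => checkStep_spec hV hβ hR ih hΓ hT h⟩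

end HoTT.Check

namespace HoTT.Check
open Judgement Tm E

variable {V W : Env} {amb : Bool} {β : ℕ → ℕ}

/-! ## Extension of signatures -/

/-- The constants of `V` are constants of `W`, possibly with more computation rules. -/
def Ext (V W : Env) : Prop := ∀ h e, V.find h = some e → ∃ e', W.find h = some e' ∧
  e'.amb = e.amb ∧ e'.ty = e.ty ∧ e'.n = e.n ∧ e'.den = e.den

/-- All constants of a typed term belong to the smaller signature. For untyped terms this fails,
since an unknown constant erases to a default that the extension may change. -/
theorem Has.er_ext (hW : Ext V W) {Γ : Ctx} {e : E} {T : Tm} (h : Has V amb β Γ e T) :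
    er W β e = er V β e := by
  induction h with
  | var | univ => rfl
  | pi _ _ _ ihA ihB => rw [er, er, ihA, ihB]
  | lam _ _ _ _ ihA _ ihb => rw [er, er, ihA, ihb]
  | app _ _ _ _ _ _ _ ihf iha => rw [er, er, ihf, iha]
  | sapp _ _ _ _ ihf iha => rw [er, er, ihf, iha]
  | hd h _ _ =>
    obtain ⟨e', h', -, -, -, hd⟩ := hW _ _ h
    rw [er, er, h, h']
    simp only [hd]

theorem er_ty_ext (hV : EnvOk V) (hW : Ext V W) {h : ℕ} {e : Entry} (he : V.find h = some e)
    (hβ : Good e.amb β) : er W β e.ty = er V β e.ty := by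
  obtain ⟨i, hi⟩ := (hV.entry _ _ he).ty β hβ
  exact hi.er_ext hW

theorem spT_ext (hV : EnvOk V) (hW : Ext V W) (hβ : Good amb β) {Γ : Ctx} {f : E} :
    ∀ {n : ℕ} {S T : Tm}, Has V amb β Γ f T → spT V β f = some (n, S) → spT W β f = some (n, S) := by
  induction f with
  | hd h l k =>
    intro n S T hf hS
    cases hf with
    | hd he ha _ =>
    obtain ⟨e', he', -, ht, hn, -⟩ := hW _ _ he
    rw [spT, he] at hS
    rw [spT, he', ← hS]
    simp only [ht, hn, er_ty_ext hV hW he (hβ.upd ha)]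
  | sapp f a ih =>
    intro n S T hf hS
    cases hf with
    | sapp hs hf ha _ =>
    rw [spT, hs] at hS
    rw [spT, ih hf hs, ← hS]
    simp only [ha.er_ext hW]
  | _ => intro _ _ _ _ h; cases h

theorem Has.ext (hV : EnvOk V) (hW : Ext V W) (hβ : Good amb β) {Γ : Ctx} {e : E} {T : Tm}
    (h : Has V amb β Γ e T) : Has W amb β Γ e T := by
  induction h with
  | var h hT => exact .var h hT
  | univ hT => exact .univ hT
  | pi hA _ hT ihA ihB => exact .pi ihA (by rwa [hA.er_ext hW]) hT
  | lam hA hB _ hT ihA ihB ihb =>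
    rw [← hB.er_ext hW, ← hA.er_ext hW] at ihb hT
    exact .lam ihA (by rwa [hA.er_ext hW]) ihb hT
  | app hA hB _ ha hT ihA ihB ihf iha =>
    rw [← hB.er_ext hW, ← hA.er_ext hW] at ihf
    rw [← hA.er_ext hW] at iha
    rw [← hB.er_ext hW, ← ha.er_ext hW] at hT
    exact .app ihA (by rwa [hA.er_ext hW]) ihf iha hT
  | hd he ha hT =>
    obtain ⟨e', he', ha', ht, -, -⟩ := hW _ _ he
    refine .hd he' (by rwa [ha']) ?_
    rwa [ht, er_ty_ext hV hW he (hβ.upd ha)]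
  | sapp hs hf ha hT ihf iha =>
    rw [← ha.er_ext hW] at hT
    exact .sapp (spT_ext hV hW hβ hf hs) ihf iha hT

theorem Wf.er_ext (hW : Ext V W) : ∀ {Γ : List E}, Wf V amb β Γ →
    Γ.map (er W β) = Γ.map (er V β)
  | [], _ => rfl
  | _ :: _, ⟨h, _, hA⟩ => by rw [List.map_cons, List.map_cons, h.er_ext hW, hA.er_ext hW]

theorem Wf.ext (hV : EnvOk V) (hW : Ext V W) (hβ : Good amb β) : ∀ {Γ : List E}, Wf V amb β Γ →
    Wf W amb β Γ
  | [], _ => trivial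
  | _ :: _, ⟨h, i, hA⟩ => ⟨h.ext hV hW hβ, i, by rw [h.er_ext hW]; exact hA.ext hV hW hβ⟩

theorem HasArgs.er_ext (hW : Ext V W) {Γ : Ctx} : ∀ {s : List E} {Δ : Ctx},
    HasArgs V amb β Γ s Δ → s.map (er W β) = s.map (er V β)
  | [], [], _ => rfl
  | _ :: _, _ :: _, ⟨h, ha⟩ => by rw [List.map_cons, List.map_cons, h.er_ext hW, ha.er_ext hW]

theorem HasArgs.ext (hV : EnvOk V) (hW : Ext V W) (hβ : Good amb β) {Γ : Ctx} :
    ∀ {s : List E} {Δ : Ctx}, HasArgs V amb β Γ s Δ → HasArgs W amb β Γ s Δ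
  | [], [], _ => trivial
  | _ :: _, _ :: _, ⟨h, ha⟩ => ⟨h.ext hV hW hβ, by rw [h.er_ext hW]; exact ha.ext hV hW hβ⟩

theorem EntryOk.ext (hV : EnvOk V) (hW : Ext V W) {e : Entry} (he : EntryOk V e) : EntryOk W e where
  ty β hβ := by
    obtain ⟨i, hi⟩ := he.ty β hβ
    exact ⟨i, hi.ext hV hW hβ⟩
  den β hβ := by
    obtain ⟨i, hi⟩ := he.ty β hβ
    rw [hi.er_ext hW]
    exact he.den β hβ
  args := by
    obtain ⟨Δ, R, hR, hl, hb, hr⟩ := he.args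
    have tele : ∀ β, Good e.amb β → Δ.map (er W β) = Δ.map (er V β) ∧ er W β R = er V β R := by
      intro β hβ
      obtain ⟨i, hi⟩ := he.ty β hβ
      rw [hR] at hi
      obtain ⟨hΔ, j, hj⟩ := Wf.epis (Γ := []) trivial hi
      rw [List.append_nil] at hΔ
      exact ⟨hΔ.er_ext hW, hj.er_ext hW⟩
    refine ⟨Δ, R, hR, hl, fun b h β hβ => ?_, fun r h β hβ => ?_⟩
    · obtain ⟨h1, h2⟩ := hb b h β hβ
      rw [(tele β hβ).1, (tele β hβ).2, h1.er_ext hW]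
      exact ⟨h1.ext hV hW hβ, h2⟩
    · obtain ⟨h1, h2, h3, h4, h5⟩ := hr r h β hβ
      refine ⟨h1, h2.ext hV hW hβ, ?_, ?_, ?_⟩
      · rw [h2.er_ext hW, (tele β hβ).1]
        exact h3.ext hV hW hβ
      · rw [h2.er_ext hW, (tele β hβ).2, h3.er_ext hW]
        exact h4.ext hV hW hβ
      · rw [h2.er_ext hW, (tele β hβ).2, h3.er_ext hW, h4.er_ext hW]
        exact h5

theorem EnvOk.ext (hV : EnvOk V) (hW : Ext V W) (h : Plain W)
    (h' : ∀ h e, W.find h = some e → EntryOk V e) : EnvOk W :=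
  ⟨h, fun _ _ he => (h' _ _ he).ext hV hW⟩

theorem Env.find_cons (e : Entry) (V : Env) (h : ℕ) :
    Env.find (e :: V) h = bif Nat.beq e.key h then some e else V.find h := rfl

/-- The type and the denotation of a constant are closed, and independent of the bound of the level
variables. -/
structure PlainEntry (e : Entry) : Prop where
  ty : plain e.ty 0 = true
  closed : ∀ β, Scoped 0 (e.den β)
  same : ∀ β β', SameLv β β' → e.den β = e.den β'

theorem find_cons_imp {P : Entry → Prop} {e : Entry} (he : P e)
    (hV : ∀ h e, V.find h = some e → P e) (h : ℕ) (e' : Entry)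
    (h' : Env.find (e :: V) h = some e') : P e' := by
  rw [Env.find_cons] at h'
  cases hb : Nat.beq e.key h with
  | true =>
    rw [hb] at h'
    cases h'
    exact he
  | false =>
    rw [hb] at h'
    exact hV _ _ h'

theorem Plain.cons (hV : Plain V) {e : Entry} (he : PlainEntry e) : Plain (e :: V) where
  ty := find_cons_imp (P := fun e => plain e.ty 0 = true) he.ty hV.ty
  closed := find_cons_imp (P := fun e => ∀ β, Scoped 0 (e.den β)) he.closed hV.closed
  same := find_cons_imp (P := fun e => ∀ β β', SameLv β β' → e.den β = e.den β') he.same hV.same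

theorem EnvOk.cons (hV : EnvOk V) {e : Entry} (hp : PlainEntry e) (he : EntryOk V e)
    (hf : V.find e.key = none) : EnvOk (e :: V) := by
  refine hV.ext (fun h e' h' => ⟨e', ?_, rfl, rfl, rfl, rfl⟩) (hV.toPlain.cons hp)
    (find_cons_imp he hV.entry)
  rw [Env.find_cons]
  cases hb : Nat.beq e.key h with
  | true =>
    rw [Nat.eq_of_beq_eq_true hb, h'] at hf
    cases hf
  | false => exact h'

/-- Computation rules are added to the last constant. -/
theorem EnvOk.rules {e : Entry} (hV : EnvOk V) (hV' : EnvOk (e :: V)) (hp : PlainEntry e)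
    (hf : V.find e.key = none) (rs : List IRule) (he : EntryOk (e :: V) { e with rules := rs }) :
    EnvOk ({ e with rules := rs } :: V) := by
  have hE : Ext V (e :: V) := by
    intro h e' h'
    refine ⟨e', ?_, rfl, rfl, rfl, rfl⟩
    rw [Env.find_cons]
    cases hb : Nat.beq e.key h with
    | true =>
      rw [Nat.eq_of_beq_eq_true hb, h'] at hf
      cases hf
    | false => exact h'
  -- The version with rules has the same type, arity and denotation as the version without, so it is
  -- an extension in the sense of `Ext`, although it replaces the entry.
  refine hV'.ext ?_ (hV.toPlain.cons ⟨hp.ty, hp.closed, hp.same⟩)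
    (find_cons_imp he fun h e' h' => (hV.entry h e' h').ext hV hE)
  intro h e' h'
  rw [Env.find_cons] at h' ⊢
  change ∃ e', (bif Nat.beq e.key h then _ else _) = _ ∧ _
  cases hb : Nat.beq e.key h with
  | true =>
    rw [hb] at h'
    cases h'
    exact ⟨_, rfl, rfl, rfl, rfl, rfl⟩
  | false =>
    rw [hb] at h'
    exact ⟨_, h', rfl, rfl, rfl, rfl⟩

theorem envOk_nil : EnvOk [] where
  closed _ _ h := by cases h
  same _ _ h := by cases h
  ty _ _ h := by cases h
  entry _ _ h := by cases h

end HoTT.Check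

/-! ### Declarations and the soundness of a list of declarations. -/

namespace HoTT.Check

/-! ## Declarations -/

/-- A closed declaration of a constant. Its type starts with `n` domains, and the terms `t` and `u`
are in the context of these. -/
structure Decl where
  key : ℕ
  amb : Bool
  n : ℕ
  ty : E
  t : E
  u : E

/-- The context of the first `n` domains and the remaining codomain. -/
def peel (n : ℕ) : E → List E → List E × E :=
  Nat.rec (motive := fun _ => E → List E → List E × E) (fun T Γ => (Γ, T))
    (fun _ ih T Γ => match T with | .pi A B => ih B (A :: Γ) | T => (Γ, T)) n

/-- A function of the variables of a context. -/
def elams (Δ : List E) (b : E) : E := Δ.foldl (fun b A => .lam A .hole b) b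

namespace Decl
open E

def fuel : ℕ := 1000

def getE {α : Type} : Except Err (E × α) → E
  | .ok (e, _) => e
  | .error _ => hole

def getC : Except Err E → E
  | .ok e => e
  | .error _ => hole

def isOk {α : Type} : Except Err α → Bool
  | .ok _ => true
  | .error _ => false

def elbOf (V : Env) (amb : Bool) : Elb := elb V amb (red V amb fuel) fuel

def elTy (V : Env) (d : Decl) : Except Err (E × Lv) :=
  Elb.inferType (red V d.amb fuel) (elbOf V d.amb) [] d.ty

/-- The elaborated type. -/
def tyE (V : Env) (d : Decl) : E := getE (d.elTy V)

/-- The elaborated context and the elaborated type of the terms. -/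
def tele (V : Env) (d : Decl) : List E × E := peel d.n (d.tyE V) []

def elTerm (V : Env) (d : Decl) (t : E) : Except Err E :=
  (elbOf V d.amb).check (d.tele V).1 t (d.tele V).2

/-- The elaboration of a term. -/
def termE (V : Env) (d : Decl) (t : E) : E := getC (d.elTerm V t)

/-- The function that a term is the value of, before elaboration. -/
def fn (d : Decl) (t : E) : E := elams (peel d.n d.ty []).1 t

/-- The elaborated function that a term is the value of. -/
def fnE (V : Env) (d : Decl) (t : E) : E := elams (d.tele V).1 (d.termE V t)

/-- A theorem. -/
def thm (V : Env) (d : Decl) : Entry :=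
  ⟨d.key, d.amb, d.tyE V, d.n, none, [], fun β => er V β (d.fnE V d.t)⟩

/-- A transparent definition. -/
def dfn (V : Env) (d : Decl) : Entry :=
  ⟨d.key, d.amb, d.tyE V, d.n, some (d.termE V d.t), [], fun β => er V β (d.fnE V d.t)⟩

/-- A transparent definition without holes. -/
def sdf (V : Env) (d : Decl) : Entry :=
  ⟨d.key, d.amb, d.tyE V, d.n, some (d.termE V d.t), [], fun β => er V β (d.fn d.t)⟩

/-- A primitive constant. -/
def cst (V : Env) (d : Decl) (c : ℕ → ℕ → Const) (rs : List IRule) : Entry :=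
  ⟨d.key, false, d.tyE V, d.n, none, rs, fun β => .const (c (β 0) (β 1))⟩

/-- The arguments of the right-hand side of a rule. -/
def ruleArgs (V : Env) (d : Decl) : List E := (d.termE V d.t).args

/-- A computation rule of an eliminator with `np` parameters, motives and methods, for the
constructor that is the key. -/
def rule (V : Env) (arity np : ℕ) (d : Decl) : IRule :=
  ⟨d.key, np, (d.tele V).1.take (d.n - np), (d.ruleArgs V).take (arity - np), d.termE V d.u⟩

/-- The type is valid. -/
def okTy (V : Env) (d : Decl) : Bool := isOk (d.elTy V) && Nat.beq (d.tele V).1.length d.n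

/-- The declared term is valid. -/
def okTerm (V : Env) (d : Decl) : Bool := d.okTy V && isOk (d.elTerm V d.t) &&
  (plain (d.tyE V) 0 && plain (d.fnE V d.t) 0 && !(V.find d.key).isSome)

def isVars (s : List E) : ℕ → ℕ → Bool :=
  List.rec (motive := fun _ => ℕ → ℕ → Bool) (fun _ n => Nat.beq n 0)
    (fun a _ ih k n => match a, n with
      | var m, n + 1 => Nat.beq m k && ih (k + 1) n
      | _, _ => false) s

def beqs (s : List E) : List E → Bool :=
  List.rec (motive := fun _ => List E → Bool) (fun t => t.isEmpty)
    (fun a _ ih t => match t with | b :: t => a.beq b && ih t | [] => false) s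

/-- The head of a term is a constant at the level variables `0` and `1`. -/
def isHd (h : ℕ) : E → Bool
  | hd h' l k => Nat.beq h' h && lvid l k
  | _ => false

/-- A computation rule for a constant with `m` arguments of types `Δ` is valid. -/
def okRule (V : Env) (h m np : ℕ) (Δ : List E) (d : Decl) : Bool :=
  d.okTy V && isOk (d.elTerm V d.t) && isOk (d.elTerm V d.u) && !d.amb &&
    ((d.tyE V).beq d.ty && (d.termE V d.t).beq d.t && (d.termE V d.u).beq d.u) &&
    (isHd h (d.termE V d.t).head && Nat.beq (d.ruleArgs V).length m && Nat.ble np m &&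
      Nat.ble np d.n && isVars ((d.ruleArgs V).drop (m - np)) (d.n - np) np) &&
    ((Red.tySpine V (d.termE V d.t)).beq (d.tele V).2 &&
      beqs ((d.tele V).1.drop (d.n - np)) (Δ.drop (m - np)))

end Decl

/-- A declaration of a rule: the arity of the eliminator, the number of its parameters, motives and
methods, and the equation. -/
structure RuleDecl where
  m : ℕ
  np : ℕ
  d : Decl
  r : ℕ → ℕ → Rule

inductive Item
  | c (d : Decl) (k : ℕ → ℕ → Const) (rs : List RuleDecl)
  | s (d : Decl)
  | f (d : Decl)
  | t (d : Decl)

namespace Item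

def decl : Item → Decl
  | c d _ _ | s d | f d | t d => d

def rules (V : Env) (d : Decl) (k : ℕ → ℕ → Const) (rs : List RuleDecl) : List IRule :=
  rs.map fun r => r.d.rule (d.cst V k [] :: V) r.m r.np

def entry (V : Env) : Item → Entry
  | c d k rs => d.cst V k (rules V d k rs)
  | s d => d.sdf V
  | f d => d.dfn V
  | t d => d.thm V

def okRules (V : Env) (h n : ℕ) (Δ : List E) (rs : List RuleDecl) : Bool :=
  List.rec (motive := fun _ => Bool) true
    (fun r _ ih => r.d.okRule V h n r.np Δ && Nat.beq r.m n && ih) rs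

/-- The elaboration succeeds. -/
def ok (V : Env) : Item → Bool
  | c d k rs => d.okTy V && (d.tyE V).beq d.ty && plain (d.tyE V) 0 && !d.amb &&
      !(V.find d.key).isSome && okRules (d.cst V k [] :: V) d.key d.n (d.tele V).1 rs
  | s d => d.okTerm V && (d.tyE V).beq d.ty && (d.termE V d.t).beq d.t
  | f d => d.okTerm V
  | t d => d.okTerm V

/-- The erased equation of a rule is the given one. -/
def RuleEqn (V : Env) (r : RuleDecl) : Prop :=
  ∀ β : ℕ → ℕ, β 2 = 0 → er V β (r.d.fn r.d.t) = (r.r (β 0) (β 1)).eqn.lhs.close ∧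
    er V β (r.d.fn r.d.u) = (r.r (β 0) (β 1)).eqn.rhs.close ∧
    er V β r.d.ty = (r.r (β 0) (β 1)).eqn.type.close

def RuleEqns (V : Env) : List RuleDecl → Prop
  | [] => True
  | r :: rs => RuleEqn V r ∧ RuleEqns V rs

/-- The erased type of a constant is the given one. -/
def Eqn (V : Env) : Item → Prop
  | c d k rs => (∀ β : ℕ → ℕ, β 2 = 0 → er V β d.ty = (k (β 0) (β 1)).typeTerm.close) ∧
      RuleEqns (d.cst V k [] :: V) rs
  | s _ => True
  | f _ => True
  | t _ => True

end Item

/-- Extension of a signature by declarations. -/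
def addAll (l : List Item) (V : Env) : Env :=
  List.rec (motive := fun _ => Env → Env) (fun V => V) (fun i _ ih V => ih (i.entry V :: V)) l V

def okAll (l : List Item) (V : Env) : Bool :=
  List.rec (motive := fun _ => Env → Bool) (fun _ => true)
    (fun i _ ih V => i.ok V && ih (i.entry V :: V)) l V

def Eqns : List Item → Env → Prop
  | [], _ => True
  | i :: l, V => i.Eqn V ∧ Eqns l (i.entry V :: V)

end HoTT.Check

namespace HoTT.Check
open Judgement Tm E

variable {V : Env} {β : ℕ → ℕ}

/-! ## Soundness of declarations -/

theorem epis_peel (n : ℕ) : ∀ (T : E) (Γ : List E),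
    epis (peel n T Γ).1 (peel n T Γ).2 = epis Γ T := by
  induction n with
  | zero => exact fun _ _ => rfl
  | succ n ih =>
    intro T Γ
    cases T with
    | pi A B => exact ih B (A :: Γ)
    | _ => rfl

theorem er_peel (n : ℕ) : ∀ {T T' : E} {Γ Γ' : List E}, T.beq T' = true →
    Γ.map (er V β) = Γ'.map (er V β) →
    (peel n T Γ).1.map (er V β) = (peel n T' Γ').1.map (er V β) := by
  induction n with
  | zero => exact fun _ h => h
  | succ n ih =>
    intro T T' Γ Γ' h hΓ
    cases T <;> cases T' <;> first | exact hΓ | cases h | skip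
    have h := (Bool.and_eq_true _ _).mp h
    exact ih h.2 (by rw [List.map_cons, List.map_cons, er_beq h.1, hΓ])

theorem er_elams (V : Env) (β : ℕ → ℕ) : ∀ (Δ : List E) (b : E),
    er V β (elams Δ b) = lams (Δ.map (er V β)) (er V β b)
  | [], _ => rfl
  | _ :: Δ, _ => er_elams V β Δ _

theorem Wf.drop {amb : Bool} : ∀ {Γ : List E} (n : ℕ), Wf V amb β Γ → Wf V amb β (Γ.drop n)
  | _, 0, h => h
  | [], _ + 1, _ => trivial
  | _ :: _, n + 1, h => h.1.drop n

theorem Wf.append {amb : Bool} : ∀ {r s t : List E}, Wf V amb β (r ++ s) → Wf V amb β t →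
    s.map (er V β) = t.map (er V β) → Wf V amb β (r ++ t)
  | [], _, _, _, ht, _ => ht
  | _ :: r, s, t, ⟨h, i, hi⟩, ht, e => by
    refine ⟨h.append ht e, i, ?_⟩
    change Has V amb β ((r ++ t).map (er V β)) _ _
    rw [List.map_append, ← e, ← List.map_append]
    exact hi

namespace Decl

theorem okTy_spec (hV : EnvOk V) {d : Decl} (h : d.okTy V = true) (hβ : Good d.amb β) :
    IsTy V d.amb β [] (d.tyE V) ∧ Wf V d.amb β (d.tele V).1 ∧
      IsTy V d.amb β (d.tele V).1 (d.tele V).2 := by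
  have h := ((Bool.and_eq_true _ _).mp h).1
  have hT : IsTy V d.amb β [] (d.tyE V) := by
    unfold tyE
    cases he : d.elTy V with
    | error x => rw [he] at h; cases h
    | ok p =>
      exact ⟨_, inferType_spec (red_ok hV hβ _) (elb_ok hV hβ (red_ok hV hβ _) _) (Γ := []) trivial he⟩
  obtain ⟨i, hi⟩ := id hT
  rw [show d.tyE V = epis (d.tele V).1 (d.tele V).2 from (epis_peel d.n _ []).symm] at hi
  have := Wf.epis (Γ := []) trivial hi
  rw [List.append_nil] at this
  exact ⟨hT, this⟩

theorem length_tele {d : Decl} (h : d.okTy V = true) : (d.tele V).1.length = d.n :=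
  Nat.eq_of_beq_eq_true ((Bool.and_eq_true _ _).mp h).2

theorem elTerm_spec (hV : EnvOk V) {d : Decl} (h : d.okTy V = true) {t : E}
    (ht : isOk (d.elTerm V t) = true) (hβ : Good d.amb β) :
    Has V d.amb β ((d.tele V).1.map (er V β)) (d.termE V t) (er V β (d.tele V).2) := by
  obtain ⟨-, hΓ, hT⟩ := okTy_spec hV h hβ
  unfold termE
  cases he : d.elTerm V t with
  | error x => rw [he] at ht; cases ht
  | ok e => exact (elb_ok hV hβ (red_ok hV hβ _) _).check hΓ hT he

theorem entryOk (hV : EnvOk V) {d : Decl} (h : d.okTy V = true) (h' : isOk (d.elTerm V d.t) = true)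
    {b : Option E} (hb : ∀ e ∈ b, e = d.termE V d.t) {den : (ℕ → ℕ) → Tm}
    (hden : ∀ β, den β = er V β (d.fnE V d.t)) :
    EntryOk V ⟨d.key, d.amb, d.tyE V, d.n, b, [], den⟩ where
  ty β hβ := (okTy_spec hV h hβ).1
  den β hβ := by
    change Derivable (of [] (den β) (er V β (d.tyE V)))
    rw [hden, fnE, er_elams, show d.tyE V = epis (d.tele V).1 (d.tele V).2 from
      (epis_peel d.n _ []).symm, er_epis]
    obtain ⟨-, hΓ, -⟩ := okTy_spec hV h hβ
    exact Derivable.lams ((elTerm_spec hV h h' hβ).of hV hβ (hΓ.ctx hV hβ))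
  args := by
    refine ⟨(d.tele V).1, (d.tele V).2, (epis_peel d.n _ []).symm, length_tele h,
      fun e he β hβ => ?_, fun r hr => by cases hr⟩
    obtain rfl := hb e he
    refine ⟨elTerm_spec hV h h' hβ, ?_⟩
    rw [← er_elams]
    exact hden β

theorem plainEntry (hV : Plain V) {e : Entry} {b : E} (h : plain e.ty 0 = true)
    (hb : plain b 0 = true) (hden : ∀ β, e.den β = er V β b) : PlainEntry e where
  ty := h
  closed β := by
    rw [hden]
    exact scoped_of_plain hV.closed β hb
  same β β' hβ := by
    rw [hden, hden]
    exact er_same hV.same hβ hb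

/-- When elaboration changes only annotations, the source term has the same erasure. Definitions
that occur in the statements can then denote the erasure of their source, and comparison with the
given raw terms never runs the elaborator. -/
theorem er_fn {d : Decl} (h : (d.tyE V).beq d.ty = true) {t : E}
    (ht : (d.termE V t).beq t = true) : er V β (d.fn t) = er V β (d.fnE V t) := by
  rw [fn, fnE, er_elams, er_elams, er_beq ht, tele, er_peel d.n h rfl]

theorem isVars_spec {s : List E} : ∀ {k n : ℕ}, isVars s k n = true → s = vars k n := by
  induction s with
  | nil =>
    intro k n h
    rw [Nat.eq_of_beq_eq_true (n := n) h]
    rfl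
  | cons a s ih =>
    intro k n h
    cases a <;> cases n <;> first | cases h | skip
    rename_i m n
    have h := (Bool.and_eq_true _ _).mp h
    rw [Nat.eq_of_beq_eq_true h.1, ih h.2]
    simp only [vars, List.range_succ_eq_map, List.map_cons, List.map_map]
    congr 1
    refine List.map_congr_left fun x _ => ?_
    simp only [Function.comp]
    congr 1
    omega

theorem beqs_spec {s : List E} : ∀ {t : List E}, beqs s t = true →
    s.map (er V β) = t.map (er V β) := by
  induction s with
  | nil =>
    intro t h
    cases t with
    | nil => rfl
    | cons => cases h
  | cons a s ih =>
    intro t h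
    cases t with
    | nil => cases h
    | cons b t =>
      have h := (Bool.and_eq_true _ _).mp h
      rw [List.map_cons, List.map_cons, er_beq h.1, ih h.2]

theorem isHd_spec {h : ℕ} {t : E} (ht : isHd h t = true) : ∃ l k, t = .hd h l k ∧
    lvid l k = true := by
  cases t with
  | hd h' l k =>
    have h := (Bool.and_eq_true _ _).mp ht
    obtain rfl := Nat.eq_of_beq_eq_true h.1
    exact ⟨l, k, rfl, h.2⟩
  | _ => cases ht

/-- The left-hand side is a spine whose head is the constant, so its typing yields the arguments in
the telescope of the constant. The tests on variables identify the parameters, motive and methods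
with the variables of the context of the rule. The abstracted equation is then literally an instance
of the formal computation rule. -/
theorem okRule_spec (hV : EnvOk V) {h m np : ℕ} {Δ : List E} {d : Decl}
    (hr : d.okRule V h m np Δ = true) {e : Entry} (he : V.find h = some e) (ha : e.amb = false)
    {R : E} (hR : e.ty = epis Δ R) (hm : Δ.length = m) (hβ : Good false β) {r : Rule}
    (h1 : er V β (d.fn d.t) = r.eqn.lhs.close) (h2 : er V β (d.fn d.u) = r.eqn.rhs.close)
    (h3 : er V β d.ty = r.eqn.type.close) :
    RuleOk V false β (e.den β) Δ R (d.rule V m np) := by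
  simp only [okRule, Bool.and_eq_true, Bool.not_eq_true'] at hr
  obtain ⟨⟨⟨⟨⟨⟨hty, ht⟩, hu⟩, hamb⟩, ⟨hbT, hbt⟩, hbu⟩,
    ⟨⟨⟨hhd, hlen⟩, hnp⟩, hnp'⟩, hvars⟩, hsp, hdrop⟩ := hr
  have hlen : (d.ruleArgs V).length = m := Nat.eq_of_beq_eq_true hlen
  have hnp := Nat.le_of_ble_eq_true hnp
  have hnp' := Nat.le_of_ble_eq_true hnp'
  have hvars := isVars_spec hvars
  have hΓl := length_tele hty
  have hdm : Good d.amb β := by rwa [hamb]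
  obtain ⟨-, hΓ, -⟩ := okTy_spec hV hty hdm
  have ht := elTerm_spec hV hty ht hdm
  have hu := elTerm_spec hV hty hu hdm
  rw [hamb] at hΓ ht hu
  obtain ⟨l, k, hh, hlk⟩ := isHd_spec hhd
  have hs : d.termE V d.t = (E.hd h l k).spine (d.ruleArgs V) := by
    rw [← hh, ruleArgs, spine_head_args]
  have hty' : er V (upd β l k) e.ty = pis (Δ.map (er V β)) (er V β R) := by
    rw [upd_of_lvid hlk, hR, er_epis]
  have ht' := ht
  rw [hs] at ht'
  obtain ⟨-, hargs, -, n, hn⟩ := ht'.spine he hty' (by rw [List.length_map, hlen, hm])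
  rw [← hs] at hn
  -- The test compares the declared type with the computed type of the left-hand side, so the two
  -- are equal as raw terms and not merely convertible.
  have hT : er V β (d.tele V).2 =
      (er V β R).subst (ofList ((d.ruleArgs V).map (er V β))) := by
    rw [← er_beq hsp]
    rcases tySpine_spec hV hβ (hΓ.ctx hV hβ) ht with h0 | ⟨⟨n', hn'⟩, -⟩
    · rw [h0] at hsp
      cases hsp
    · rw [hn] at hn'
      exact (Prod.mk.inj (Option.some.inj hn')).2.symm
  have hrest : (d.rule V m np).rest.length = m - np := by
    simp only [rule, List.length_take, hlen]
    omega
  have htys : (d.rule V m np).tys.length = d.n - np := by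
    simp only [rule, List.length_take, hΓl]
    omega
  have hsplit : (d.rule V m np).rest ++ vars (d.rule V m np).tys.length (d.rule V m np).np =
      d.ruleArgs V := by
    rw [htys]
    change (d.ruleArgs V).take (m - np) ++ vars (d.n - np) np = _
    rw [← hvars, List.take_append_drop]
  have hctx : ((d.rule V m np).tys ++ Δ.drop (d.rule V m np).rest.length).map (er V β) =
      (d.tele V).1.map (er V β) := by
    rw [hrest, List.map_append, ← beqs_spec hdrop, ← List.map_append]
    change ((d.tele V).1.take (d.n - np) ++ _).map _ = _
    rw [List.take_append_drop]
  refine ⟨?_, ?_, ?_, ?_, ?_⟩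
  · rw [hrest]
    change m - np + np = _
    omega
  · rw [hrest]
    refine Wf.append (s := (d.tele V).1.drop (d.n - np)) ?_ ?_ (beqs_spec hdrop)
    · change Wf V false β ((d.tele V).1.take (d.n - np) ++ _)
      rwa [List.take_append_drop]
    · obtain ⟨i, hi⟩ := (hV.entry _ _ he).ty β (by rwa [ha])
      rw [hR, ha] at hi
      have := (Wf.epis (Γ := []) trivial hi).1
      rw [List.append_nil] at this
      exact this.drop _
  · rw [hctx, hsplit]
    exact hargs
  · rw [hctx, hsplit, ← hT]
    exact hu
  · rw [hctx, hsplit, ← hT, ← er_epis, ← er_elams]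
    have e1 : lams ((d.tele V).1.map (er V β)) (apps (e.den β) ((d.ruleArgs V).map (er V β))) =
        r.eqn.lhs.close := by
      rw [← h1, er_fn hbT hbt, fnE, er_elams, hs, er_spine, er, he]
      simp only [upd_of_lvid hlk]
    have e2 : er V β (elams (d.tele V).1 (d.rule V m np).rhs) = r.eqn.rhs.close := by
      rw [← h2, er_fn hbT hbu]
      rfl
    have e3 : er V β (epis (d.tele V).1 (d.tele V).2) = r.eqn.type.close := by
      rw [← h3, tele, epis_peel]
      exact er_beq hbT
    rw [e1, e2, e3]
    exact .rule r .ctx_nil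

theorem cst_ok (hV : EnvOk V) {d : Decl} {k : ℕ → ℕ → Const} (h : d.okTy V = true)
    (hT : (d.tyE V).beq d.ty = true) (ha : d.amb = false)
    (hk : ∀ β : ℕ → ℕ, β 2 = 0 → er V β d.ty = (k (β 0) (β 1)).typeTerm.close) :
    EntryOk V (d.cst V k []) where
  ty β hβ := by
    have := (okTy_spec hV h (β := β) (by rwa [ha])).1
    rwa [ha] at this
  den β hβ := by
    change Derivable (of [] (.const (k (β 0) (β 1))) (er V β (d.tyE V)))
    rw [er_beq hT, hk β hβ.1]
    exact .const _ .ctx_nil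
  args := ⟨(d.tele V).1, (d.tele V).2, (epis_peel d.n _ []).symm, length_tele h,
    ⟨fun e he => (by cases he), fun r hr => (by cases hr)⟩⟩

theorem cst_plain {d : Decl} {k : ℕ → ℕ → Const} (h : plain (d.tyE V) 0 = true)
    {rs : List IRule} : PlainEntry (d.cst V k rs) where
  ty := h
  closed β s hs := rfl
  same β β' hβ := by
    change Tm.const _ = Tm.const _
    rw [hβ 0 (by decide), hβ 1 (by decide)]

end Decl

namespace Item

theorem rules_spec (hV : EnvOk V) {h n : ℕ} {Δ : List E} {e : Entry} (he : V.find h = some e)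
    (ha : e.amb = false) {R : E} (hR : e.ty = epis Δ R) (hm : Δ.length = n) :
    ∀ {rs : List RuleDecl}, okRules V h n Δ rs = true → RuleEqns V rs →
    ∀ r ∈ rs.map (fun r => r.d.rule V r.m r.np), ∀ β, Good false β →
      RuleOk V false β (e.den β) Δ R r
  | [], _, _, r, hr, _, _ => by cases hr
  | r :: rs, hok, heq, r', hr', β, hβ => by
    have hok := (Bool.and_eq_true _ _).mp hok
    have hok' := (Bool.and_eq_true _ _).mp hok.1
    rcases List.mem_cons.mp hr' with rfl | hr'
    · obtain ⟨h1, h2, h3⟩ := heq.1 β hβ.1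
      dsimp only
      rw [Nat.eq_of_beq_eq_true hok'.2]
      exact Decl.okRule_spec hV hok'.1 he ha hR hm hβ h1 h2 h3
    · exact rules_spec hV he ha hR hm hok.2 heq.2 r' hr' β hβ

theorem ok_spec (hV : EnvOk V) {i : Item} (h : i.ok V = true) (hi : i.Eqn V) :
    EnvOk (i.entry V :: V) := by
  have term {d : Decl} (h : d.okTerm V = true) : d.okTy V = true ∧
      Decl.isOk (d.elTerm V d.t) = true ∧ plain (d.tyE V) 0 = true ∧
      plain (d.fnE V d.t) 0 = true ∧ V.find d.key = none := by
    simpa [Decl.okTerm, and_assoc] using h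
  cases i with
  | c d k rs =>
    simp only [ok, Bool.and_eq_true, Bool.not_eq_true', Option.isSome_eq_false_iff,
      Option.isNone_iff_eq_none] at h
    obtain ⟨⟨⟨⟨⟨h1, h2⟩, h3⟩, h4⟩, h5⟩, h6⟩ := h
    have he := Decl.cst_ok hV h1 h2 h4 hi.1
    have hp : PlainEntry (d.cst V k []) := Decl.cst_plain h3
    have hV' := hV.cons hp he h5
    have hf : Env.find (d.cst V k [] :: V) d.key = some (d.cst V k []) := by
      rw [Env.find_cons]
      change (bif Nat.beq d.key d.key then _ else _) = _
      rw [Nat.beq_refl]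
      rfl
    -- Computation rules mention the constant that they belong to. They are checked where it is
    -- still without rules, and attached afterwards.
    refine EnvOk.rules (e := d.cst V k []) hV hV' hp h5 _ ?_
    obtain ⟨h7, h8, -⟩ := hV'.entry _ _ hf
    refine ⟨h7, h8, (d.tele V).1, (d.tele V).2, (epis_peel d.n _ []).symm, Decl.length_tele h1,
      fun e he => (by cases he), ?_⟩
    exact rules_spec hV' hf rfl (epis_peel d.n _ []).symm (Decl.length_tele h1) h6 hi.2
  | s d =>
    have h := (Bool.and_eq_true _ _).mp h
    have h' := (Bool.and_eq_true _ _).mp h.1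
    obtain ⟨h1, h2, h3, h4, h5⟩ := term h'.1
    have hd (β) := Decl.er_fn (β := β) h'.2 h.2
    exact hV.cons (Decl.plainEntry hV.toPlain h3 h4 hd)
      (Decl.entryOk hV h1 h2 (fun e he => (Option.some.inj he).symm) hd) h5
  | f d =>
    obtain ⟨h1, h2, h3, h4, h5⟩ := term h
    exact hV.cons (Decl.plainEntry hV.toPlain h3 h4 fun _ => rfl)
      (Decl.entryOk hV h1 h2 (fun e he => (Option.some.inj he).symm) fun _ => rfl) h5
  | t d =>
    obtain ⟨h1, h2, h3, h4, h5⟩ := term h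
    exact hV.cons (Decl.plainEntry hV.toPlain h3 h4 fun _ => rfl)
      (Decl.entryOk hV h1 h2 (fun e he => by cases he) fun _ => rfl) h5

end Item

theorem EnvOk.addAll {l : List Item} : ∀ {V : Env}, EnvOk V → okAll l V = true → Eqns l V →
    EnvOk (addAll l V) := by
  induction l with
  | nil => exact fun h _ _ => h
  | cons i l ih =>
    intro V hV h hi
    have h := (Bool.and_eq_true _ _).mp h
    exact ih (Item.ok_spec hV h.1 hi.1) h.2 hi.2

end HoTT.Check

/-! ### Transcription of the primitive constants and of the definitions in the statements. -/

namespace HoTT.Check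

/-! ## Named variables -/

/-- Terms with named variables: functions of the number of variables in scope. -/
abbrev Bd := ℕ → E

def Va (d : ℕ) : Bd := fun e => .var (e - (d + 1))
def U (l : Lv) : Bd := fun _ => .univ l
def Pi (A : Bd) (B : Bd → Bd) : Bd := fun d => .pi (A d) (B (Va d) (d + 1))
def Lam (A : Bd) (b : Bd → Bd) : Bd := fun d => .lam (A d) .hole (b (Va d) (d + 1))
/-- A function whose type is inferred. -/
def ELam (A : Bd) (b : Bd → Bd) : Bd := fun d =>
  .lam (A d) (.lam .hole .hole .hole) (b (Va d) (d + 1))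
/-- A function whose domain is inferred. -/
def Fn (b : Bd → Bd) : Bd := fun d => .lam .hole .hole (b (Va d) (d + 1))
def App (f a : Bd) : Bd := fun d => .app .hole .hole (f d) (a d)
def Arr (A B : Bd) : Bd := Pi A fun _ => B
def hole : Bd := fun _ => .hole
/-- A constant applied to arguments. -/
def Hd (h : ℕ) (l k : Lv) (as : List Bd) : Bd :=
  fun d => as.foldl (fun f a => .sapp f (a d)) (.hd h l k)

infixr:30 " ⇒ " => Arr
infixl:200 " ⬝ " => App
notation "◦" => hole

def l0 : Lv := ⟨0, 0⟩
def l1 : Lv := ⟨1, 0⟩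
def lz : Lv := ⟨2, 0⟩

/-- A type and two terms in the context of a telescope. -/
structure Tele where
  n : ℕ
  ty : Bd
  t : Bd
  u : Bd

/-- The number of arguments does not depend on the bound variable, so it is computed at a dummy. -/
def arg (A : Bd) (k : Bd → Tele) : Tele where
  n := (k hole).n + 1
  ty := fun d => .pi (A d) ((k (Va d)).ty (d + 1))
  t := fun d => (k (Va d)).t (d + 1)
  u := fun d => (k (Va d)).u (d + 1)

def ret (T : Bd) (t : Bd := hole) (u : Bd := hole) : Tele := ⟨0, T, t, u⟩

def Tele.decl (t : Tele) (key : ℕ) (amb : Bool := false) : Decl := ⟨key, amb, t.n, t.ty 0, t.t 0, t.u 0⟩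

/-! ## Primitive constants -/

def Empty : Bd := Hd 0 lz lz []
def emptyInd (P x : Bd) (k := l0) : Bd := Hd 1 k lz [P, x]
def Unit : Bd := Hd 2 lz lz []
def star : Bd := Hd 3 lz lz []
def unitInd (P s x : Bd) (k := l0) : Bd := Hd 4 k lz [P, s, x]
def Nat' : Bd := Hd 5 lz lz []
def zero : Bd := Hd 6 lz lz []
def succ (n : Bd) : Bd := Hd 7 lz lz [n]
def natInd (P z s n : Bd) (k := l0) : Bd := Hd 8 k lz [P, z, s, n]
def sig (A B : Bd) (i := l0) : Bd := Hd 9 i lz [A, B]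
def Sig (A : Bd) (B : Bd → Bd) (i := l0) : Bd := sig A (Lam A B) i
def Prod (A B : Bd) (i := l0) : Bd := Sig A (fun _ => B) i
def pair (a b : Bd) (A := ◦) (B := ◦) (i := l0) : Bd := Hd 10 i lz [A, B, a, b]
def sigInd (P h p : Bd) (A := ◦) (B := ◦) (i := l0) (k := l0) : Bd := Hd 11 i k [A, B, P, h, p]
def Id (A x y : Bd) (i := l0) : Bd := Hd 12 i lz [A, x, y]
def refl (A := ◦) (x := ◦) (i := l0) : Bd := Hd 13 i lz [A, x]
def idInd (P h p : Bd) (A := ◦) (x := ◦) (y := ◦) (i := l0) (k := l0) : Bd :=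
  Hd 14 i k [A, x, P, h, y, p]
def funextC (A B f g : Bd) (i := l0) : Bd := Hd 15 i lz [A, B, f, g]
def univalence (A B : Bd) (i := l0) : Bd := Hd 16 i lz [A, B]
/-- A constant at a span. -/
def Span (h : ℕ) (A B C f g : Bd) (as : List Bd) (i := l0) (k := lz) : Bd :=
  Hd h i k ([A, B, C, f, g] ++ as)
def trunc (A : Bd) (i := l0) : Bd := Hd 23 i lz [A]
def tr (a : Bd) (A := ◦) (i := l0) : Bd := Hd 24 i lz [A, a]
def squash (x y : Bd) (A := ◦) (i := l0) : Bd := Hd 25 i lz [A, x, y]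
def truncInd (P h q x : Bd) (A := ◦) (i := l0) (k := l0) : Bd := Hd 26 i k [A, P, h, q, x]
/-- A constant at a nullification. -/
def Null (h : ℕ) (A B X : Bd) (as : List Bd) (i := l0) (k := lz) : Bd :=
  Hd h i k ([A, B, X] ++ as)

/-! ## Transparent definitions -/

def fst (A B p : Bd) (i := l0) : Bd := Hd 40 i lz [A, B, p]
def snd (A B p : Bd) (i := l0) : Bd := Hd 41 i lz [A, B, p]
def transport (P p u : Bd) (A := ◦) (x := ◦) (y := ◦) (i := l0) (k := l0) : Bd :=
  Hd 42 i k [A, P, x, y, p, u]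
def apd (A P f x y p : Bd) (i := l0) (k := l0) : Bd := Hd 43 i k [A, P, f, x, y, p]
def ap (f p : Bd) (A := ◦) (B := ◦) (x := ◦) (y := ◦) (i := l0) : Bd := Hd 44 i lz [A, B, f, x, y, p]
def pathOverConst (A B x y p u v e : Bd) (i := l0) : Bd := Hd 45 i lz [A, B, x, y, p, u, v, e]
def isEquiv (A B f : Bd) (i := l0) : Bd := Hd 46 i lz [A, B, f]
def Equiv (A B : Bd) (i := l0) : Bd := Hd 47 i lz [A, B]
def idEquiv (A : Bd) (i := l0) : Bd := Hd 48 i lz [A]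
def idToEquiv (A B p : Bd) (i := l0) : Bd := Hd 49 i lz [A, B, p]
def happly (A B f g p : Bd) (i := l0) : Bd := Hd 50 i lz [A, B, f, g, p]

def mk (A : Bd) (B : Bd → Bd) (a b : Bd) (i := l0) : Bd := pair a b A (Lam A B) i

def natHyp (body : Bd → Bd → Bd → Tele) : Tele :=
  arg (Nat' ⇒ U l0) fun P => arg (P ⬝ zero) fun z =>
  arg (Pi Nat' fun n => P ⬝ n ⇒ P ⬝ succ n) fun s => body P z s

def sigHyp (body : Bd → Bd → Bd → Bd → Tele) : Tele :=
  arg (U l0) fun A => arg (A ⇒ U l0) fun B => arg (sig A B ⇒ U l1) fun P =>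
  arg (Pi A fun a => Pi (B ⬝ a) fun b => P ⬝ pair a b A B) fun h => body A B P h

def idHyp (body : Bd → Bd → Bd → Bd → Tele) : Tele :=
  arg (U l0) fun A => arg A fun x => arg (Pi A fun y => Id A x y ⇒ U l1) fun P =>
  arg (P ⬝ x ⬝ refl A x) fun h => body A x P h

def spanHyp (body : Bd → Bd → Bd → Bd → Bd → Tele) : Tele :=
  arg (U l0) fun A => arg (U l0) fun B => arg (U l0) fun C => arg (C ⇒ A) fun f =>
  arg (C ⇒ B) fun g => body A B C f g

def pushoutHyp (body : Bd → Bd → Bd → Bd → Bd → Bd → Bd → Bd → Bd → Tele) : Tele :=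
  spanHyp fun A B C f g => arg (Span 17 A B C f g [] ⇒ U l1) fun P =>
  arg (Pi A fun a => P ⬝ Span 18 A B C f g [a]) fun l =>
  arg (Pi B fun b => P ⬝ Span 19 A B C f g [b]) fun r =>
  arg (Pi C fun c => Id (P ⬝ Span 19 A B C f g [g ⬝ c])
    (transport P (Span 20 A B C f g [c]) (l ⬝ (f ⬝ c)) (Span 17 A B C f g [])
      (Span 18 A B C f g [f ⬝ c]) (Span 19 A B C f g [g ⬝ c]) l0 l1)
    (r ⬝ (g ⬝ c)) l1) fun q =>
  body A B C f g P l r q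

def truncHyp (body : Bd → Bd → Bd → Bd → Tele) : Tele :=
  arg (U l0) fun A => arg (trunc A ⇒ U l1) fun P => arg (Pi A fun a => P ⬝ tr a A) fun h =>
  arg (Pi (trunc A) fun x => Pi (trunc A) fun y => Pi (P ⬝ x) fun u => Pi (P ⬝ y) fun v =>
    Id (P ⬝ y) (transport P (squash x y A) u (trunc A) x y l0 l1) v l1) fun q =>
  body A P h q

def nullParam (body : Bd → Bd → Bd → Tele) : Tele :=
  arg (U l0) fun A => arg (A ⇒ U l0) fun B => arg (U l0) fun X => body A B X

def nullHyp (body : Bd → Bd → Bd → Bd → Bd → Bd → Bd → Bd → Bd → Tele) : Tele :=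
  nullParam fun A B X =>
  arg (Null 27 A B X [] ⇒ U l1) fun P =>
  arg (Pi X fun x => P ⬝ Null 28 A B X [x]) fun h =>
  arg (Pi A fun a => Pi (B ⬝ a ⇒ Null 27 A B X []) fun g =>
    (Pi (B ⬝ a) fun b => P ⬝ (g ⬝ b)) ⇒ P ⬝ Null 29 A B X [a, g]) fun s =>
  arg (Pi A fun a => Pi (B ⬝ a ⇒ Null 27 A B X []) fun g =>
    Pi (Pi (B ⬝ a) fun b => P ⬝ (g ⬝ b)) fun u => Pi (B ⬝ a) fun b =>
    Id (P ⬝ (g ⬝ b))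
      (transport P (Null 30 A B X [a, g, b]) (s ⬝ a ⬝ g ⬝ u) (Null 27 A B X [])
        (Null 29 A B X [a, g]) (g ⬝ b) l0 l1)
      (u ⬝ b) l1) fun s' =>
  arg (Pi A fun a => Pi (B ⬝ a ⇒ Null 27 A B X []) fun g =>
    (Pi (B ⬝ a) fun b => P ⬝ (g ⬝ b)) ⇒ P ⬝ Null 31 A B X [a, g]) fun r =>
  arg (Pi A fun a => Pi (Null 27 A B X []) fun x => Pi (P ⬝ x) fun u =>
    Id (P ⬝ x)
      (transport P (Null 32 A B X [a, x])
        (r ⬝ a ⬝ (Lam (B ⬝ a) fun _ => x) ⬝ (Lam (B ⬝ a) fun _ => u)) (Null 27 A B X [])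
        (Null 31 A B X [a, Lam (B ⬝ a) fun _ => x]) x l0 l1)
      u l1) fun r' =>
  body A B X P h s s' r r'

def dEmpty := (ret (U lz)).decl 0
def dEmptyInd := (arg (Empty ⇒ U l0) fun P => arg Empty fun x => ret (P ⬝ x)).decl 1
def dUnit := (ret (U lz)).decl 2
def dStar := (ret Unit).decl 3
def dUnitInd := (arg (Unit ⇒ U l0) fun P => arg (P ⬝ star) fun _ => arg Unit fun x => ret (P ⬝ x)).decl 4
def dNat := (ret (U lz)).decl 5
def dZero := (ret Nat').decl 6
def dSucc := (arg Nat' fun _ => ret Nat').decl 7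
def dNatInd := (natHyp fun P _ _ => arg Nat' fun n => ret (P ⬝ n)).decl 8
def dSig := (arg (U l0) fun A => arg (A ⇒ U l0) fun _ => ret (U l0)).decl 9
def dPair := (arg (U l0) fun A => arg (A ⇒ U l0) fun B => arg A fun a => arg (B ⬝ a) fun _ =>
  ret (sig A B)).decl 10
def dSigInd := (sigHyp fun A B P _ => arg (sig A B) fun x => ret (P ⬝ x)).decl 11
def dId := (arg (U l0) fun A => arg A fun _ => arg A fun _ => ret (U l0)).decl 12
def dRefl := (arg (U l0) fun A => arg A fun x => ret (Id A x x)).decl 13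
def dIdInd := (idHyp fun A x P _ => arg A fun y => arg (Id A x y) fun p => ret (P ⬝ y ⬝ p)).decl 14
def dFunext := (arg (U l0) fun A => arg (A ⇒ U l0) fun B =>
  arg (Pi A fun x => B ⬝ x) fun f => arg (Pi A fun x => B ⬝ x) fun g =>
  ret (isEquiv (Id (Pi A fun x => B ⬝ x) f g) (Pi A fun x => Id (B ⬝ x) (f ⬝ x) (g ⬝ x))
    (Hd 50 l0 lz [A, B, f, g]))).decl 15
def dUnivalence := (arg (U l0) fun A => arg (U l0) fun B =>
  ret (isEquiv (Id (U l0) A B ⟨0, 1⟩) (Equiv A B) (Hd 49 l0 lz [A, B]) ⟨0, 1⟩)).decl 16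
def dPushout := (spanHyp fun _ _ _ _ _ => ret (U l0)).decl 17
def dInl := (spanHyp fun A B C f g => arg A fun _ => ret (Span 17 A B C f g [])).decl 18
def dInr := (spanHyp fun A B C f g => arg B fun _ => ret (Span 17 A B C f g [])).decl 19
def dGlue := (spanHyp fun A B C f g => arg C fun c => ret (Id (Span 17 A B C f g [])
  (Span 18 A B C f g [f ⬝ c]) (Span 19 A B C f g [g ⬝ c]))).decl 20
def dPushoutInd := (pushoutHyp fun A B C f g P _ _ _ =>
  arg (Span 17 A B C f g []) fun x => ret (P ⬝ x)).decl 21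
def dPushoutIndGlue := (pushoutHyp fun A B C f g P l r q => arg C fun c =>
  ret (Id (Id (P ⬝ Span 19 A B C f g [g ⬝ c])
      (transport P (Span 20 A B C f g [c]) (l ⬝ (f ⬝ c)) (Span 17 A B C f g [])
        (Span 18 A B C f g [f ⬝ c]) (Span 19 A B C f g [g ⬝ c]) l0 l1)
      (r ⬝ (g ⬝ c)) l1)
    (apd (Span 17 A B C f g []) P (Span 21 A B C f g [P, l, r, q] l0 l1)
      (Span 18 A B C f g [f ⬝ c]) (Span 19 A B C f g [g ⬝ c]) (Span 20 A B C f g [c]) l0 l1)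
    (q ⬝ c) l1)).decl 22
def dTrunc := (arg (U l0) fun _ => ret (U l0)).decl 23
def dTr := (arg (U l0) fun A => arg A fun _ => ret (trunc A)).decl 24
def dSquash := (arg (U l0) fun A => arg (trunc A) fun x => arg (trunc A) fun y =>
  ret (Id (trunc A) x y)).decl 25
def dTruncInd := (truncHyp fun A P _ _ => arg (trunc A) fun x => ret (P ⬝ x)).decl 26
def dNull := (nullParam fun _ _ _ => ret (U l0)).decl 27
def dEta := (nullParam fun A B X => arg X fun _ => ret (Null 27 A B X [])).decl 28
def dSec := (nullParam fun A B X => arg A fun a => arg (B ⬝ a ⇒ Null 27 A B X []) fun _ =>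
  ret (Null 27 A B X [])).decl 29
def dIsSec := (nullParam fun A B X => arg A fun a => arg (B ⬝ a ⇒ Null 27 A B X []) fun g =>
  arg (B ⬝ a) fun b => ret (Id (Null 27 A B X []) (Null 29 A B X [a, g]) (g ⬝ b))).decl 30
def dRet := (nullParam fun A B X => arg A fun a => arg (B ⬝ a ⇒ Null 27 A B X []) fun _ =>
  ret (Null 27 A B X [])).decl 31
def dIsRet := (nullParam fun A B X => arg A fun a => arg (Null 27 A B X []) fun x =>
  ret (Id (Null 27 A B X []) (Null 31 A B X [a, Lam (B ⬝ a) fun _ => x]) x)).decl 32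
def dNullInd := (nullHyp fun A B X P _ _ _ _ _ => arg (Null 27 A B X []) fun x =>
  ret (P ⬝ x)).decl 33

def rUnit := (arg (Unit ⇒ U l0) fun P => arg (P ⬝ star) fun h =>
  ret (P ⬝ star) (Hd 4 l0 l1 [P, h, star]) h).decl 3
def rZero := (natHyp fun P z s => ret (P ⬝ zero) (Hd 8 l0 l1 [P, z, s, zero]) z).decl 6
def rSucc := (natHyp fun P z s => arg Nat' fun n =>
  ret (P ⬝ succ n) (Hd 8 l0 l1 [P, z, s, succ n]) (s ⬝ n ⬝ Hd 8 l0 l1 [P, z, s, n])).decl 7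
def rPair := (sigHyp fun A B P h => arg A fun a => arg (B ⬝ a) fun b =>
  ret (P ⬝ pair a b A B) (sigInd P h (pair a b A B) A B l0 l1) (h ⬝ a ⬝ b)).decl 10
def rRefl := (idHyp fun A x P h =>
  ret (P ⬝ x ⬝ refl A x) (idInd P h (refl A x) A x x l0 l1) h).decl 13
def rInl := (pushoutHyp fun A B C f g P l r q => arg A fun a =>
  ret (P ⬝ Span 18 A B C f g [a]) (Span 21 A B C f g [P, l, r, q, Span 18 A B C f g [a]] l0 l1)
    (l ⬝ a)).decl 18
def rInr := (pushoutHyp fun A B C f g P l r q => arg B fun b =>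
  ret (P ⬝ Span 19 A B C f g [b]) (Span 21 A B C f g [P, l, r, q, Span 19 A B C f g [b]] l0 l1)
    (r ⬝ b)).decl 19
def rTr := (truncHyp fun A P h q => arg A fun a =>
  ret (P ⬝ tr a A) (truncInd P h q (tr a A) A l0 l1) (h ⬝ a)).decl 24
def rEta := (nullHyp fun A B X P h s s' r r' => arg X fun x =>
  ret (P ⬝ Null 28 A B X [x])
    (Null 33 A B X [P, h, s, s', r, r', Null 28 A B X [x]] l0 l1) (h ⬝ x)).decl 28

def fFst := (arg (U l0) fun A => arg (A ⇒ U l0) fun B => arg (sig A B) fun p =>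
  ret A (sigInd (Lam (sig A B) fun _ => A) (Lam A fun a => Lam (B ⬝ a) fun _ => a) p A B)).decl 40
def fSnd := (arg (U l0) fun A => arg (A ⇒ U l0) fun B => arg (sig A B) fun p =>
  ret (B ⬝ fst A B p) (sigInd (Lam (sig A B) fun q => B ⬝ fst A B q)
    (Lam A fun a => Lam (B ⬝ a) fun b => b) p A B)).decl 41
def fTransport := (arg (U l0) fun A => arg (A ⇒ U l1) fun P => arg A fun x => arg A fun y =>
  arg (Id A x y) fun p => arg (P ⬝ x) fun u =>
  ret (P ⬝ y) (idInd (Lam A fun z => Lam (Id A x z) fun _ => P ⬝ z) u p A x y l0 l1)).decl 42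
def fApd := (arg (U l0) fun A => arg (A ⇒ U l1) fun P => arg (Pi A fun x => P ⬝ x) fun f =>
  arg A fun x => arg A fun y => arg (Id A x y) fun p =>
  ret (Id (P ⬝ y) (transport P p (f ⬝ x) A x y l0 l1) (f ⬝ y) l1)
    (idInd (Lam A fun z => Lam (Id A x z) fun q =>
      Id (P ⬝ z) (transport P q (f ⬝ x) A x z l0 l1) (f ⬝ z) l1)
      (refl (P ⬝ x) (f ⬝ x) l1) p A x y l0 l1)).decl 43
def fAp := (arg (U l0) fun A => arg (U l0) fun B => arg (A ⇒ B) fun f => arg A fun x =>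
  arg A fun y => arg (Id A x y) fun p => ret (Id B (f ⬝ x) (f ⬝ y))
    (idInd (Lam A fun z => Lam (Id A x z) fun _ => Id B (f ⬝ x) (f ⬝ z))
      (refl B (f ⬝ x)) p A x y)).decl 44
def fPathOverConst := (arg (U l0) fun A => arg (U l0) fun B => arg A fun x => arg A fun y =>
  arg (Id A x y) fun p => arg B fun u => arg B fun v => arg (Id B u v) fun e =>
  ret (Id B (transport (Lam A fun _ => B) p u A x y) v)
    (idInd (Lam A fun z => Lam (Id A x z) fun q =>
      Id B (transport (Lam A fun _ => B) q u A x z) v) e p A x y)).decl 45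
def fIsEquiv := (arg (U l0) fun A => arg (U l0) fun B => arg (A ⇒ B) fun f => ret (U l0)
  (Prod (Sig (B ⇒ A) fun g => Pi B fun b => Id B (f ⬝ (g ⬝ b)) b)
    (Sig (B ⇒ A) fun h => Pi A fun a => Id A (h ⬝ (f ⬝ a)) a))).decl 46
def fEquiv := (arg (U l0) fun A => arg (U l0) fun B => ret (U l0)
  (Sig (A ⇒ B) fun f => isEquiv A B f)).decl 47
def fIdEquiv := (arg (U l0) fun A => ret (Equiv A A)
  (mk (A ⇒ A) (fun f => isEquiv A A f) (Lam A fun x => x)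
    (mk (Sig (A ⇒ A) fun g => Pi A fun b => Id A (g ⬝ b) b)
      (fun _ => Sig (A ⇒ A) fun h => Pi A fun a => Id A (h ⬝ a) a)
      (mk (A ⇒ A) (fun g => Pi A fun b => Id A (g ⬝ b) b) (Lam A fun x => x)
        (Lam A fun x => refl A x))
      (mk (A ⇒ A) (fun h => Pi A fun a => Id A (h ⬝ a) a) (Lam A fun x => x)
        (Lam A fun x => refl A x))))).decl 48
def fIdToEquiv := (arg (U l0) fun A => arg (U l0) fun B => arg (Id (U l0) A B ⟨0, 1⟩) fun p =>
  ret (Equiv A B) (idInd (Lam (U l0) fun C => Lam (Id (U l0) A C ⟨0, 1⟩) fun _ => Equiv A C)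
    (idEquiv A) p (U l0) A B ⟨0, 1⟩ l0)).decl 49
def fHapply := (arg (U l0) fun A => arg (A ⇒ U l0) fun B => arg (Pi A fun x => B ⬝ x) fun f =>
  arg (Pi A fun x => B ⬝ x) fun g => arg (Id (Pi A fun x => B ⬝ x) f g) fun p =>
  ret (Pi A fun x => Id (B ⬝ x) (f ⬝ x) (g ⬝ x))
    (idInd (Lam (Pi A fun x => B ⬝ x) fun h => Lam (Id (Pi A fun x => B ⬝ x) f h) fun _ =>
      Pi A fun x => Id (B ⬝ x) (f ⬝ x) (h ⬝ x)) (Lam A fun x => refl (B ⬝ x) (f ⬝ x)) p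
      (Pi A fun x => B ⬝ x) f g)).decl 50

/-- Only what the argument uses is transcribed. Binary sums are absent. So are the computation rules
of truncation at `squash`, and those of nullification at its constructors other than the unit:
recursion into local types needs only its value at the unit. -/
def baseItems : List Item := [
  .c dEmpty (fun _ _ => .empty) [], .c dEmptyInd (fun k _ => .emptyInd k) [],
  .c dUnit (fun _ _ => .unit) [], .c dStar (fun _ _ => .star) [],
  .c dUnitInd (fun k _ => .unitInd k) [⟨3, 2, rUnit, fun k _ => .unitStar k⟩],
  .c dNat (fun _ _ => .nat) [], .c dZero (fun _ _ => .zero) [], .c dSucc (fun _ _ => .succ) [],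
  .c dNatInd (fun k _ => .natInd k)
    [⟨4, 3, rZero, fun k _ => .natZero k⟩, ⟨4, 3, rSucc, fun k _ => .natSucc k⟩],
  .c dSig (fun i _ => .sig i) [], .c dPair (fun i _ => .pair i) [],
  .c dSigInd (fun i k => .sigInd i k) [⟨5, 4, rPair, fun i k => .sigPair i k⟩],
  .c dId (fun i _ => .id i) [], .c dRefl (fun i _ => .refl i) [],
  .c dIdInd (fun i k => .idInd i k) [⟨6, 4, rRefl, fun i k => .idRefl i k⟩],
  .s fFst, .s fSnd, .s fTransport, .s fApd, .s fAp, .s fPathOverConst,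
  .s fIsEquiv, .s fEquiv, .s fIdEquiv, .s fIdToEquiv, .s fHapply,
  .c dFunext (fun i _ => .funext i) [], .c dUnivalence (fun i _ => .univalence i) [],
  .c dPushout (fun i _ => .pushout i) [], .c dInl (fun i _ => .inl i) [],
  .c dInr (fun i _ => .inr i) [], .c dGlue (fun i _ => .glue i) [],
  .c dPushoutInd (fun i k => .pushoutInd i k)
    [⟨10, 9, rInl, fun i k => .pushoutInl i k⟩, ⟨10, 9, rInr, fun i k => .pushoutInr i k⟩],
  .c dPushoutIndGlue (fun i k => .pushoutIndGlue i k) [],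
  .c dTrunc (fun i _ => .trunc i) [], .c dTr (fun i _ => .tr i) [],
  .c dSquash (fun i _ => .squash i) [],
  .c dTruncInd (fun i k => .truncInd i k) [⟨5, 4, rTr, fun i k => .truncTr i k⟩],
  .c dNull (fun i _ => .null i) [], .c dEta (fun i _ => .eta i) [],
  .c dSec (fun i _ => .sec i) [], .c dIsSec (fun i _ => .isSec i) [],
  .c dRet (fun i _ => .ret i) [], .c dIsRet (fun i _ => .isRet i) [],
  .c dNullInd (fun i k => .nullInd i k) [⟨10, 9, rEta, fun i k => .nullEta i k⟩]]

end HoTT.Check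

namespace HoTT.Check

/-! ## Sheaves and covers -/

def l2 : Lv := ⟨3, 0⟩
def l3 : Lv := ⟨4, 0⟩
def lu : Lv := ⟨0, 1⟩

def isTruncSubTwo (n X : Bd) (i := l0) : Bd := Hd 52 i lz [] ⬝ n ⬝ X
def fib (A B f b : Bd) (i := l0) : Bd := Hd 53 i lz [A, B, f, b]
def mem (I T Y : Bd) : Bd := Hd 54 l0 l1 [I, T, Y]
def isCover (I T A B f : Bd) : Bd := Hd 55 l0 l1 [I, T, A, B, f]
def truncFamily (I T x : Bd) : Bd := Hd 56 l0 l1 [I, T, x]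
def isSheaf (I T X : Bd) : Bd := Hd 57 l0 l1 [I, T, X]
/-- A construction on a cospan. -/
def Cospan (h : ℕ) (A C B f g : Bd) (as : List Bd := []) (i := l0) : Bd :=
  Hd h i lz ([A, C, B, f, g] ++ as)
def Pullback (A C B f g : Bd) (as : List Bd := []) : Bd := Cospan 58 A C B f g as
def pullbackFst (A C B f g : Bd) (as : List Bd := []) : Bd := Cospan 59 A C B f g as
def pullbackSnd (A C B f g : Bd) (as : List Bd := []) : Bd := Cospan 60 A C B f g as
def pullbackPath (A C B f g : Bd) (as : List Bd := []) : Bd := Cospan 61 A C B f g as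
def Join (A C B f g : Bd) (as : List Bd := []) : Bd := Cospan 62 A C B f g as
def joinMap (A C B f g : Bd) (as : List Bd := []) : Bd := Cospan 63 A C B f g as
def Over (B : Bd) (i := l0) : Bd := Hd 68 i lz [B]
def overType (B w : Bd) (i := l0) : Bd := Hd 69 i lz [B, w]
def overMap (B w : Bd) (i := l0) : Bd := Hd 70 i lz [B, w]
def joinPower (A B f n : Bd) (i := l0) : Bd := Hd 71 i lz [A, B, f] ⬝ n
def joinPowerType (A B f n : Bd) (i := l0) : Bd := Hd 72 i lz [A, B, f, n]
def joinPowerMap (A B f n : Bd) (i := l0) : Bd := Hd 73 i lz [A, B, f, n]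
def joinRestrict (A B f n X : Bd) (i := l0) : Bd := Hd 74 i lz [A, B, f, n, X]
def Agree (A B f X h : Bd) (i := l0) : Bd := Hd 75 i lz [A, B, f, X, h]
def Equaliser (A B f X : Bd) (i := l0) : Bd := Hd 76 i lz [A, B, f, X]
def equaliserMap (A B f X : Bd) (i := l0) : Bd := Hd 77 i lz [A, B, f, X]
def Iff (P Q : Bd) (i := l0) : Bd := Hd 78 i lz [P, Q]

def fIsContr := (arg (U l0) fun X => ret (U l0) (Sig X fun x => Pi X fun y => Id X x y)).decl 51
def fIsTruncSubTwo := (ret (Nat' ⇒ U l0 ⇒ U l0)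
  (Hd 8 lu lz [Lam Nat' fun _ => U l0 ⇒ U l0, Hd 51 l0 lz [],
    ELam Nat' fun _ => ELam (U l0 ⇒ U l0) fun h => ELam (U l0) fun X =>
      Pi X fun x => Pi X fun y => h ⬝ Id X x y])).decl 52
def fFib := (arg (U l0) fun A => arg (U l0) fun B => arg (A ⇒ B) fun f => arg B fun b =>
  ret (U l0) (Sig A fun a => Id B (f ⬝ a) b)).decl 53
def fMem := (arg (U l2) fun I => arg (I ⇒ U l0) fun T => arg (U l0) fun Y =>
  ret (U l3) (trunc (Sig I (fun x => Id (U l0) (T ⬝ x) Y lu) l3) l3)).decl 54 true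
def fIsCover := (arg (U l2) fun I => arg (I ⇒ U l0) fun T => arg (U l0) fun A => arg (U l0) fun B =>
  arg (A ⇒ B) fun f => ret (U l3) (Pi B fun b => mem I T (fib A B f b))).decl 55 true
def fTruncFamily := (arg (U l2) fun I => arg (I ⇒ U l0) fun T => arg I fun x =>
  ret (U l0) (trunc (T ⬝ x))).decl 56 true
def fIsSheaf := (arg (U l2) fun I => arg (I ⇒ U l0) fun T => arg (U l0) fun X =>
  ret (U l1) (isEquiv X (Null 27 I (Lam I fun x => truncFamily I T x) X [] l1)
    (Null 28 I (Lam I fun x => truncFamily I T x) X [] l1) l1)).decl 57 true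

def cospanHyp (body : Bd → Bd → Bd → Bd → Bd → Tele) : Tele :=
  arg (U l0) fun A => arg (U l0) fun C => arg (U l0) fun B =>
  arg (A ⇒ B) fun f => arg (C ⇒ B) fun g => body A C B f g

def fPullback := (cospanHyp fun A C B f g =>
  ret (U l0) (Sig A fun a => Sig C fun c => Id B (f ⬝ a) (g ⬝ c))).decl 58
def fPullbackFst := (cospanHyp fun A C B f g => arg (Pullback A C B f g) fun z =>
  ret A (fst A (Lam A fun a => Sig C fun c => Id B (f ⬝ a) (g ⬝ c)) z)).decl 59
def fPullbackSnd := (cospanHyp fun A C B f g => arg (Pullback A C B f g) fun z =>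
  ret C (fst C (Lam C fun c => Id B (f ⬝ pullbackFst A C B f g [z]) (g ⬝ c))
    (snd A (Lam A fun a => Sig C fun c => Id B (f ⬝ a) (g ⬝ c)) z))).decl 60
def fPullbackPath := (cospanHyp fun A C B f g => arg (Pullback A C B f g) fun z =>
  ret (Id B (f ⬝ pullbackFst A C B f g [z]) (g ⬝ pullbackSnd A C B f g [z]))
    (snd C (Lam C fun c => Id B (f ⬝ pullbackFst A C B f g [z]) (g ⬝ c))
    (snd A (Lam A fun a => Sig C fun c => Id B (f ⬝ a) (g ⬝ c)) z))).decl 61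

/-- A constant at the span of a pullback. -/
def atPullback (h : ℕ) (A C B f g : Bd) (as : List Bd) (k := lz) : Bd :=
  Span h A C (Pullback A C B f g) (pullbackFst A C B f g) (pullbackSnd A C B f g) as l0 k

def fJoin := (cospanHyp fun A C B f g => ret (U l0) (atPullback 17 A C B f g [])).decl 62
-- The given `joinMap` applies the abstraction `atPullback` of each pushout constant to the cospan.
-- These four constants denote the same abstractions, so that the erasures agree literally.
def fAtInl := (cospanHyp fun A C B f g => ret (A ⇒ Join A C B f g) (atPullback 18 A C B f g [])).decl 64
def fAtInr := (cospanHyp fun A C B f g => ret (C ⇒ Join A C B f g) (atPullback 19 A C B f g [])).decl 65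
def fAtGlue := (cospanHyp fun A C B f g => ret (Pi (Pullback A C B f g) fun z =>
    Id (Join A C B f g) (atPullback 18 A C B f g [pullbackFst A C B f g [z]])
      (atPullback 19 A C B f g [pullbackSnd A C B f g [z]]))
  (atPullback 20 A C B f g [])).decl 66
def fAtInd := (cospanHyp fun A C B f g => ret (
    Pi (Join A C B f g ⇒ U l0) fun P =>
    Pi (Pi A fun a => P ⬝ atPullback 18 A C B f g [a]) fun l =>
    Pi (Pi C fun c => P ⬝ atPullback 19 A C B f g [c]) fun r =>
    (Pi (Pullback A C B f g) fun z => Id (P ⬝ atPullback 19 A C B f g [pullbackSnd A C B f g [z]])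
      (transport P (atPullback 20 A C B f g [z]) (l ⬝ pullbackFst A C B f g [z])
        (Join A C B f g) (atPullback 18 A C B f g [pullbackFst A C B f g [z]])
        (atPullback 19 A C B f g [pullbackSnd A C B f g [z]]))
      (r ⬝ pullbackSnd A C B f g [z])) ⇒ Pi (Join A C B f g) fun z => P ⬝ z)
  (atPullback 21 A C B f g [] l0)).decl 67
def fJoinMap := (cospanHyp fun A C B f g => ret (Join A C B f g ⇒ B)
  (Cospan 67 A C B f g ⬝ (ELam (Join A C B f g) fun _ => B) ⬝ f ⬝ g ⬝
    ELam (Pullback A C B f g) fun z => pathOverConst (Join A C B f g) B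
      (Cospan 64 A C B f g ⬝ pullbackFst A C B f g [z])
      (Cospan 65 A C B f g ⬝ pullbackSnd A C B f g [z]) (Cospan 66 A C B f g ⬝ z)
      (f ⬝ pullbackFst A C B f g [z]) (g ⬝ pullbackSnd A C B f g [z])
      (pullbackPath A C B f g [z]))).decl 63

def fOver := (arg (U l0) fun B => ret (U lu) (Sig (U l0) (fun Y => Y ⇒ B) lu)).decl 68
def fOverType := (arg (U l0) fun B => arg (Over B) fun w =>
  ret (U l0) (fst (U l0) (Lam (U l0) fun Y => Y ⇒ B) w lu)).decl 69
def fOverMap := (arg (U l0) fun B => arg (Over B) fun w =>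
  ret (overType B w ⇒ B) (snd (U l0) (Lam (U l0) fun Y => Y ⇒ B) w lu)).decl 70
def fJoinPower := (arg (U l0) fun A => arg (U l0) fun B => arg (A ⇒ B) fun f =>
  ret (Nat' ⇒ Over B) (Hd 8 lu lz [Lam Nat' fun _ => Over B,
    mk (U l0) (fun Y => Y ⇒ B) Empty (Hd 1 l0 lz [Lam Empty fun _ => B]) lu,
    ELam Nat' fun _ => ELam (Over B) fun w => mk (U l0) (fun Y => Y ⇒ B)
      (Join A (overType B w) B f (overMap B w)) (joinMap A (overType B w) B f (overMap B w)) lu]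
    )).decl 71

def mapHyp (body : Bd → Bd → Bd → Tele) : Tele :=
  arg (U l0) fun A => arg (U l0) fun B => arg (A ⇒ B) fun f => body A B f

def fJoinPowerType := (mapHyp fun A B f => arg Nat' fun n =>
  ret (U l0) (overType B (joinPower A B f n))).decl 72
def fJoinPowerMap := (mapHyp fun A B f => arg Nat' fun n =>
  ret (joinPowerType A B f n ⇒ B) (overMap B (joinPower A B f n))).decl 73
def fJoinRestrict := (mapHyp fun A B f => arg Nat' fun n => arg (U l0) fun X =>
  ret ((B ⇒ X) ⇒ joinPowerType A B f n ⇒ X)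
    (Lam (B ⇒ X) fun g => Lam (joinPowerType A B f n) fun z =>
      g ⬝ (joinPowerMap A B f n ⬝ z))).decl 74
def fAgree := (mapHyp fun A B f => arg (U l0) fun X => arg (A ⇒ X) fun h =>
  ret (U l0) (Pi (Pullback A A B f f) fun z =>
    Id X (h ⬝ pullbackFst A A B f f [z]) (h ⬝ pullbackSnd A A B f f [z]))).decl 75
def fEqualiser := (mapHyp fun A B f => arg (U l0) fun X =>
  ret (U l0) (Sig (A ⇒ X) fun h => Agree A B f X h)).decl 76
def fEqualiserMap := (mapHyp fun A B f => arg (U l0) fun X =>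
  ret ((B ⇒ X) ⇒ Equaliser A B f X) (Lam (B ⇒ X) fun g =>
    mk (A ⇒ X) (fun h => Agree A B f X h) (Lam A fun a => g ⬝ (f ⬝ a))
      (Lam (Pullback A A B f f) fun z =>
        ap g (pullbackPath A A B f f [z]) B X (f ⬝ pullbackFst A A B f f [z])
          (f ⬝ pullbackSnd A A B f f [z])))).decl 77
def fIff := (arg (U l0) fun P => arg (U l0) fun Q => ret (U l0) (Prod (P ⇒ Q) (Q ⇒ P))).decl 78

def sheafItems : List Item := [
  .s fIsContr, .s fIsTruncSubTwo, .s fFib, .s fMem, .s fIsCover, .s fTruncFamily, .s fIsSheaf,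
  .s fPullback, .s fPullbackFst, .s fPullbackSnd, .s fPullbackPath, .s fJoin, .s fAtInl, .s fAtInr,
  .s fAtGlue, .s fAtInd, .s fJoinMap, .s fOver, .s fOverType, .s fOverMap, .s fJoinPower,
  .s fJoinPowerType, .s fJoinPowerMap, .s fJoinRestrict, .s fAgree, .s fEqualiser,
  .s fEqualiserMap, .s fIff]

end HoTT.Check

/-! ### The argument inside the type theory. -/

namespace HoTT.Check

/-! ## Paths -/

def inv (p : Bd) (i := l0) : Bd := Hd 100 i lz [◦, ◦, ◦, p]
def dInv := (arg (U l0) fun A => arg A fun x => arg A fun y => arg (Id A x y) fun p =>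
  ret (Id A y x) (idInd (Fn fun z => Fn fun _ => Id A z x) (refl A x) p)).decl 100

def trans (p q : Bd) (i := l0) : Bd := Hd 101 i lz [◦, ◦, ◦, ◦, p, q]
def dTrans := (arg (U l0) fun A => arg A fun x => arg A fun y => arg A fun z =>
  arg (Id A x y) fun p => arg (Id A y z) fun q =>
  ret (Id A x z) (idInd (Fn fun z => Fn fun _ => Id A x z) p q)).decl 101

/-- Composition is defined by induction on the second path. The right unit law is therefore
judgemental, and the left one is not. -/
def reflTrans (q : Bd) (i := l0) : Bd := Hd 102 i lz [◦, ◦, ◦, q]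
def dReflTrans := (arg (U l0) fun A => arg A fun x => arg A fun y => arg (Id A x y) fun q =>
  ret (Id (Id A x y) (trans (refl A x) q) q)
    (idInd (Fn fun y => Fn fun q => Id (Id A x y) (trans (refl A x) q) q) (refl) q)).decl 102

/-- `q = (q · s⁻¹) · s` -/
def cancel (q s : Bd) (i := l0) : Bd := Hd 104 i lz [◦, ◦, ◦, ◦, s, q]
def dCancel := (arg (U l0) fun A => arg A fun x => arg A fun z => arg A fun y =>
  arg (Id A z y) fun s => arg (Id A x y) fun q =>
  ret (Id (Id A x y) q (trans (trans q (inv s)) s))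
    (idInd (Fn fun y => Fn fun s => Pi (Id A x y) fun q =>
      Id (Id A x y) q (trans (trans q (inv s)) s)) (Fn fun q => refl) s ⬝ q)).decl 104

/-- From `u = v · k⁻¹` and `K = k` follows `u · K = v`. This is the coherence over a glue path that
the step of the induction on joins requires. -/
def cancelBy (v K e e' : Bd) : Bd := Hd 105 l0 lz [◦, ◦, ◦, ◦, ◦, K, ◦, v, e, e']
def dCancelBy := (arg (U l0) fun A => arg A fun x => arg A fun y => arg A fun z =>
  arg (Id A x z) fun u => arg (Id A z y) fun K => arg (Id A z y) fun k => arg (Id A x y) fun v =>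
  arg (Id (Id A x z) u (trans v (inv k))) fun e => arg (Id (Id A z y) K k) fun e' =>
  ret (Id (Id A x y) (trans u K) v)
    (idInd (Fn fun k => Fn fun _ => Id (Id A x z) u (trans v (inv k)) ⇒ Id (Id A x y) (trans u K) v)
      (Fn fun e => trans (ap (Lam (Id A x z) fun t => trans t K) e) (inv (cancel v K))) e' ⬝ e)
    ).decl 105

def transportBack (P p v : Bd) (i := l0) (k := l0) : Bd := Hd 106 i k [◦, P, ◦, ◦, p, v]
def dTransportBack := (arg (U l0) fun A => arg (A ⇒ U l1) fun P => arg A fun x => arg A fun y =>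
  arg (Id A x y) fun p => arg (P ⬝ y) fun v =>
  ret (Id (P ⬝ y) (transport P p (transport P (inv p) v ◦ ◦ ◦ l0 l1) ◦ ◦ ◦ l0 l1) v l1)
    (idInd (Fn fun y => Fn fun p => Pi (P ⬝ y) fun v =>
      Id (P ⬝ y) (transport P p (transport P (inv p) v ◦ ◦ ◦ l0 l1) ◦ ◦ ◦ l0 l1) v l1)
      (Fn fun v => refl ◦ ◦ l1) p ◦ ◦ ◦ l0 l1 ⬝ v)).decl 106

def pairPath (A B pp p b b' : Bd) : Bd := Hd 107 l0 lz [A, B, pp, ◦, ◦, p, b, b']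
def dPairPath := (arg (U l0) fun A => arg (A ⇒ U l0) fun B =>
  arg (Pi A fun x => Pi (B ⬝ x) fun b => Pi (B ⬝ x) fun b' => Id (B ⬝ x) b b') fun pp =>
  arg A fun a => arg A fun a' => arg (Id A a a') fun p => arg (B ⬝ a) fun b => arg (B ⬝ a') fun b' =>
  ret (Id (sig A B) (pair a b A B) (pair a' b' A B))
    (idInd (Fn fun a' => Fn fun _ => Pi (B ⬝ a') fun b' =>
        Id (sig A B) (pair a b A B) (pair a' b' A B))
      (Fn fun b' => ap (Lam (B ⬝ a) fun b => pair a b A B) (pp ⬝ a ⬝ b ⬝ b')) p ⬝ b')).decl 107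

/-- Elements of a subtype are equal if their first components are. -/
def sigPath (A B pp u v p : Bd) : Bd := Hd 108 l0 lz [A, B, pp, u, v, p]
def dSigPath := (arg (U l0) fun A => arg (A ⇒ U l0) fun B =>
  arg (Pi A fun x => Pi (B ⬝ x) fun b => Pi (B ⬝ x) fun b' => Id (B ⬝ x) b b') fun pp =>
  arg (sig A B) fun u => arg (sig A B) fun v => arg (Id A (fst A B u) (fst A B v)) fun p =>
  ret (Id (sig A B) u v)
    (sigInd (Lam (sig A B) fun u => Id A (fst A B u) (fst A B v) ⇒ Id (sig A B) u v)
      (Fn fun a => Fn fun b =>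
        sigInd (Lam (sig A B) fun v => Id A a (fst A B v) ⇒ Id (sig A B) (pair a b A B) v)
          (Fn fun a' => Fn fun b' => Fn fun p => pairPath A B pp p b b') v) u ⬝ p)).decl 108

def prodPath (A B p q : Bd) : Bd := Hd 109 l0 lz [A, B, ◦, ◦, p, ◦, ◦, q]
def dProdPath := (arg (U l0) fun A => arg (U l0) fun B => arg A fun a => arg A fun a' =>
  arg (Id A a a') fun p => arg B fun b => arg B fun b' => arg (Id B b b') fun q =>
  ret (Id (Prod A B) (mk A (fun _ => B) a b) (mk A (fun _ => B) a' b'))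
    (idInd (Fn fun a' => Fn fun _ => Id (Prod A B) (mk A (fun _ => B) a b) (mk A (fun _ => B) a' b'))
      (ap (Lam B fun b => mk A (fun _ => B) a b) q) p)).decl 109

/-! ## Equivalences -/

def eqInv (e y : Bd) (i := l0) : Bd := Hd 110 i lz [◦, ◦, ◦, e, y]
def eqHyp (body : Bd → Bd → Bd → Bd → Tele) : Tele :=
  arg (U l0) fun A => arg (U l0) fun B => arg (A ⇒ B) fun f => arg (isEquiv A B f) fun e =>
  body A B f e
def dEqInv := (eqHyp fun A B f e => arg B fun y => ret A (fst ◦ ◦ (fst ◦ ◦ e) ⬝ y)).decl 110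

def eqSec (e y : Bd) (i := l0) : Bd := Hd 111 i lz [◦, ◦, ◦, e, y]
def dEqSec := (eqHyp fun A B f e => arg B fun y => ret (Id B (f ⬝ eqInv e y) y)
  (snd ◦ ◦ (fst ◦ ◦ e) ⬝ y)).decl 111

/-- The inverse `g` is the component that is a right inverse. With `h` the left inverse, `g (f x) =
h (f (g (f x))) = h (f x) = x`. -/
def eqRet (e x : Bd) (i := l0) : Bd := Hd 112 i lz [◦, ◦, ◦, e, x]
def dEqRet := (eqHyp fun A B f e => arg A fun x => ret (Id A (eqInv e (f ⬝ x)) x)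
  (trans (trans (inv (snd ◦ ◦ (snd ◦ ◦ e) ⬝ eqInv e (f ⬝ x)))
    (ap (fst ◦ ◦ (snd ◦ ◦ e)) (eqSec e (f ⬝ x)))) (snd ◦ ◦ (snd ◦ ◦ e) ⬝ x))).decl 112

def mkEquiv (A B f g r s : Bd) (i := l0) : Bd := Hd 113 i lz [A, B, f, g, r, s]
def dMkEquiv := (arg (U l0) fun A => arg (U l0) fun B => arg (A ⇒ B) fun f => arg (B ⇒ A) fun g =>
  arg (Pi B fun b => Id B (f ⬝ (g ⬝ b)) b) fun r => arg (Pi A fun a => Id A (g ⬝ (f ⬝ a)) a) fun s =>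
  ret (isEquiv A B f) (pair (pair g r) (pair g s))).decl 113

def funext (h : Bd) (A := ◦) (B := ◦) (f := ◦) (g := ◦) (i := l0) : Bd := Hd 114 i lz [A, B, f, g, h]
def funHyp (body : Bd → Bd → Bd → Bd → Tele) : Tele :=
  arg (U l0) fun A => arg (A ⇒ U l0) fun B => arg (Pi A fun x => B ⬝ x) fun f =>
  arg (Pi A fun x => B ⬝ x) fun g => body A B f g
def dFunext' := (funHyp fun A B f g => arg (Pi A fun x => Id (B ⬝ x) (f ⬝ x) (g ⬝ x)) fun h =>
  ret (Id (Pi A fun x => B ⬝ x) f g) (eqInv (funextC A B f g) h)).decl 114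

def happlyFunext (A B f g h : Bd) (i := l0) : Bd := Hd 115 i lz [A, B, f, g, h]
def dHapplyFunext := (funHyp fun A B f g =>
  arg (Pi A fun x => Id (B ⬝ x) (f ⬝ x) (g ⬝ x)) fun h =>
  ret (Id (Pi A fun x => Id (B ⬝ x) (f ⬝ x) (g ⬝ x)) (happly A B f g (funext h A B f g)) h)
    (eqSec (funextC A B f g) h)).decl 115

def funextRefl (A B f : Bd) (i := l0) : Bd := Hd 116 i lz [A, B, f]
def dFunextRefl := (arg (U l0) fun A => arg (A ⇒ U l0) fun B => arg (Pi A fun x => B ⬝ x) fun f =>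
  ret (Id (Id (Pi A fun x => B ⬝ x) f f) (funext (Lam A fun x => refl (B ⬝ x) (f ⬝ x)) A B f f)
    (refl (Pi A fun x => B ⬝ x) f)) (eqRet (funextC A B f f) (refl (Pi A fun x => B ⬝ x) f))).decl 116

/-- Induction over all equivalences out of `A`. -/
def eqvInd (P d f e : Bd) (i := l0) (k := l0) : Bd := Hd 117 i k [◦, P, d, ◦, f, e]
def dEqvInd := (arg (U l0) fun A => arg (Pi (U l0) fun B => (A ⇒ B) ⇒ U l1) fun P =>
  arg (P ⬝ A ⬝ Lam A fun x => x) fun d => arg (U l0) fun B => arg (A ⇒ B) fun f =>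
  arg (isEquiv A B f) fun e =>
  let F (C w : Bd) := fst (A ⇒ C) (Lam (A ⇒ C) fun f => isEquiv A C f) w
  let w := mk (A ⇒ B) (fun f => isEquiv A B f) f e
  ret (P ⬝ B ⬝ f)
    -- Univalence turns the equivalence into a path in the universe, path induction applies to it,
    -- and the result is carried back along the section homotopy.
    (transport (Lam (Equiv A B) fun w => P ⬝ B ⬝ F B w) (eqSec (univalence A B) w lu)
      (idInd (Fn fun C => Fn fun p => P ⬝ C ⬝ F C (idToEquiv A C p)) d
        (eqInv (univalence A B) w lu) ◦ ◦ ◦ lu l1) ◦ ◦ ◦ lu l1)).decl 117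

def Retr (A B y : Bd) : Bd := Sig (A ⇒ B) fun g => Pi A fun a => Id B (g ⬝ a) (y ⬝ a)

/-- The type of maps with a homotopy to the identity is contractible. By function extensionality the
homotopy may be replaced by the one that comes from a path of functions, on which path induction
applies. -/
def retrContr (A w : Bd) : Bd := Hd 118 l0 lz [A, w]
def dRetrContr := (arg (U l0) fun A => 
  let i := Lam A fun x => x
  arg (Retr A A i) fun w =>
  let R (y : Bd) := Retr A A y
  ret (Id (R i) w (mk (A ⇒ A) (fun g => Pi A fun a => Id A (g ⬝ a) a) i (Lam A fun a => refl A a)))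
    (sigInd (Lam (R i) fun w => Id (R i) w
        (mk (A ⇒ A) (fun g => Pi A fun a => Id A (g ⬝ a) a) i (Lam A fun a => refl A a)))
      (Fn fun g => Fn fun h =>
        transport (Lam (Pi A fun a => Id A (g ⬝ a) a) fun h => Id (R i)
            (mk (A ⇒ A) (fun g => Pi A fun a => Id A (g ⬝ a) a) g h)
            (mk (A ⇒ A) (fun g => Pi A fun a => Id A (g ⬝ a) a) i (Lam A fun a => refl A a)))
          (happlyFunext A (Lam A fun _ => A) g i h)
          (idInd (Fn fun y => Fn fun p => Id (R y)
              (mk (A ⇒ A) (fun g => Pi A fun a => Id A (g ⬝ a) (y ⬝ a)) g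
                (happly A (Lam A fun _ => A) g y p))
              (mk (A ⇒ A) (fun g => Pi A fun a => Id A (g ⬝ a) (y ⬝ a)) y
                (Lam A fun a => refl A (y ⬝ a))))
            (refl) (funext h A (Lam A fun _ => A) g i))) w)).decl 118

def idEq (A : Bd) : Bd :=
  let i : Bd := Lam A fun x => x
  let r : Bd := mk (A ⇒ A) (fun g => Pi A fun a => Id A (g ⬝ a) a) i (Lam A fun a => refl A a)
  mk (Retr A A i) (fun _ => Retr A A i) r r

/-- Induction over equivalences reduces to the identity map. There both components of `isEquiv` are
elements of the contractible type `Retr A A i`. -/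
def isPropEquiv (e e' : Bd) (i := l0) : Bd := Hd 119 i lz [◦, ◦, ◦, e, e']
def dIsPropEquiv := (eqHyp fun A B f e => arg (isEquiv A B f) fun e' =>
  ret (Id (isEquiv A B f) e e')
    (eqvInd (Fn fun B => Fn fun f => Pi (isEquiv A B f) fun e => Pi (isEquiv A B f) fun e' =>
        Id (isEquiv A B f) e e')
      (let i := Lam A fun x => x
       let R := Retr A A i
       let q (e : Bd) (k : Bd → Bd) : Bd :=
          sigInd (Lam (isEquiv A A i) fun e => Id (isEquiv A A i) e 
              (idEq A))
            (Fn fun u => Fn fun v => prodPath R R (retrContr A u) (retrContr A v)) e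
       Fn fun e => Fn fun e' => trans (q e id) (inv (q e' id)))
      f e ⬝ e ⬝ e')).decl 119
-- Transparency matters: inverses and composites of paths must compute on reflexivity, and inverses
-- of equivalences must unfold. Propositions used only through their statements are opaque.
def pathItems : List Item := [
  .f dInv, .f dTrans, .t dReflTrans, .f dCancel, .t dCancelBy, .t dTransportBack,
  .t dPairPath, .t dSigPath, .t dProdPath, .f dEqInv, .t dEqSec, .t dEqRet, .f dMkEquiv, .f dFunext',
  .t dHapplyFunext, .t dFunextRefl, .t dEqvInd, .t dRetrContr, .t dIsPropEquiv]

end HoTT.Check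

namespace HoTT.Check

/-! ## Composition of equivalences -/

def isEquivId (A : Bd) (i := l0) : Bd := Hd 120 i lz [A]
def dIsEquivId := (arg (U l0) fun A => ret (isEquiv A A (Lam A fun x => x))
  (mkEquiv A A (Lam A fun x => x) (Lam A fun x => x) (Lam A fun x => refl A x)
    (Lam A fun x => refl A x))).decl 120

def isEquivComp (f g e e' : Bd) (i := l0) : Bd := Hd 121 i lz [◦, ◦, ◦, f, g, e, e']
def compHyp (body : Bd → Bd → Bd → Bd → Bd → Tele) : Tele :=
  arg (U l0) fun A => arg (U l0) fun B => arg (U l0) fun C => arg (A ⇒ B) fun f =>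
  arg (B ⇒ C) fun g => body A B C f g
def comp (A f g : Bd) : Bd := Lam A fun x => g ⬝ (f ⬝ x)
def dIsEquivComp := (compHyp fun A B C f g => arg (isEquiv A B f) fun e =>
  arg (isEquiv B C g) fun e' => ret (isEquiv A C (comp A f g))
    (eqvInd (Fn fun C => Fn fun g => isEquiv A C (comp A f g)) e g e')).decl 121

def cancelLeft (f g e e' : Bd) (i := l0) : Bd := Hd 122 i lz [◦, ◦, ◦, f, g, e, e']
def dCancelLeft := (compHyp fun A B C f g => arg (isEquiv B C g) fun e =>
  arg (isEquiv A C (comp A f g)) fun e' => ret (isEquiv A B f)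
    (eqvInd (Fn fun C => Fn fun g => isEquiv A C (comp A f g) ⇒ isEquiv A B f) (Fn fun e => e)
      g e ⬝ e')).decl 122

def isEquivHtpy (A B f g h e : Bd) (i := l0) : Bd := Hd 124 i lz [A, B, f, g, h, e]
def dIsEquivHtpy := (arg (U l0) fun A => arg (U l0) fun B => arg (A ⇒ B) fun f =>
  arg (A ⇒ B) fun g => arg (Pi A fun x => Id B (f ⬝ x) (g ⬝ x)) fun h =>
  arg (isEquiv A B f) fun e => ret (isEquiv A B g)
    (transport (Lam (A ⇒ B) fun f => isEquiv A B f) (funext h A (Lam A fun _ => B) f g) e)).decl 124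

/-- By induction over equivalences it suffices to treat the identity, whose action on paths is
homotopic to the identity. -/
def isEquivAp (f e x y : Bd) : Bd := Hd 125 l0 lz [◦, ◦, f, e, x, y]
def dIsEquivAp := (eqHyp fun A B f e => arg A fun x => arg A fun y =>
  let T (B f : Bd) : Bd := isEquiv (Id A x y) (Id B (f ⬝ x) (f ⬝ y)) (Lam (Id A x y) fun p => ap f p)
  ret (T B f) (eqvInd (Fn fun B => Fn fun f => T B f)
    (isEquivHtpy (Id A x y) (Id A x y) (Lam (Id A x y) fun p => p)
      (Lam (Id A x y) fun p => ap (Lam A fun x => x) p)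
      (Fn fun p => idInd (Fn fun y => Fn fun p => Id (Id A x y) p (ap (Lam A fun x => x) p))
        refl p) (isEquivId (Id A x y))) f e)).decl 125

/-! ## Local types -/

/-- The map to the constant functions. -/
def Const (P X : Bd) : Bd := Lam X fun x => Lam P fun _ => x
def Local (P X : Bd) (i := l0) : Bd := isEquiv X (P ⇒ X) (Const P X) i

def postEquiv (P X K c h : Bd) (i := l0) : Bd := Hd 126 i lz [P, X, K, c, h]
def postHyp (body : Bd → Bd → Bd → Bd → Tele) : Tele :=
  arg (U l0) fun P => arg (U l0) fun X => arg (U l0) fun K => arg (X ⇒ K) fun c => body P X K c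
def dPostEquiv := (postHyp fun P X K c => arg (P ⇒ isEquiv X K c) fun h =>
  ret (isEquiv (P ⇒ X) (P ⇒ K) (Lam (P ⇒ X) fun u => Lam P fun p => c ⬝ (u ⬝ p)))
    (mkEquiv (P ⇒ X) (P ⇒ K) ◦ (Lam (P ⇒ K) fun k => Lam P fun p => eqInv (h ⬝ p) (k ⬝ p))
      (Fn fun k => funext (Fn fun p => eqSec (h ⬝ p) (k ⬝ p)))
      (Fn fun u => funext (Fn fun p => eqRet (h ⬝ p) (u ⬝ p))))).decl 126

/-- A type that is equivalent to a local type is local. -/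
def localOfEquiv (P X K c e l : Bd) (i := l0) : Bd := Hd 127 i lz [P, X, K, c, e, l]
def dLocalOfEquiv := (postHyp fun P X K c => arg (isEquiv X K c) fun e => arg (Local P K) fun l =>
  ret (Local P X)
    (eqvInd (Fn fun K => Fn fun c => Local P K ⇒ Local P X) (Fn fun l => l) c e ⬝ l)).decl 127

/-- A map of local types that is an equivalence if `P` holds is an equivalence. -/
def equivOfLocal (P X K c h l l' : Bd) (i := l0) : Bd := Hd 128 i lz [P, X, K, c, h, l, l']
def dEquivOfLocal := (postHyp fun P X K c => arg (P ⇒ isEquiv X K c) fun h =>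
  arg (Local P X) fun l => arg (Local P K) fun l' => ret (isEquiv X K c)
    -- Both composites from `X` to `P → K` agree judgementally. Constant functions followed by
    -- composition with `c` is an equivalence, and so is the last map of the other composite; it can
    -- be cancelled.
    (cancelLeft c (Const P K) l'
      (isEquivComp (Const P X) (Lam (P ⇒ X) fun u => Lam P fun p => c ⬝ (u ⬝ p)) l
        (postEquiv P X K c h)))).decl 128

/-- Equality in a local type may be proved under the hypothesis `P`. -/
def localSep (P X l x y h : Bd) (i := l0) : Bd := Hd 129 i lz [P, X, l, x, y, h]
def localHyp (body : Bd → Bd → Bd → Bd → Bd → Tele) : Tele :=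
  arg (U l0) fun P => arg (U l0) fun X => arg (Local P X) fun l => arg X fun x => arg X fun y =>
  body P X l x y
def dLocalSep := (localHyp fun P X l x y => arg (P ⇒ Id X x y) fun h => ret (Id X x y)
  (trans (inv (eqRet l x))
    (trans (ap (Lam (P ⇒ X) fun u => eqInv l u)
      (funext (Fn fun p => h ⬝ p) P (Lam P fun _ => X) (Lam P fun _ => x) (Lam P fun _ => y)))
      (eqRet l y)))).decl 129

/-- The constant-function map of `x = y` is homotopic to the action on paths of the one of `X`, an
equivalence, followed by `happly`, an equivalence by function extensionality. -/
def localId (P X l x y : Bd) (i := l0) : Bd := Hd 130 i lz [P, X, l, x, y]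
def dLocalId := (localHyp fun P X l x y =>
  let I : Bd := Id X x y
  let J : Bd := Id (P ⇒ X) (Lam P fun _ => x) (Lam P fun _ => y)
  let H (y p : Bd) : Bd := happly P (Lam P fun _ => X) (Lam P fun _ => x) (Lam P fun _ => y)
    (ap (Const P X) p X (P ⇒ X) x y)
  ret (Local P I)
    (isEquivHtpy I (P ⇒ I) (Lam I fun p => H y p) (Const P I)
      (Fn fun p => idInd (Fn fun y => Fn fun p => Id (P ⇒ Id X x y) (H y p) (Lam P fun _ => p))
        (refl (P ⇒ Id X x x) (Lam P fun _ => refl X x)) p)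
      (isEquivComp (Lam I fun p => ap (Const P X) p X (P ⇒ X) x y)
        (Lam J fun q => happly P (Lam P fun _ => X) (Lam P fun _ => x) (Lam P fun _ => y) q)
        (isEquivAp (Const P X) l x y)
        (funextC P (Lam P fun _ => X) (Lam P fun _ => x) (Lam P fun _ => y))))).decl 130

/-- The type of functions from types over `b` to `X` is local for propositions that hold if these
types are inhabited. -/
def localFun (P Z R X pp s : Bd) : Bd := Hd 131 l0 lz [P, Z, R, X, pp, s]
def dLocalFun := (arg (U l0) fun P => arg (U l0) fun Z => arg (Z ⇒ U l0) fun R => arg (U l0) fun X =>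
  arg (Pi P fun p => Pi P fun q => Id P p q) fun pp => arg (Pi Z fun z => R ⬝ z ⇒ P) fun s =>
  let K : Bd := Pi Z fun z => R ⬝ z ⇒ X
  ret (Local P K)
    -- An argument `r` of the functions in question itself provides the proof of `P` at which a
    -- family `k` is evaluated.
    (mkEquiv K (P ⇒ K) ◦ (Lam (P ⇒ K) fun k => Lam Z fun z => Lam (R ⬝ z) fun r =>
        k ⬝ (s ⬝ z ⬝ r) ⬝ z ⬝ r)
      (Fn fun k => funext (Fn fun p => funext (Fn fun z => funext (Fn fun r =>
        ap (Lam P fun p => k ⬝ p ⬝ z ⬝ r) (pp ⬝ (s ⬝ z ⬝ r) ⬝ p)))))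
      (Fn fun k => funext (Fn fun z => funext (Fn fun r => refl))))).decl 131

/-- Induction on a propositional truncation, into a proposition. -/
def truncRec (Q pp h x : Bd) (i := l0) (k := l0) : Bd := Hd 132 i k [◦, Q, pp, h, x]
def dTruncRec := (arg (U l0) fun A => arg (U l1) fun Q =>
  arg (Pi Q fun p => Pi Q fun q => Id Q p q l1) fun pp => arg (A ⇒ Q) fun h => arg (trunc A) fun x =>
  ret Q (truncInd (Lam (trunc A) fun _ => Q) h (Fn fun x => Fn fun y => Fn fun u => Fn fun v =>
    pp ⬝ transport (Lam (trunc A) fun _ => Q) (squash x y) u ◦ ◦ ◦ l0 l1 ⬝ v) x ◦ l0 l1)).decl 132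

def equivItems : List Item := [.t dIsEquivId, .t dIsEquivComp, .t dCancelLeft,
  .t dIsEquivHtpy, .t dIsEquivAp, .t dPostEquiv, .t dLocalOfEquiv, .t dEquivOfLocal, .t dLocalSep,
  .t dLocalId, .t dLocalFun, .t dTruncRec]

end HoTT.Check

namespace HoTT.Check

/-! ## Joins -/

def jinl (A C B f g a : Bd) : Bd := atPullback 18 A C B f g [a]
def jinr (A C B f g c : Bd) : Bd := atPullback 19 A C B f g [c]
def mkPullback (A C B f g a c p : Bd) : Bd :=
  mk A (fun a => Sig C fun c => Id B (f ⬝ a) (g ⬝ c)) a (mk C (fun c => Id B (f ⬝ a) (g ⬝ c)) c p)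
def jglue (A C B f g a c p : Bd) : Bd := atPullback 20 A C B f g [mkPullback A C B f g a c p]

/-- Pushout induction with the points of the pullback split into `a`, `c` and a path `f a = g c`. -/
def joinInd (A C B f g Q l r h z : Bd) : Bd := Hd 133 l0 lz [A, C, B, f, g, Q, l, r, h, z]
def dJoinInd := (cospanHyp fun A C B f g => arg (Join A C B f g ⇒ U l0) fun Q =>
  arg (Pi A fun a => Q ⬝ jinl A C B f g a) fun l => arg (Pi C fun c => Q ⬝ jinr A C B f g c) fun r =>
  arg (Pi A fun a => Pi C fun c => Pi (Id B (f ⬝ a) (g ⬝ c)) fun p =>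
    Id (Q ⬝ jinr A C B f g c) (transport Q (jglue A C B f g a c p) (l ⬝ a)) (r ⬝ c)) fun h =>
  arg (Join A C B f g) fun z => ret (Q ⬝ z)
    (let G (z : Bd) := Id (Q ⬝ jinr A C B f g (pullbackSnd A C B f g [z]))
        (transport Q (atPullback 20 A C B f g [z]) (l ⬝ pullbackFst A C B f g [z]))
        (r ⬝ pullbackSnd A C B f g [z])
     atPullback 21 A C B f g [Q, l, r, Lam (Pullback A C B f g) fun z =>
      sigInd (Lam (Pullback A C B f g) fun z => G z) (Fn fun a => Fn fun w =>
        sigInd (Lam (Sig C fun c => Id B (f ⬝ a) (g ⬝ c)) fun w =>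
          G (mk A (fun a => Sig C fun c => Id B (f ⬝ a) (g ⬝ c)) a w))
          (Fn fun c => Fn fun p => h ⬝ a ⬝ c ⬝ p) w) z, z] l0)).decl 133

/-- The action of the join map on a glue path is the path over which it was glued. This is the one
place where the path computation rule of pushouts enters. -/
def joinGlue (A C B f g a c p : Bd) : Bd := Hd 134 l0 lz [A, C, B, f, g, a, c, p]
def dJoinGlue := (cospanHyp fun A C B f g => arg A fun a => arg C fun c =>
  arg (Id B (f ⬝ a) (g ⬝ c)) fun p =>
  let J := Join A C B f g
  ret (Id (Id B (transport (Lam J fun _ => B) (jglue A C B f g a c p) (f ⬝ a)) (g ⬝ c))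
      (apd J (Lam J fun _ => B) (joinMap A C B f g) (jinl A C B f g a) (jinr A C B f g c)
        (jglue A C B f g a c p))
      (pathOverConst J B (jinl A C B f g a) (jinr A C B f g c) (jglue A C B f g a c p) (f ⬝ a) (g ⬝ c)
        p))
    (Span 22 A C (Pullback A C B f g) (pullbackFst A C B f g) (pullbackSnd A C B f g)
      [Lam J fun _ => B, f, g, Lam (Pullback A C B f g) fun z => pathOverConst J B
        (jinl A C B f g (pullbackFst A C B f g [z])) (jinr A C B f g (pullbackSnd A C B f g [z]))
        (atPullback 20 A C B f g [z])
        (f ⬝ pullbackFst A C B f g [z]) (g ⬝ pullbackSnd A C B f g [z])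
        (pullbackPath A C B f g [z]), mkPullback A C B f g a c p] l0 l0)).decl 134

/-- Transport in the fibres of a map. -/
def fibTransport (Z B w b γ s e r q h : Bd) : Bd := Hd 135 l0 lz [Z, B, w, b, ◦, ◦, γ, s, e, r, q, h]
def dFibTransport := (arg (U l0) fun Z => arg (U l0) fun B => arg (Z ⇒ B) fun w => arg B fun b =>
  arg Z fun z => arg Z fun z' => arg (Id Z z z') fun γ =>
  let D := Lam Z fun z => Id B (w ⬝ z) b
  let T (z' γ s : Bd) := Id (Id B (transport (Lam Z fun _ => B) γ (w ⬝ z)) (w ⬝ z'))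
    (apd Z (Lam Z fun _ => B) w z z' γ) (pathOverConst Z B z z' γ (w ⬝ z) (w ⬝ z') s)
  let R (z' γ s r q : Bd) := Id (Id B (w ⬝ z') b) (transport D γ q) r
  arg (Id B (w ⬝ z) (w ⬝ z')) fun s => arg (T z' γ s) fun e => arg (Id B (w ⬝ z') b) fun r =>
  arg (Id B (w ⬝ z) b) fun q => arg (Id (Id B (w ⬝ z) b) q (trans s r)) fun h =>
  ret (R z' γ s r q)
    (idInd (Fn fun z' => Fn fun γ => Pi (Id B (w ⬝ z) (w ⬝ z')) fun s => T z' γ s ⇒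
        Pi (Id B (w ⬝ z') b) fun r => Id (Id B (w ⬝ z) b) q (trans s r) ⇒ R z' γ s r q)
      (Fn fun s => Fn fun e => Fn fun r => Fn fun h =>
        trans h (idInd (Lam (Id B (w ⬝ z) (w ⬝ z)) fun s => Fn fun _ =>
            Id (Id B (w ⬝ z) b) (trans s r) r) (reflTrans r) e (Id B (w ⬝ z) (w ⬝ z)) ◦ s))
      γ ⬝ s ⬝ e ⬝ r ⬝ h)).decl 135

def famHyp (body : Bd → Bd → Bd → Bd → Bd → Bd → Bd → Tele) : Tele :=
  arg (U l0) fun Z => arg (Z ⇒ U l0) fun D => arg (U l0) fun X =>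
  arg (Pi Z fun z => D ⬝ z ⇒ X) fun k => arg Z fun z => arg Z fun z' => arg (Id Z z z') fun γ =>
  body Z D X k z z' γ

def famPath (Z D X k z z' γ q r h : Bd) : Bd := Hd 136 l0 lz [Z, D, X, k, z, z', γ, q, r, h]
def dFamPath := (famHyp fun Z D X k z z' γ => arg (D ⬝ z) fun q => arg (D ⬝ z') fun r =>
  arg (Id (D ⬝ z') (transport D γ q) r) fun h => ret (Id X (k ⬝ z ⬝ q) (k ⬝ z' ⬝ r))
    (idInd (Fn fun z' => Fn fun γ => Pi (D ⬝ z') fun r => Id (D ⬝ z') (transport D γ q) r ⇒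
        Id X (k ⬝ z ⬝ q) (k ⬝ z' ⬝ r))
      (Fn fun r => Fn fun h => ap (k ⬝ z) h (D ⬝ z) X q r) γ ⬝ r ⬝ h)).decl 136

/-- An equation in a family of functions `Π q, x = k z q` over a path is checked pointwise. Every
`r` in the final fibre is the transport of `φ r`, and path induction on that identification reduces
the claim to the hypothesis. -/
def famTransport (Z D X k z z' γ x u v φ θ h : Bd) : Bd :=
  Hd 137 l0 lz [Z, D, X, k, z, z', γ, x, u, v, φ, θ, h]
def dFamTransport := (famHyp fun Z D X k z z' γ => arg X fun x =>
  let Q := Lam Z fun z => Pi (D ⬝ z) fun q => Id X x (k ⬝ z ⬝ q)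
  let Θ (z' γ φ : Bd) := Pi (D ⬝ z') fun r => Id (D ⬝ z') (transport D γ (φ ⬝ r)) r
  let H (u z' γ v φ θ : Bd) := Pi (D ⬝ z') fun r => Id (Id X x (k ⬝ z' ⬝ r))
    (trans (u ⬝ (φ ⬝ r)) (famPath Z D X k z z' γ (φ ⬝ r) r (θ ⬝ r))) (v ⬝ r)
  let R (u z' γ v : Bd) := Id (Q ⬝ z') (transport Q γ u) v
  arg (Q ⬝ z) fun u => arg (Q ⬝ z') fun v =>
  arg (D ⬝ z' ⇒ D ⬝ z) fun φ => arg (Θ z' γ φ) fun θ => arg (H u z' γ v φ θ) fun h =>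
  ret (R u z' γ v)
    (idInd (Fn fun z' => Fn fun γ => Pi (Q ⬝ z') fun v => Pi (D ⬝ z' ⇒ D ⬝ z) fun φ =>
        Pi (Θ z' γ φ) fun θ => H u z' γ v φ θ ⇒ R u z' γ v)
      (Fn fun v => Fn fun φ => Fn fun θ => Fn fun h => funext (Fn fun r =>
        idInd (Lam (D ⬝ z) fun y => Lam (Id (D ⬝ z) (φ ⬝ r) y) fun e =>
            Pi (Id X x (k ⬝ z ⬝ y)) fun v => Id (Id X x (k ⬝ z ⬝ y))
              (trans (u ⬝ (φ ⬝ r)) (famPath Z D X k z z (refl Z z) (φ ⬝ r) y e)) v ⇒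
            Id (Id X x (k ⬝ z ⬝ y)) (u ⬝ y) v)
          (Fn fun v => Fn fun h => h) (θ ⬝ r) (D ⬝ z) (φ ⬝ r) r ⬝ (v ⬝ r) ⬝ (h ⬝ r))
        (D ⬝ z) (Lam (D ⬝ z) fun q => Id X x (k ⬝ z ⬝ q)) u v)
      γ ⬝ v ⬝ φ ⬝ θ ⬝ h)).decl 137

/-- A function on the fibres of a join over `b` takes equal values on fibres over `a` and `c`. -/
def joinPath (A C B f g b X k a c p q s h : Bd) : Bd :=
  Hd 138 l0 lz [A, C, B, f, g, b, X, k, a, c, p, q, s, h]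
def joinFun (A C B f g b X : Bd) : Bd :=
  Pi (Join A C B f g) fun z => Id B (joinMap A C B f g ⬝ z) b ⇒ X
def joinFib (A C B f g b : Bd) : Bd :=
  Lam (Join A C B f g) fun z => Id B (joinMap A C B f g ⬝ z) b
def dJoinPath := (cospanHyp fun A C B f g => arg B fun b => arg (U l0) fun X =>
  arg (joinFun A C B f g b X) fun k => arg A fun a => arg C fun c =>
  arg (Id B (f ⬝ a) (g ⬝ c)) fun p => arg (Id B (f ⬝ a) b) fun q => arg (Id B (g ⬝ c) b) fun s =>
  arg (Id (Id B (f ⬝ a) b) q (trans p s)) fun h =>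
  ret (Id X (k ⬝ jinl A C B f g a ⬝ q) (k ⬝ jinr A C B f g c ⬝ s))
    (famPath (Join A C B f g) (joinFib A C B f g b) X k (jinl A C B f g a) (jinr A C B f g c)
      (jglue A C B f g a c p) q s (fibTransport (Join A C B f g) B (joinMap A C B f g) b
        (jglue A C B f g a c p) p (joinGlue A C B f g a c p) s q h))).decl 138

def joinPath' (A C B f g b X k a c q s : Bd) : Bd :=
  joinPath A C B f g b X k a c (trans q (inv s)) q s (cancel q s)

/-- The pairs of a path `p` and an identification `q = p · s` form a contractible type, so the
induced path does not depend on the choice. After `s` becomes reflexivity, `h` identifies `q` with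
`p`, and both sides compute to the same term. -/
def joinPathUnique (A C B f g b X k a c p q s h : Bd) : Bd :=
  Hd 139 l0 lz [A, C, B, f, g, b, X, k, a, c, p, q, s, h]
def dJoinPathUnique := (cospanHyp fun A C B f g => arg B fun b => arg (U l0) fun X =>
  arg (joinFun A C B f g b X) fun k => arg A fun a => arg C fun c =>
  arg (Id B (f ⬝ a) (g ⬝ c)) fun p => arg (Id B (f ⬝ a) b) fun q => arg (Id B (g ⬝ c) b) fun s =>
  arg (Id (Id B (f ⬝ a) b) q (trans p s)) fun h =>
  let T (b k p q s h : Bd) := Id (Id X (k ⬝ jinl A C B f g a ⬝ q) (k ⬝ jinr A C B f g c ⬝ s))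
    (joinPath A C B f g b X k a c p q s h) (joinPath' A C B f g b X k a c q s)
  ret (T b k p q s h)
    (idInd (Fn fun b => Fn fun s => Pi (joinFun A C B f g b X) fun k =>
        Pi (Id B (f ⬝ a) (g ⬝ c)) fun p => Pi (Id B (f ⬝ a) b) fun q =>
        Pi (Id (Id B (f ⬝ a) b) q (trans p s)) fun h => T b k p q s h)
      (Fn fun k => Fn fun p => Fn fun q => Fn fun h =>
        idInd (Lam (Id B (f ⬝ a) (g ⬝ c)) fun p => Fn fun h => T (g ⬝ c) k p q (refl B (g ⬝ c)) h)
          refl h (Id B (f ⬝ a) (g ⬝ c)) q p)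
      s ⬝ k ⬝ p ⬝ q ⬝ h)).decl 139

/-- If identity types of `X` are equivalent to functions on fibres of `g`, and `f` has a fibre,
then `X` is equivalent to functions on fibres of the join. -/
def joinStep (A C B f g b X H a p : Bd) : Bd := Hd 140 l0 lz [A, C, B, f, g, b, X, H, a, p]
def fibFun (Z B w b X : Bd) : Bd := Pi Z fun z => Id B (w ⬝ z) b ⇒ X
def fibConst (Z B w b X : Bd) : Bd := Lam X fun x => Lam Z fun z => Lam (Id B (w ⬝ z) b) fun _ => x
def dJoinStep := (cospanHyp fun A C B f g => arg B fun b => arg (U l0) fun X =>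
  arg (Pi X fun x => Pi X fun y => isEquiv (Id X x y) (fibFun C B g b (Id X x y))
    (fibConst C B g b (Id X x y))) fun H =>
  arg A fun a => arg (Id B (f ⬝ a) b) fun p =>
  let J : Bd := Join A C B f g
  let w : Bd := joinMap A C B f g
  let K : Bd := fibFun J B w b X
  let G (k a q c s : Bd) : Bd := joinPath' A C B f g b X k a c q s
  let x (k : Bd) : Bd := k ⬝ jinl A C B f g a ⬝ p
  let y (k a q : Bd) : Bd := k ⬝ jinl A C B f g a ⬝ q
  -- The inverse evaluates at the given point `(a, p)`. A path from that value to the value at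
  -- another point `(a', q)` is specified by its candidates: for each point `(c, s)` of the fibre of
  -- `g`, go up one glue path and back along another. The equivalence `H` turns this family into a
  -- single path `u`.
  let E (k a' q : Bd) : Bd := Lam C fun c => Lam (Id B (g ⬝ c) b) fun s =>
    trans (G k a p c s) (inv (G k a' q c s))
  let u (k a' q : Bd) : Bd := eqInv (H ⬝ x k ⬝ y k a' q) (E k a' q)
  ret (isEquiv X K (fibConst J B w b X))
    (mkEquiv X K ◦ (Lam K fun k => x k) (Fn fun k => funext (Fn fun z => funext (
      joinInd A C B f g (Lam J fun z => Pi (Id B (w ⬝ z) b) fun q => Id X (x k) (k ⬝ z ⬝ q))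
        (Fn fun a' => Fn fun q => u k a' q) (Fn fun c => Fn fun s => G k a p c s)
        (Fn fun a' => Fn fun c => Fn fun r =>
          -- Over a glue path `r : f a' = g c`, every point `s` of the fibre over `c` corresponds to
          -- `r · s` over `a'`.
          famTransport J (joinFib A C B f g b) X k (jinl A C B f g a') (jinr A C B f g c)
            (jglue A C B f g a' c r) (x k) (Lam (Id B (f ⬝ a') b) fun q => u k a' q)
            (Lam (Id B (g ⬝ c) b) fun s => G k a p c s) (Lam (Id B (g ⬝ c) b) fun s => trans r s)
            (Lam (Id B (g ⬝ c) b) fun s => fibTransport J B w b (jglue A C B f g a' c r) r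
              (joinGlue A C B f g a' c r) s (trans r s) (refl (Id B (f ⬝ a') b) (trans r s)))
            (Lam (Id B (g ⬝ c) b) fun s => 
              let q : Bd := trans r s
              let I : Bd := Id X (x k) (y k a' q)
              -- By the section homotopy of `H`, the path `u` agrees at `(c, s)` with its candidate
              -- there. The second leg of that candidate is the path induced by `r`, by uniqueness,
              -- so it cancels.
              cancelBy (G k a p c s)
                (joinPath A C B f g b X k a' c r q s (refl (Id B (f ⬝ a') b) q))
                (ap (Lam (fibFun C B g b I) fun φ => φ ⬝ c ⬝ s) (eqSec (H ⬝ x k ⬝ y k a' q) (E k a' q)))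
                (joinPathUnique A C B f g b X k a' c r q s (refl (Id B (f ⬝ a') b) q)))) z)))
      (Fn fun x => refl))).decl 140

def joinItems : List Item := [.t dJoinInd, .t dJoinGlue, .t dFibTransport, .f dFamPath,
  .t dFamTransport, .f dJoinPath, .t dJoinPathUnique, .t dJoinStep]

end HoTT.Check

namespace HoTT.Check

/-! ## Iterated joins -/

def jpHyp (body : Bd → Bd → Bd → Bd → Tele) : Tele := mapHyp fun A B f => arg Nat' fun n => body A B f n

/-- The type of functions from the fibre over `b` of an iterated join. -/
def powFun (A B f n b X : Bd) : Bd := fibFun (joinPowerType A B f n) B (joinPowerMap A B f n) b X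
def powConst (A B f n b X : Bd) : Bd := fibConst (joinPowerType A B f n) B (joinPowerMap A B f n) b X

/-- Induction on `n` with `X` generalised, since the step applies the hypothesis to identity types
of `X`. For `n = 0` the centre of `X` serves as inverse, and functions out of the empty type are
unique. -/
def powEquiv (A B f b a p n X t : Bd) : Bd := Hd 141 l0 lz [A, B, f, b, a, p, n, X, t]
def dPowEquiv := (mapHyp fun A B f => arg B fun b => arg A fun a => arg (Id B (f ⬝ a) b) fun p =>
  arg Nat' fun n => arg (U l0) fun X => arg (isTruncSubTwo n X) fun t =>
  let T (n : Bd) : Bd := Pi (U l0) fun X => isTruncSubTwo n X ⇒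
    isEquiv X (powFun A B f n b X) (powConst A B f n b X)
  ret (isEquiv X (powFun A B f n b X) (powConst A B f n b X))
    (natInd (Lam Nat' fun n => T n)
      (Lam (U l0) fun X => Lam (isTruncSubTwo zero X) fun t =>
        let K : Bd := powFun A B f zero b X
        let F : Bd := Lam X fun x => Pi X fun y => Id X x y
        mkEquiv X K ◦ (Lam K fun _ => fst X F t)
          (Lam K fun k => funext (Fn fun z => emptyInd (Fn fun z =>
            Id (Id B (joinPowerMap A B f zero ⬝ z) b ⇒ X)
              (Fn fun _ => fst X F t) (k ⬝ z)) z))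
          (Fn fun x => snd X F t ⬝ x))
      (Lam Nat' fun n => Lam (T n) fun ih => Lam (U l0) fun X =>
        Lam (isTruncSubTwo (succ n) X) fun t =>
        -- The truncation level of `X` unfolds to the level below for each `x = y`, exactly what the
        -- induction hypothesis needs.
        joinStep A (joinPowerType A B f n) B f (joinPowerMap A B f n) b X
          (Lam X fun x => Lam X fun y => ih ⬝ Id X x y ⬝ (t ⬝ x ⬝ y)) a p) n lu ⬝ X ⬝ t)).decl 141

/-- The fibres of `f` over the image of an iterated join of `f` are inhabited. -/
def powSupport (A B f n z : Bd) : Bd := Hd 142 l0 lz [A, B, f, n, z]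
def dPowSupport := (jpHyp fun A B f n => arg (joinPowerType A B f n) fun z =>
  let P (b : Bd) : Bd := trunc (fib A B f b)
  ret (P (joinPowerMap A B f n ⬝ z))
    (natInd (Lam Nat' fun n => Pi (joinPowerType A B f n) fun z => P (joinPowerMap A B f n ⬝ z))
      (Lam Empty fun z => emptyInd (Lam Empty fun z => P (joinPowerMap A B f zero ⬝ z)) z)
      (Fn fun n => Fn fun ih => Fn fun z =>
        let C : Bd := joinPowerType A B f n
        let g : Bd := joinPowerMap A B f n
        let J : Bd := Join A C B f g
        let Q : Bd := Lam J fun z => P (joinMap A C B f g ⬝ z)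
        joinInd A C B f g Q (Lam A fun a => tr (pair a (refl B (f ⬝ a)) A
            (Lam A fun a' => Id B (f ⬝ a') (f ⬝ a))) (fib A B f (f ⬝ a))) ih
          -- The goal is a proposition, so there is nothing to verify over the glue paths.
          (Fn fun a => Fn fun c => Fn fun p => squash (transport Q (jglue A C B f g a c p)
            (tr (pair a (refl B (f ⬝ a)) A (Lam A fun a' => Id B (f ⬝ a') (f ⬝ a)))
              (fib A B f (f ⬝ a)))) (ih ⬝ c)) z)
      n ⬝ z)).decl 142

def Fib' (A B f b : Bd) : Bd := trunc (fib A B f b)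

/-- The functions on the fibre of an iterated join over `b` are local. -/
def powLocal (A B f n b X : Bd) : Bd := Hd 143 l0 lz [A, B, f, n, b, X]
def dPowLocal := (jpHyp fun A B f n => arg B fun b => arg (U l0) fun X =>
  let P : Bd := Fib' A B f b
  ret (Local P (powFun A B f n b X))
    (localFun P (joinPowerType A B f n)
      (Lam (joinPowerType A B f n) fun z => Id B (joinPowerMap A B f n ⬝ z) b) X
      (Fn fun p => Fn fun q => squash p q)
      (Fn fun z => Fn fun p => transport (Lam B fun b => Fib' A B f b) p (powSupport A B f n z)))
    ).decl 143

/-- Being an equivalence is a proposition, so mere inhabitation of the fibre suffices. -/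
def powEquiv' (A B f n b X t p : Bd) : Bd := Hd 144 l0 lz [A, B, f, n, b, X, t, p]
def dPowEquiv' := (jpHyp fun A B f n => arg B fun b => arg (U l0) fun X =>
  arg (isTruncSubTwo n X) fun t => arg (Fib' A B f b) fun p =>
  let E : Bd := isEquiv X (powFun A B f n b X) (powConst A B f n b X)
  ret E (truncRec E (Lam E fun e => Lam E fun e' => isPropEquiv e e')
    (Lam (fib A B f b) fun w => let F : Bd := Lam A fun a => Id B (f ⬝ a) b
      powEquiv A B f b (fst A F w) (snd A F w) n X t) p)).decl 144

/-- Restriction to an iterated join is an equivalence if it is one on the fibres. -/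
def restrictOfPow (A B f n X e : Bd) : Bd := Hd 145 l0 lz [A, B, f, n, X, e]
def dRestrictOfPow := (jpHyp fun A B f n => arg (U l0) fun X =>
  arg (Pi B fun b => isEquiv X (powFun A B f n b X) (powConst A B f n b X)) fun e =>
  let J : Bd := joinPowerType A B f n
  let w : Bd := joinPowerMap A B f n
  let c (h b : Bd) : Bd := Lam J fun z => Lam (Id B (w ⬝ z) b) fun _ => h ⬝ z
  ret (isEquiv (B ⇒ X) (J ⇒ X) (joinRestrict A B f n X))
    -- A function `h` on the iterated join restricts to the fibre over each `b`, where it is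
    -- constant up to the given equivalence; its extension takes that constant value at `b`.
    (mkEquiv (B ⇒ X) (J ⇒ X) ◦ (Lam (J ⇒ X) fun h => Lam B fun b => eqInv (e ⬝ b) (c h b))
      (Fn fun h => funext (Fn fun z =>
        ap (Lam (powFun A B f n (w ⬝ z) X) fun k => k ⬝ z ⬝ refl B (w ⬝ z))
          (eqSec (e ⬝ (w ⬝ z)) (c h (w ⬝ z)))))
      (Fn fun g => funext (Fn fun b =>
        trans (ap (Lam (powFun A B f n b X) fun k => eqInv (e ⬝ b) k)
          (funext (Fn fun z => funext (Fn fun p => ap g p)) J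
            (Lam J fun z => Id B (w ⬝ z) b ⇒ X) (Lam J fun z => Lam (Id B (w ⬝ z) b) fun _ => g ⬝ (w ⬝ z))
            (Lam J fun z => Lam (Id B (w ⬝ z) b) fun _ => g ⬝ b)))
          (eqRet (e ⬝ b) (g ⬝ b)))))).decl 145

/-! ## The unit type -/

def unitPath (b : Bd) (i := l0) : Bd := Hd 146 i lz [b]
def dUnitPath := (arg Unit fun b => ret (Id Unit b star)
  (unitInd (Lam Unit fun b => Id Unit b star) (refl Unit star) b)).decl 146

/-- Each `b = ⋆` has only one element, so functions on the fibre over `⋆` of a map to the unit type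
amount to functions on its whole domain. -/
def unitSet (b p : Bd) (i := l0) : Bd := Hd 147 i lz [b, p]
def dUnitSet := (arg Unit fun b => arg (Id Unit b star) fun p =>
  let q (b c : Bd) : Bd := trans (unitPath b) (inv (unitPath c))
  ret (Id (Id Unit b star) (q b star) p)
    (idInd (Lam Unit fun c => Lam (Id Unit b c) fun p => Id (Id Unit b c) (q b c) p)
      (unitInd (Lam Unit fun b => Id (Id Unit b b) (q b b) (refl Unit b)) refl b)
      p Unit b star)).decl 147

def powItems : List Item := [.t dPowEquiv, .t dPowSupport, .t dPowLocal, .t dPowEquiv',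
  .t dRestrictOfPow, .f dUnitPath, .t dUnitSet]

end HoTT.Check

namespace HoTT.Check

/-! ## Nullification -/

def N (A B X : Bd) : Bd := Null 27 A B X []

def apConst (B X x b b' p : Bd) : Bd := Hd 148 l0 lz [B, X, x, b, b', p]
def dApConst := (arg (U l0) fun B => arg (U l0) fun X => arg X fun x => arg B fun b => arg B fun b' =>
  arg (Id B b b') fun p => ret (Id (Id X x x) (ap (Lam B fun _ => x) p B X b b') (refl X x))
  (idInd (Fn fun b' => Fn fun p => Id (Id X x x) (ap (Lam B fun _ => x) p B X b b') (refl X x))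
    refl p)).decl 148

/-- The four constructors `sec`, `isSec`, `ret`, `isRet` are the data of an equivalence, up to
function extensionality for `isSec`. -/
def nullLocal (A B X a : Bd) : Bd := Hd 149 l0 lz [A, B, X, a]
def dNullLocal := (nullParam fun A B X => arg A fun a =>
  let Y := N A B X
  let L := Lam (B ⬝ a ⇒ Y)
  ret (Local (B ⬝ a) Y) (pair
    (pair (L fun g => Null 29 A B X [a, g])
      (L fun g => funext (Lam (B ⬝ a) fun b => Null 30 A B X [a, g, b])))
    (pair (L fun g => Null 31 A B X [a, g]) (Lam Y fun x => Null 32 A B X [a, x])))).decl 149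

def localOfNull (A B X e a : Bd) (i := l0) : Bd := Hd 150 i lz [A, B, X, e, a]
def dLocalOfNull := (nullParam fun A B X => arg (isEquiv X (N A B X) (Null 28 A B X [])) fun e =>
  arg A fun a => ret (Local (B ⬝ a) X)
    (localOfEquiv (B ⬝ a) X (N A B X) (Null 28 A B X []) e (nullLocal A B X a))).decl 150

def retPath (A B X a x g p : Bd) : Bd := Hd 151 l0 lz [A, B, X, a, x, g, p]
def dRetPath := (nullParam fun A B X => arg A fun a => arg (N A B X) fun x =>
  arg (B ⬝ a ⇒ N A B X) fun g => arg (Id (B ⬝ a ⇒ N A B X) (Lam (B ⬝ a) fun _ => x) g) fun p =>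
  ret (Id (N A B X) x (Null 31 A B X [a, g]))
    (idInd (Fn fun g => Fn fun _ => Id (N A B X) x (Null 31 A B X [a, g]))
      (inv (Null 32 A B X [a, x])) p)).decl 151

/-- The type of proofs that the types `B a` are propositions. -/
def AllProp (A B : Bd) : Bd := Pi A fun a => Pi (B ⬝ a) fun b => Pi (B ⬝ a) fun b' => Id (B ⬝ a) b b'

/-- The method for `ret`. Given `b : B a`, the function `g` is constant with value `g b`, because `B
a` is a proposition. So `g b = ret a g` and `u b` can be transported there. Locality of the family
removes the dependence on `b`. -/
def fiberRet (A B X pp P loc a g u : Bd) : Bd := Hd 152 l0 lz [A, B, X, pp, P, loc, a, g, u]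
def indHyp (body : Bd → Bd → Bd → Bd → Bd → Bd → Tele) : Tele :=
  nullParam fun A B X => arg (AllProp A B) fun pp => arg (N A B X ⇒ U l0) fun P =>
  arg (Pi (N A B X) fun z => Pi A fun a => Local (B ⬝ a) (P ⬝ z)) fun loc => body A B X pp P loc
def retPaths (A B X pp a g b : Bd) : Bd :=
  funext (Lam (B ⬝ a) fun b' => ap g (pp ⬝ a ⬝ b ⬝ b')) (B ⬝ a) (Lam (B ⬝ a) fun _ => N A B X)
    (Lam (B ⬝ a) fun _ => g ⬝ b) g
def retFun (A B X pp P a g u : Bd) : Bd := Lam (B ⬝ a) fun b =>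
  transport P (retPath A B X a (g ⬝ b) g (retPaths A B X pp a g b)) (u ⬝ b)
def dFiberRet := (indHyp fun A B X pp P loc => arg A fun a => arg (B ⬝ a ⇒ N A B X) fun g =>
  arg (Pi (B ⬝ a) fun b => P ⬝ (g ⬝ b)) fun u => ret (P ⬝ Null 31 A B X [a, g])
    (eqInv (loc ⬝ Null 31 A B X [a, g] ⬝ a) (retFun A B X pp P a g u))).decl 152

/-- The target is an equation in a local type, so some `b : B a` may be assumed. Locality then
returns the value of `retFun` at `b`. Since `g` is constant, the path of functions used there is
`funext` of trivial paths, hence trivial (`apConst`, `funextRefl`). What remains is transport along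
`isRet` and back. -/
def fiberIsRet (A B X pp P loc a x u : Bd) : Bd := Hd 153 l0 lz [A, B, X, pp, P, loc, a, x, u]
def dFiberIsRet := (indHyp fun A B X pp P loc => arg A fun a => arg (N A B X) fun x =>
  arg (P ⬝ x) fun u =>
  let Y : Bd := N A B X
  let g : Bd := Lam (B ⬝ a) fun _ => x
  let v : Bd := Lam (B ⬝ a) fun _ => u
  let q : Bd := Null 32 A B X [a, x]
  let w : Bd := fiberRet A B X pp P loc a g v
  let y : Bd := Null 31 A B X [a, g]
  ret (Id (P ⬝ x) (transport P q w Y y x) u)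
    (localSep (B ⬝ a) (P ⬝ x) (loc ⬝ x ⬝ a) (transport P q w Y y x) u (Lam (B ⬝ a) fun b =>
      trans (ap (Lam (P ⬝ y) fun w => transport P q w Y y x) (trans
          (ap (Lam (B ⬝ a ⇒ P ⬝ y) fun k => k ⬝ b) (eqSec (loc ⬝ y ⬝ a) (retFun A B X pp P a g v))
            (B ⬝ a ⇒ P ⬝ y) (P ⬝ y))
          (ap (Lam (Id (B ⬝ a ⇒ Y) g g) fun φ => transport P (retPath A B X a x g φ) u)
            (trans (ap (Lam (Pi (B ⬝ a) fun _ => Id Y x x) fun h =>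
                funext h (B ⬝ a) (Lam (B ⬝ a) fun _ => Y) g g)
              (funext (Lam (B ⬝ a) fun b' => apConst (B ⬝ a) Y x b b' (pp ⬝ a ⬝ b ⬝ b'))
                (B ⬝ a) (Lam (B ⬝ a) fun _ => Id Y x x) 
                (Lam (B ⬝ a) fun b' => ap g (pp ⬝ a ⬝ b ⬝ b'))
                (Lam (B ⬝ a) fun _ => refl Y x)))
              (funextRefl (B ⬝ a) (Lam (B ⬝ a) fun _ => Y) g)))))
        (transportBack P q u)))).decl 153

/-- Induction on a nullification at propositions, into local types. -/
def nullIndLocal (A B X pp P loc h z : Bd) : Bd := Hd 154 l0 lz [A, B, X, pp, P, loc, h, z]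
def dNullIndLocal := (indHyp fun A B X pp P loc =>
  arg (Pi X fun x => P ⬝ Null 28 A B X [x]) fun h => arg (N A B X) fun z =>
  let Y : Bd := N A B X
  let f (a g u : Bd) : Bd := Lam (B ⬝ a) fun b =>
    transport P (inv (Null 30 A B X [a, g, b])) (u ⬝ b)
  let L (k : Bd → Bd → Bd → Bd) : Bd := Lam A fun a => Lam (B ⬝ a ⇒ Y) fun g =>
    Lam (Pi (B ⬝ a) fun b => P ⬝ (g ⬝ b)) fun u => k a g u
  let y (a g : Bd) : Bd := Null 29 A B X [a, g]
  ret (P ⬝ z) (Null 33 A B X [P, h,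
    -- The method for `sec`: each `u b` is transported back along `isSec`, and locality of the fibre
    -- over `sec a g` combines these values.
    L fun a g u => eqInv (loc ⬝ y a g ⬝ a) (f a g u),
    L fun a g u => Lam (B ⬝ a) fun b =>
      trans (ap (Lam (P ⬝ y a g) fun w => transport P (Null 30 A B X [a, g, b]) w)
          (ap (Lam (B ⬝ a ⇒ P ⬝ y a g) fun k => k ⬝ b) (eqSec (loc ⬝ y a g ⬝ a) (f a g u))
            (B ⬝ a ⇒ P ⬝ y a g) (P ⬝ y a g)))
        (transportBack P (Null 30 A B X [a, g, b]) (u ⬝ b)),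
    L fun a g u => fiberRet A B X pp P loc a g u,
    Lam A fun a => Lam Y fun x => Lam (P ⬝ x) fun u => fiberIsRet A B X pp P loc a x u,
    z] l0 l0)).decl 154

/-- A type that is local for propositions is its own nullification. -/
def nullOfLocal (A B X pp loc : Bd) (i := l0) : Bd := Hd 155 i lz [A, B, X, pp, loc]
def dNullOfLocal := (nullParam fun A B X => arg (AllProp A B) fun pp =>
  arg (Pi A fun a => Local (B ⬝ a) X) fun loc =>
  let Y : Bd := N A B X
  let r (z : Bd) : Bd := nullIndLocal A B X pp (Lam Y fun _ => X) (Lam Y fun _ => loc)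
    (Lam X fun x => x) z
  ret (isEquiv X Y (Null 28 A B X []))
    (mkEquiv X Y (Null 28 A B X []) (Lam Y fun z => r z)
      -- That the retraction is also a section holds on the image of the unit, and extends because
      -- identity types of the local type `Y` are local.
      (Lam Y fun z => nullIndLocal A B X pp (Lam Y fun z => Id Y (Null 28 A B X [r z]) z)
        (Lam Y fun z => Lam A fun a => localId (B ⬝ a) Y (nullLocal A B X a) (Null 28 A B X [r z]) z)
        (Lam X fun x => refl Y (Null 28 A B X [x])) z)
      (Lam X fun x => refl X x))).decl 155

def nullItems : List Item := [.t dApConst, .t dNullLocal, .t dLocalOfNull, .f dRetPath, .f dFiberRet,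
  .t dFiberIsRet, .f dNullIndLocal, .t dNullOfLocal]

end HoTT.Check

namespace HoTT.Check

/-! ## Change of universe -/

def Amb (h : ℕ) (as : List Bd) : Bd := Hd h l0 l1 as

/-- Identity types at two levels are distinct constants, even for a type that lies in both
universes. Path induction with a motive at the other level goes back and forth. This is needed
because the nullification lives in `U (max i j)` while covers use `U i`. -/
def idUp (A x y p : Bd) : Bd := Amb 160 [A, x, y, p]
def dIdUp := (arg (U l0) fun A => arg A fun x => arg A fun y => arg (Id A x y) fun p =>
  ret (Id A x y l1) (idInd (Lam A fun y => Fn fun _ => Id A x y l1) (refl A x l1) p A x y l0 l1)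
  ).decl 160 true

def idDown (A x y p : Bd) : Bd := Amb 161 [A, x, y, p]
def dIdDown := (arg (U l0) fun A => arg A fun x => arg A fun y => arg (Id A x y l1) fun p =>
  ret (Id A x y) (idInd (Lam A fun y => Fn fun _ => Id A x y) (refl A x) p A x y l1 l0)
  ).decl 161 true

def isEquivUp (A B f e : Bd) : Bd := Amb 162 [A, B, f, e]
def dIsEquivUp := (mapHyp fun A B f => arg (isEquiv A B f) fun e => ret (isEquiv A B f l1)
  (mkEquiv A B f (Lam B fun y => eqInv e y)
    (Lam B fun y => idUp B (f ⬝ eqInv e y) y (eqSec e y))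
    (Lam A fun x => idUp A (eqInv e (f ⬝ x)) x (eqRet e x)) l1)).decl 162 true

def isEquivDown (A B f e : Bd) : Bd := Amb 163 [A, B, f, e]
def dIsEquivDown := (mapHyp fun A B f => arg (isEquiv A B f l1) fun e => ret (isEquiv A B f)
  (mkEquiv A B f (Lam B fun y => eqInv e y l1)
    (Lam B fun y => idDown B (f ⬝ eqInv e y l1) y (eqSec e y l1))
    (Lam A fun x => idDown A (eqInv e (f ⬝ x) l1) x (eqRet e x l1)))).decl 163 true

/-! ## Sheaves -/

def famHypT (body : Bd → Bd → Bd → Tele) : Tele :=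
  arg (U l2) fun I => arg (I ⇒ U l0) fun T => arg (U l0) fun X => body I T X
def Fam (I T : Bd) : Bd := Lam I fun x => truncFamily I T x

def localOfSheaf (I T X s x : Bd) : Bd := Amb 164 [I, T, X, s, x]
def dLocalOfSheaf := (famHypT fun I T X => arg (isSheaf I T X) fun s => arg I fun x =>
  let P : Bd := trunc (T ⬝ x)
  ret (Local P X) (isEquivDown X (P ⇒ X) (Const P X)
    (localOfNull I (Fam I T) X s x l1))).decl 164 true

def sheafOfLocal (I T X l : Bd) : Bd := Amb 165 [I, T, X, l]
def dSheafOfLocal := (famHypT fun I T X => arg (Pi I fun x => Local (trunc (T ⬝ x)) X) fun l =>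
  ret (isSheaf I T X) (nullOfLocal I (Fam I T) X
    (Lam I fun x => Lam (trunc (T ⬝ x)) fun b => Lam (trunc (T ⬝ x)) fun b' =>
      idUp (trunc (T ⬝ x)) b b' (squash b b'))
    (Lam I fun x => isEquivUp X (trunc (T ⬝ x) ⇒ X) (Const (trunc (T ⬝ x)) X) (l ⬝ x)) l1)
    ).decl 165 true

/-- Sheaves are local for the fibres of covers. -/
def localOfCover (I T X s A B f c b : Bd) : Bd := Amb 166 [I, T, X, s, A, B, f, c, b]
def dLocalOfCover := (famHypT fun I T X => arg (isSheaf I T X) fun s =>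
  arg (U l0) fun A => arg (U l0) fun B => arg (A ⇒ B) fun f => arg (isCover I T A B f) fun c =>
  arg B fun b =>
  let L : Bd := Local (Fib' A B f b) X
  let Q : Bd := Lam I fun x => Id (U l0) (T ⬝ x) (fib A B f b) lu
  -- The cover condition only gives the mere existence of `x` with `T x = fib`. Locality is a
  -- proposition, so `x` may be chosen, and locality for `‖T x‖` is transported along the path in
  -- the universe.
  ret L (truncRec L (Lam L fun e => Lam L fun e' => isPropEquiv e e')
    (Lam (sig I Q l3) fun w => transport (Lam (U l0) fun Y => Local (trunc Y) X)
      (snd I Q w l3) (localOfSheaf I T X s (fst I Q w l3)) (U l0) (T ⬝ fst I Q w l3) (fib A B f b) lu l0)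
    (c ⬝ b) l3 l0)).decl 166 true

/-- The map from `Y` to the unit type. -/
def ToUnit (Y : Bd) : Bd := Lam Y fun _ => star
def UFib (Y b : Bd) : Bd := fib Y Unit (ToUnit Y) b

/-- By univalence a type equals each fibre of its map to the unit type; an equality of types is what
membership in `T` asks for. -/
def fibUnit (Y b : Bd) : Bd := Hd 167 l0 lz [Y, b]
def dFibUnit := (arg (U l0) fun Y => arg Unit fun b =>
  let F : Bd := Lam Y fun _ => Id Unit star b
  let c (b : Bd) : Bd := inv (unitPath b)
  let f : Bd := Lam Y fun y => pair y (c b) Y F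
  ret (Id (U l0) Y (UFib Y b) lu)
    (eqInv (univalence Y (UFib Y b)) (mk (Y ⇒ UFib Y b) (fun f => isEquiv Y (UFib Y b) f) f
      (mkEquiv Y (UFib Y b) f (Lam (UFib Y b) fun w => fst Y F w)
        (Lam (UFib Y b) fun w => sigInd (Lam (UFib Y b) fun w =>
            Id (UFib Y b) (pair (fst Y F w) (c b) Y F) w)
          (Fn fun y => Fn fun p => idInd (Lam Unit fun b => Lam (Id Unit star b) fun p =>
              Id (UFib Y b) (pair y (c b) Y (Lam Y fun _ => Id Unit star b))
                (pair y p Y (Lam Y fun _ => Id Unit star b))) refl p Unit star b) w)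
        (Lam Y fun y => refl Y y))) lu)).decl 167

def unitCover (I T x : Bd) : Bd := Amb 168 [I, T, x]
def dUnitCover := (arg (U l2) fun I => arg (I ⇒ U l0) fun T => arg I fun x =>
  ret (isCover I T (T ⬝ x) Unit (ToUnit (T ⬝ x)))
    (Lam Unit fun b => tr (pair x (fibUnit (T ⬝ x) b) I
      (Lam I fun x' => Id (U l0) (T ⬝ x') (UFib (T ⬝ x) b) lu) l3) ◦ l3)).decl 168 true

def localOfUnit (Y X l : Bd) : Bd := Hd 169 l0 lz [Y, X, l]
def dLocalOfUnit := (arg (U l0) fun Y => arg (U l0) fun X =>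
  arg (Local (trunc (UFib Y star)) X) fun l => ret (Local (trunc Y) X)
    (transport (Lam (U l0) fun Z => Local (trunc Z) X) (inv (fibUnit Y star) lu) l (U l0)
      (UFib Y star) Y lu l0)).decl 169

def unitConst (X : Bd) : Bd := Hd 170 l0 lz [X]
def dUnitConst := (arg (U l0) fun X => ret (isEquiv X (Unit ⇒ X) (Const Unit X))
  (mkEquiv X (Unit ⇒ X) ◦ (Lam (Unit ⇒ X) fun g => g ⬝ star)
    (Lam (Unit ⇒ X) fun g => funext (Lam Unit fun b =>
      unitInd (Lam Unit fun b => Id X (g ⬝ star) (g ⬝ b)) (refl X (g ⬝ star)) b))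
    (Lam X fun x => refl X x))).decl 170

/-- The other direction of `restrictOfPow` for maps to the unit type. -/
def powOfRestrict (A n X e : Bd) : Bd := Hd 171 l0 lz [A, n, X, e]
def dPowOfRestrict := (arg (U l0) fun A => arg Nat' fun n => arg (U l0) fun X =>
  let f := ToUnit A
  let J : Bd := joinPowerType A Unit f n
  let w : Bd := joinPowerMap A Unit f n
  let K : Bd := powFun A Unit f n star X
  let c (z : Bd) : Bd := trans (unitPath (w ⬝ z)) (inv (unitPath star))
  let r : Bd := Lam (J ⇒ X) fun h => Lam J fun z => Lam (Id Unit (w ⬝ z) star) fun _ => h ⬝ z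
  arg (isEquiv (Unit ⇒ X) (J ⇒ X) (joinRestrict A Unit f n X)) fun e =>
  ret (isEquiv X K (powConst A Unit f n star X))
    -- The map is computed as the composite `X → (1 → X) → (J → X) → K`. The last map is an
    -- equivalence because its paths in the unit type carry no information.
    (isEquivComp (Const Unit X) (Lam (Unit ⇒ X) fun g => r ⬝ (joinRestrict A Unit f n X ⬝ g))
      (unitConst X) (isEquivComp (joinRestrict A Unit f n X) r e
        (mkEquiv (J ⇒ X) K r (Lam K fun k => Lam J fun z => k ⬝ z ⬝ c z)
          (Lam K fun k => funext (Fn fun z => funext (Fn fun p =>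
            ap (k ⬝ z) (unitSet (w ⬝ z) p))))
          (Lam (J ⇒ X) fun h => funext (Lam J fun z => refl X (h ⬝ z))))))).decl 171

def dSheafCondition := (arg (U l2) fun I => arg (I ⇒ U l0) fun T => arg Nat' fun n =>
  arg (U l0) fun X => arg (isTruncSubTwo n X) fun t =>
  let S : Bd := isSheaf I T X
  let C : Bd := Pi (U l0) fun A => Pi (U l0) fun B => Pi (A ⇒ B) fun f => isCover I T A B f ⇒
    isEquiv (B ⇒ X) (joinPowerType A B f n ⇒ X) (joinRestrict A B f n X)
  ret (Iff S C l3)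
    (mk (S ⇒ C) (fun _ => C ⇒ S)
      (Lam S fun s => Fn fun A => Fn fun B => Fn fun f => Fn fun c =>
        restrictOfPow A B f n X (Lam B fun b =>
          equivOfLocal (Fib' A B f b) X (powFun A B f n b X) (powConst A B f n b X)
            (Lam (Fib' A B f b) fun p => powEquiv' A B f n b X t p)
            (localOfCover I T X s A B f c b) (powLocal A B f n b X)))
      (Lam C fun e => sheafOfLocal I T X (Lam I fun x =>
        let Y := T ⬝ x
        let f := ToUnit Y
        -- For the cover `T x → 1`, the type `X` is equivalent to the functions on the fibre of the
        -- iterated join. These are local for the truncated fibre, which is then replaced by `‖T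
        -- x‖`.
        localOfUnit Y X (localOfEquiv (Fib' Y Unit f star) X (powFun Y Unit f n star X)
          (powConst Y Unit f n star X)
          (powOfRestrict Y n X (e ⬝ Y ⬝ Unit ⬝ f ⬝ unitCover I T x))
          (powLocal Y Unit f n star X)))) l3)).decl 172 true

def sheafThmItems : List Item := [.t dIdUp, .t dIdDown, .t dIsEquivUp, .t dIsEquivDown,
  .t dLocalOfSheaf, .t dSheafOfLocal, .t dLocalOfCover, .t dFibUnit, .t dUnitCover, .t dLocalOfUnit,
  .t dUnitConst, .t dPowOfRestrict, .t dSheafCondition]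

end HoTT.Check

namespace HoTT.Check

/-! ## The sheaf condition for sets -/

def two : Bd := succ (succ zero)

/-- At the numeral `2` the truncation hypothesis computes to contractibility of `p = q`, whose
centre is taken. -/
def setPath (X t x y p q : Bd) : Bd := Hd 180 l0 lz [X, t, x, y, p, q]
def dSetPath := (arg (U l0) fun X => arg (isTruncSubTwo two X) fun t => arg X fun x => arg X fun y =>
  arg (Id X x y) fun p => arg (Id X x y) fun q =>
  let I : Bd := Id X x y
  let F : Bd := Lam (Id I p q) fun r => Pi (Id I p q) fun s => Id (Id I p q) r s
  ret (Id I p q) (fst (Id I p q) F (t ⬝ x ⬝ y ⬝ p ⬝ q))).decl 180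

/-- The property of functions on a fibre that they do not depend on the element. -/
def Indep (A B f b X h : Bd) : Bd := Hd 181 l0 lz [A, B, f, b, X, h]
def fibHyp (body : Bd → Bd → Bd → Bd → Bd → Tele) : Tele :=
  mapHyp fun A B f => arg B fun b => arg (U l0) fun X => body A B f b X
def FibFun (A B f b X : Bd) : Bd := Pi A fun a => Id B (f ⬝ a) b ⇒ X
def dIndep := (fibHyp fun A B f b X => arg (FibFun A B f b X) fun h => ret (U l0)
  (Pi A fun a => Pi (Id B (f ⬝ a) b) fun p => Pi A fun a' => Pi (Id B (f ⬝ a') b) fun p' =>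
    Id X (h ⬝ a ⬝ p) (h ⬝ a' ⬝ p'))).decl 181

def IndepFam (A B f b X : Bd) : Bd := Lam (FibFun A B f b X) fun h => Indep A B f b X h
def FibEq (A B f b X : Bd) : Bd := sig (FibFun A B f b X) (IndepFam A B f b X)
def fibEqConst (A B f b X : Bd) : Bd := Lam X fun x =>
  pair (Lam A fun a => Lam (Id B (f ⬝ a) b) fun _ => x)
    (Lam A fun a => Lam (Id B (f ⬝ a) b) fun _ => Lam A fun a' => Lam (Id B (f ⬝ a') b) fun _ =>
      refl X x) (FibFun A B f b X) (IndepFam A B f b X)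

/-- As `X` is a set, independence of the point is a proposition, and only the underlying functions
have to agree. -/
def fibEqPath (A B f b X t u v h : Bd) : Bd := Hd 182 l0 lz [A, B, f, b, X, t, u, v, h]
def dFibEqPath := (fibHyp fun A B f b X => arg (isTruncSubTwo two X) fun t =>
  let G : Bd := FibFun A B f b X
  let F : Bd := IndepFam A B f b X
  let E : Bd := FibEq A B f b X
  arg E fun u => arg E fun v => arg (Pi A fun a => Pi (Id B (f ⬝ a) b) fun p =>
    Id X (fst G F u ⬝ a ⬝ p) (fst G F v ⬝ a ⬝ p)) fun h => ret (Id E u v)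
  (sigPath G F (Lam G fun h => Lam (F ⬝ h) fun k => Lam (F ⬝ h) fun k' =>
      funext (Fn fun a => funext (Fn fun p => funext (Fn fun a' => funext (Fn fun p' =>
        setPath X t (h ⬝ a ⬝ p) (h ⬝ a' ⬝ p') (k ⬝ a ⬝ p ⬝ a' ⬝ p') (k' ⬝ a ⬝ p ⬝ a' ⬝ p'))))))
    u v (funext (Fn fun a => funext (Fn fun p => h ⬝ a ⬝ p))))).decl 182

def fibEqEquiv (A B f b X t p : Bd) : Bd := Hd 183 l0 lz [A, B, f, b, X, t, p]
def dFibEqEquiv := (fibHyp fun A B f b X => arg (isTruncSubTwo two X) fun t =>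
  arg (Fib' A B f b) fun p =>
  let G : Bd := FibFun A B f b X
  let F : Bd := IndepFam A B f b X
  let E : Bd := FibEq A B f b X
  let c : Bd := fibEqConst A B f b X
  let D : Bd := Lam A fun a => Id B (f ⬝ a) b
  let Q : Bd := isEquiv X E c
  ret Q (truncRec Q (Lam Q fun e => Lam Q fun e' => isPropEquiv e e')
    (Lam (fib A B f b) fun w =>
      let x (u : Bd) := fst G F u ⬝ fst A D w ⬝ snd A D w
      mkEquiv X E c (Lam E fun u => x u)
        -- Independence of the point says directly that `u` is constant with its value at the chosen
        -- point.
        (Lam E fun u => fibEqPath A B f b X t (c ⬝ x u) u (Lam A fun a => Lam (Id B (f ⬝ a) b) fun p =>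
          snd G F u ⬝ fst A D w ⬝ snd A D w ⬝ a ⬝ p))
        (Lam X fun x => refl X x)) p)).decl 183

/-- A function on the fibre is evaluated only at points of it, and such a point proves `P`. The
family over `P` is evaluated at the proof given by the point itself; different proofs give equal
values because `P` is a proposition. -/
def fibEqLocal (A B f b X t : Bd) : Bd := Hd 184 l0 lz [A, B, f, b, X, t]
def dFibEqLocal := (fibHyp fun A B f b X => arg (isTruncSubTwo two X) fun t =>
  let G : Bd := FibFun A B f b X
  let F : Bd := IndepFam A B f b X
  let E : Bd := FibEq A B f b X
  let P : Bd := Fib' A B f b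
  let D : Bd := Lam A fun a => Id B (f ⬝ a) b
  let s (a p : Bd) : Bd := tr (pair a p A D) (fib A B f b)
  let H (k a p : Bd) : Bd := fst G F (k ⬝ s a p) ⬝ a ⬝ p
  let g (k : Bd) : Bd := pair (Lam A fun a => Lam (D ⬝ a) fun p => H k a p)
    (Lam A fun a => Lam (D ⬝ a) fun p => Lam A fun a' => Lam (D ⬝ a') fun p' =>
      trans (snd G F (k ⬝ s a p) ⬝ a ⬝ p ⬝ a' ⬝ p')
        (ap (Lam P fun q => fst G F (k ⬝ q) ⬝ a' ⬝ p') (squash (s a p) (s a' p')) P X)) G F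
  ret (Local P E) (mkEquiv E (P ⇒ E) (Const P E) (Lam (P ⇒ E) fun k => g k)
    (Lam (P ⇒ E) fun k => funext (Lam P fun q => fibEqPath A B f b X t (g k) (k ⬝ q)
        (Lam A fun a => Lam (D ⬝ a) fun p =>
          ap (Lam P fun q => fst G F (k ⬝ q) ⬝ a ⬝ p) (squash (s a p) q) P X))
      P (Lam P fun _ => E) (Lam P fun _ => g k) k)
    (Lam E fun u => fibEqPath A B f b X t (g (Lam P fun _ => u)) u
      (Lam A fun a => Lam (D ⬝ a) fun p => refl X (fst G F u ⬝ a ⬝ p))))).decl 184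

def mapSetHyp (body : Bd → Bd → Bd → Bd → Bd → Tele) : Tele :=
  mapHyp fun A B f => arg (U l0) fun X => arg (isTruncSubTwo two X) fun t => body A B f X t

def eqPath (A B f X t u v h : Bd) : Bd := Hd 185 l0 lz [A, B, f, X, t, u, v, h]
def AgreeFam (A B f X : Bd) : Bd := Lam (A ⇒ X) fun h => Agree A B f X h
def dEqPath := (mapSetHyp fun A B f X t =>
  let F : Bd := AgreeFam A B f X
  let E : Bd := Equaliser A B f X
  arg E fun u => arg E fun v => arg (Pi A fun a => Id X (fst (A ⇒ X) F u ⬝ a) (fst (A ⇒ X) F v ⬝ a))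
    fun h => ret (Id E u v)
  (sigPath (A ⇒ X) F (Lam (A ⇒ X) fun h => Lam (F ⬝ h) fun k => Lam (F ⬝ h) fun k' =>
      funext (Fn fun z => setPath X t (h ⬝ pullbackFst A A B f f [z]) (h ⬝ pullbackSnd A A B f f [z])
        (k ⬝ z) (k' ⬝ z))
        (Pullback A A B f f) ◦ k k')
    u v (funext h A (Lam A fun _ => X) (fst (A ⇒ X) F u) (fst (A ⇒ X) F v)))).decl 185

/-- The element of `FibEq` that is given by an element of the equaliser. -/
def fibEqOf (A B f b X u : Bd) : Bd := Hd 186 l0 lz [A, B, f, b, X, u]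
def dFibEqOf := (fibHyp fun A B f b X => arg (Equaliser A B f X) fun u =>
  let F : Bd := AgreeFam A B f X
  ret (FibEq A B f b X) (pair
    (Lam A fun a => Lam (Id B (f ⬝ a) b) fun p => fst (A ⇒ X) F u ⬝ a)
    (Lam A fun a => Lam (Id B (f ⬝ a) b) fun p => Lam A fun a' => Lam (Id B (f ⬝ a') b) fun p' =>
      -- Two points over the same `b` give the point `(a, a', p · p'⁻¹)` of the pullback, where the
      -- two restrictions agree.
      snd (A ⇒ X) F u ⬝ mkPullback A A B f f a a' (trans p (inv p')))
    (FibFun A B f b X) (IndepFam A B f b X))).decl 186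

def equaliserOfFibEq (A B f X t e : Bd) : Bd := Hd 187 l0 lz [A, B, f, X, t, e]
def dEqualiserOfFibEq := (mapSetHyp fun A B f X t =>
  arg (Pi B fun b => isEquiv X (FibEq A B f b X) (fibEqConst A B f b X)) fun e =>
  let F : Bd := AgreeFam A B f X
  let E : Bd := Equaliser A B f X
  let m : Bd := equaliserMap A B f X
  -- The value at `b` is the element of `X` that corresponds to the restriction of `u` to the fibre
  -- over `b`.
  let r (u : Bd) : Bd := Lam B fun b => eqInv (e ⬝ b) (fibEqOf A B f b X u)
  ret (isEquiv (B ⇒ X) E m)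
    (mkEquiv (B ⇒ X) E m (Lam E fun u => r u)
      (Lam E fun u => eqPath A B f X t (m ⬝ r u) u (Lam A fun a =>
        let b : Bd := f ⬝ a
        ap (Lam (FibEq A B f b X) fun k =>
            fst (FibFun A B f b X) (IndepFam A B f b X) k ⬝ a ⬝ refl B b)
          (eqSec (e ⬝ b) (fibEqOf A B f b X u)) (FibEq A B f b X) X))
      (Lam (B ⇒ X) fun g => funext (Lam B fun b =>
          trans (ap (Lam (FibEq A B f b X) fun k => eqInv (e ⬝ b) k)
            (fibEqPath A B f b X t (fibEqOf A B f b X (m ⬝ g)) (fibEqConst A B f b X ⬝ (g ⬝ b))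
              (Lam A fun a => Lam (Id B (f ⬝ a) b) fun p => ap g p)))
            (eqRet (e ⬝ b) (g ⬝ b)))
        B (Lam B fun _ => X) (r (m ⬝ g)) g))).decl 187

def fibEqOfEqualiser (A X t e : Bd) : Bd := Hd 188 l0 lz [A, X, t, e]
def dFibEqOfEqualiser := (arg (U l0) fun A => arg (U l0) fun X => arg (isTruncSubTwo two X) fun t =>
  let f : Bd := ToUnit A
  let F : Bd := AgreeFam A Unit f X
  let E : Bd := Equaliser A Unit f X
  let m : Bd := equaliserMap A Unit f X
  let D : Bd := Lam A fun _ => Id Unit star star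
  let G : Bd := FibFun A Unit f star X
  let H : Bd := IndepFam A Unit f star X
  let K : Bd := FibEq A Unit f star X
  let c : Bd := fibEqConst A Unit f star X
  let r : Bd := Lam E fun u => fibEqOf A Unit f star X u
  let q : Bd := refl Unit star
  let P : Bd := Pullback A A Unit f f
  let s (k : Bd) : Bd := mk (A ⇒ X) (fun h => Agree A Unit f X h) (Lam A fun a => fst G H k ⬝ a ⬝ q)
    (Lam P fun z => snd G H k ⬝ pullbackFst A A Unit f f [z] ⬝ q ⬝ pullbackSnd A A Unit f f [z] ⬝ q)
  arg (isEquiv (Unit ⇒ X) E m) fun e =>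
  ret (isEquiv X K c)
    (isEquivHtpy X K (Lam X fun x => r ⬝ (m ⬝ (Const Unit X ⬝ x))) c
      -- The composite agrees with the constant map in its functions but not in its proofs of
      -- independence, so it is corrected by a homotopy.
      (Lam X fun x => fibEqPath A Unit f star X t (r ⬝ (m ⬝ (Const Unit X ⬝ x))) (c ⬝ x)
        (Lam A fun a => Lam (D ⬝ a) fun p => refl X x))
      (isEquivComp (Const Unit X) (Lam (Unit ⇒ X) fun g => r ⬝ (m ⬝ g))
        (unitConst X) (isEquivComp m r e
          (mkEquiv E K r (Lam K fun k => s k)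
            (Lam K fun k => fibEqPath A Unit f star X t (r ⬝ s k) k
              (Lam A fun a => Lam (D ⬝ a) fun p => snd G H k ⬝ a ⬝ q ⬝ a ⬝ p))
            (Lam E fun u => eqPath A Unit f X t (s (r ⬝ u)) u
              (Lam A fun a => refl X (fst (A ⇒ X) F u ⬝ a)))))))).decl 188

def dSetSheafCondition := (arg (U l2) fun I => arg (I ⇒ U l0) fun T =>
  arg (U l0) fun X => arg (isTruncSubTwo two X) fun t =>
  let S : Bd := isSheaf I T X
  let C : Bd := Pi (U l0) fun A => Pi (U l0) fun B => Pi (A ⇒ B) fun f => isCover I T A B f ⇒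
    isEquiv (B ⇒ X) (Equaliser A B f X) (equaliserMap A B f X)
  ret (Iff S C l3)
    (mk (S ⇒ C) (fun _ => C ⇒ S)
      (Lam S fun s => Fn fun A => Fn fun B => Fn fun f => Fn fun c =>
        equaliserOfFibEq A B f X t (Lam B fun b =>
          equivOfLocal (Fib' A B f b) X (FibEq A B f b X) (fibEqConst A B f b X)
            (Lam (Fib' A B f b) fun p => fibEqEquiv A B f b X t p)
            (localOfCover I T X s A B f c b) (fibEqLocal A B f b X t)))
      (Lam C fun e => sheafOfLocal I T X (Lam I fun x =>
        let Y := T ⬝ x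
        let f := ToUnit Y
        localOfUnit Y X (localOfEquiv (Fib' Y Unit f star) X (FibEq Y Unit f star X)
          (fibEqConst Y Unit f star X)
          (fibEqOfEqualiser Y X t (e ⬝ Y ⬝ Unit ⬝ f ⬝ unitCover I T x))
          (fibEqLocal Y Unit f star X t)))) l3)).decl 189 true

def setItems : List Item := [.t dSetPath, .f dIndep, .t dFibEqPath, .t dFibEqEquiv, .t dFibEqLocal,
  .t dEqPath, .f dFibEqOf, .t dEqualiserOfFibEq, .t dFibEqOfEqualiser, .t dSetSheafCondition]

end HoTT.Check

/-! ### Return to the formal system. -/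

namespace HoTT.Check

/-! ## Comparison with the formal system -/

/-- The transcriptions agree with the formal system by evaluation, for symbolic levels. Only the
universe `U 0` needs the convention that level variable `2` has value zero. -/
theorem eqns_baseItems : Eqns baseItems [] := by
  have univ (β : ℕ → ℕ) (h : β 2 = 0) : Tm.univ (β 2) = Tm.univ 0 := congrArg Tm.univ h
  refine ⟨⟨univ, trivial⟩, ⟨fun _ _ => rfl, trivial⟩, ⟨univ, trivial⟩, ⟨fun _ _ => rfl, trivial⟩,
    ⟨fun _ _ => rfl, fun _ _ => ⟨rfl, rfl, rfl⟩, trivial⟩, ⟨univ, trivial⟩, ⟨fun _ _ => rfl, trivial⟩,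
    ⟨fun _ _ => rfl, trivial⟩,
    ⟨fun _ _ => rfl, fun _ _ => ⟨rfl, rfl, rfl⟩, fun _ _ => ⟨rfl, rfl, rfl⟩, trivial⟩, ?_⟩
  refine ⟨⟨fun _ _ => rfl, trivial⟩, ⟨fun _ _ => rfl, trivial⟩,
    ⟨fun _ _ => rfl, fun _ _ => ⟨rfl, rfl, rfl⟩, trivial⟩, ⟨fun _ _ => rfl, trivial⟩,
    ⟨fun _ _ => rfl, trivial⟩, ⟨fun _ _ => rfl, fun _ _ => ⟨rfl, rfl, rfl⟩, trivial⟩, ?_⟩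
  refine ⟨trivial, trivial, trivial, trivial, trivial, trivial, trivial, trivial, trivial, trivial,
    trivial, ?_⟩
  refine ⟨⟨fun _ _ => rfl, trivial⟩, ⟨fun _ _ => rfl, trivial⟩, ⟨fun _ _ => rfl, trivial⟩,
    ⟨fun _ _ => rfl, trivial⟩, ⟨fun _ _ => rfl, trivial⟩, ⟨fun _ _ => rfl, trivial⟩,
    ⟨fun _ _ => rfl, fun _ _ => ⟨rfl, rfl, rfl⟩, fun _ _ => ⟨rfl, rfl, rfl⟩, trivial⟩,
    ⟨fun _ _ => rfl, trivial⟩, ?_⟩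
  refine ⟨⟨fun _ _ => rfl, trivial⟩, ⟨fun _ _ => rfl, trivial⟩, ⟨fun _ _ => rfl, trivial⟩,
    ⟨fun _ _ => rfl, fun _ _ => ⟨rfl, rfl, rfl⟩, trivial⟩, ?_⟩
  refine ⟨⟨fun _ _ => rfl, trivial⟩, ⟨fun _ _ => rfl, trivial⟩, ⟨fun _ _ => rfl, trivial⟩,
    ⟨fun _ _ => rfl, trivial⟩, ⟨fun _ _ => rfl, trivial⟩, ⟨fun _ _ => rfl, trivial⟩,
    ⟨fun _ _ => rfl, fun _ _ => ⟨rfl, rfl, rfl⟩, trivial⟩, trivial⟩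

def env0 : Env := addAll baseItems []
def env1 : Env := addAll sheafItems env0
def env2 : Env := addAll pathItems env1
def env3 : Env := addAll equivItems env2
def env4 : Env := addAll joinItems env3
def env5 : Env := addAll powItems env4
def env6 : Env := addAll nullItems env5

/-- The values of the level variables for a collection of types in `U i` that is indexed by a type
in `U j`. -/
def levels (i j : ℕ) : ℕ → ℕ
  | 0 => i
  | 1 => max i j
  | 3 => j
  | 4 => max (i + 1) j
  | 5 => max (i + 1) j
  | _ => 0

theorem good_levels (i j : ℕ) : Good true (levels i j) := by
  refine ⟨rfl, fun b => ?_, fun _ => ⟨rfl, rfl⟩⟩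
  change _ ≤ max (i + 1) j
  unfold levels
  split <;> omega

def env7 : Env := addAll sheafThmItems env6

set_option maxRecDepth 100000 in
-- The type is erased as written, before elaboration, and every definition in it denotes the given
-- raw term; hence evaluation suffices.
theorem sheafCondition_eq (i j : ℕ) :
    er env7 (levels i j) dSheafCondition.ty = (sheafCondition i j).close := rfl

set_option maxRecDepth 100000 in
theorem setSheafCondition_eq (i j : ℕ) :
    er (addAll setItems env7) (levels i j) dSetSheafCondition.ty = (setSheafCondition i j).close := rfl

end HoTT.Check

namespace HoTT.Check

/-- Here the checker runs, in the kernel, on all declarations of each list. -/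
theorem okAll_baseItems : okAll baseItems [] = true := by decide +kernel
theorem okAll_sheafItems : okAll sheafItems env0 = true := by decide +kernel
theorem okAll_pathItems : okAll pathItems env1 = true := by decide +kernel
theorem okAll_equivItems : okAll equivItems env2 = true := by decide +kernel
theorem okAll_joinItems : okAll joinItems env3 = true := by decide +kernel
theorem okAll_powItems : okAll powItems env4 = true := by decide +kernel
theorem okAll_nullItems : okAll nullItems env5 = true := by decide +kernel
theorem okAll_sheafThmItems : okAll sheafThmItems env6 = true := by decide +kernel
theorem okAll_setItems : okAll setItems env7 = true := by decide +kernel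

theorem envOk_env7 : EnvOk env7 := by
  have h0 : EnvOk env0 := envOk_nil.addAll okAll_baseItems eqns_baseItems
  -- These lists contain no primitive constants, so the comparison with the formal system is vacuous
  -- for them.
  have h1 : EnvOk env1 := h0.addAll okAll_sheafItems (by repeat constructor)
  have h2 : EnvOk env2 := h1.addAll okAll_pathItems (by repeat constructor)
  have h3 : EnvOk env3 := h2.addAll okAll_equivItems (by repeat constructor)
  have h4 : EnvOk env4 := h3.addAll okAll_joinItems (by repeat constructor)
  have h5 : EnvOk env5 := h4.addAll okAll_powItems (by repeat constructor)
  have h6 : EnvOk env6 := h5.addAll okAll_nullItems (by repeat constructor)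
  exact h6.addAll okAll_sheafThmItems (by repeat constructor)

theorem envOk_env8 : EnvOk (addAll setItems env7) :=
  envOk_env7.addAll okAll_setItems (by repeat constructor)

end HoTT.Check

namespace HoTT.Check

/-- The denotation of a valid declaration is a closed term with a derivation at its elaborated type,
and this type erases like the written one. This is where the required element comes from. -/
theorem isTheorem_of_thm {V W : Env} (hV : EnvOk V) {d : Decl} (hd : V.find d.key = some (d.thm W))
    (ht : (d.tyE W).beq d.ty = true) {β : ℕ → ℕ} (hβ : Good d.amb β) {A : Term}
    (hA : er V β d.ty = A.close) : IsTheorem A := by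
  have := (hV.entry _ _ hd).den β hβ
  change Derivable (.of [] _ (er V β (d.tyE W))) at this
  rw [er_beq ht, hA] at this
  exact ⟨_, this⟩

/-- The signature is the one in which the last declaration of the list was elaborated, with the
twelve that precede it. -/
theorem beq_sheafCondition : (dSheafCondition.tyE (addAll (sheafThmItems.take 12) env6)).beq
    dSheafCondition.ty = true := by decide +kernel

theorem beq_setSheafCondition : (dSetSheafCondition.tyE (addAll (setItems.take 9) env7)).beq
    dSetSheafCondition.ty = true := by decide +kernel

theorem isTheorem_sheafCondition (i j : ℕ) : IsTheorem (sheafCondition i j) :=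
  isTheorem_of_thm envOk_env7 (W := addAll (sheafThmItems.take 12) env6) rfl beq_sheafCondition
    (good_levels i j) (sheafCondition_eq i j)

theorem isTheorem_setSheafCondition (i j : ℕ) : IsTheorem (setSheafCondition i j) :=
  isTheorem_of_thm envOk_env8 (W := addAll (setItems.take 9) env7) rfl beq_setSheafCondition
    (good_levels i j) (setSheafCondition_eq i j)

end HoTT.Check

end

/-- In homotopy type theory, for all universe levels `i` of the types and `j` of the index type of
the collection `T`, the sheaf condition is a theorem, and so is its form for sets. -/
theorem mainTheorem1 (i j : ℕ) :
    HoTT.IsTheorem (HoTT.sheafCondition i j) ∧ HoTT.IsTheorem (HoTT.setSheafCondition i j) :=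
  ⟨HoTT.Check.isTheorem_sheafCondition i j, HoTT.Check.isTheorem_setSheafCondition i j⟩
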